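/- Let $\Omega\subset\mathbb{R}^2$ be a bounded open set with smooth boundary, and let $G_\Omega$ be its Green's function with zero Dirichlet boundary conditions, that is, $$G_\Omega(x,y)=\frac{1}{2\pi}\log|x-y|^{-1}+g_\Omega(x,y),$$ where $g_\Omega$ is symmetric and, for each $y\in\Omega$, the function $x\mapsto g_\Omega(x,y)$ is harmonic in $\Omega$, continuous on $\overline\Omega$, and equal to $-\frac{1}{2\pi}\log|x-y|^{-1}$ for $x\in\partial\Omega$. For $n\ge 3$, $\alpha_1,\dots,\alpha_n\in(-\sqrt{4\pi},\sqrt{4\pi})$ and complex-valued $f_3,\dots,f_n\in C_c^\infty(\Omega)$, write $\|\alpha\|=\max_{1\le i\le n}|\alpha_i|$ and, for distinct $x_1,x_2\in\Omega$, $$H_n(x_1,x_2)=\int_{\Omega^{n-2}}d^2x_3\cdots d^2x_n\,\prod_{j=3}^n f_j(x_j)\;e^{-\sum_{1\le k<l\le n}\alpha_k\alpha_l G_\Omega(x_k,x_l)}.$$ Then for each compact $K\subset\Omega$ there exists a constant $C>0$, depending only on $K$, $\Omega$, $\|\alpha\|$, $\bigcup_{i=3}^n\mathrm{supp}(f_i)$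 and $\max_i\|f_i\|_{L^\infty(\Omega)}$ (in particular not otherwise on $n$), such that for all $x_1,x_2\in K$ with $x_1\ne x_2$ the integral defining $H_n(x_1,x_2)$ converges absolutely and $$|H_n(x_1,x_2)|\le |x_1-x_2|^{-\frac{\|\alpha\|^2}{2\pi}}\,C^n\,n^{\frac{\|\alpha\|^2}{8\pi}n}.$$ -/

import Mathlib

open MeasureTheory InnerProductSpace
open scoped ENNReal ContDiff

/-- The boundary of the planar open set `Ω` is smooth: near each of its boundary points, `Ω` is
the set where a smooth real function with non-vanishing derivative is negative.
The plane `ℝ²` is identified with `ℂ` throughout. -/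
def HasSmoothBoundary (Ω : Set ℂ) : Prop :=
  ∀ p ∈ frontier Ω, ∃ (U : Set ℂ) (ρ : ℂ → ℝ), IsOpen U ∧ p ∈ U ∧ ContDiffOn ℝ ∞ ρ U ∧
    fderiv ℝ ρ p ≠ 0 ∧ Ω ∩ U = {z | z ∈ U ∧ ρ z < 0}

/-- `g` is the regular part of the Dirichlet Green's function of `Ω`: for each `y ∈ Ω`, the
function `x ↦ g x y` is the classical solution of the Dirichlet problem in `Ω` with boundary
values `-(1 / 2π) log |x - y|⁻¹`, and `g` is symmetric. -/
structure IsGreenRegularPart (Ω : Set ℂ) (g : ℂ → ℂ → ℝ) : Prop where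
  harmonic : ∀ y ∈ Ω, HarmonicContOnCl (fun x => g x y) Ω
  boundary : ∀ y ∈ Ω, ∀ x ∈ frontier Ω, g x y = -((2 * Real.pi)⁻¹ * Real.log ‖x - y‖⁻¹)
  symm : ∀ x ∈ Ω, ∀ y ∈ Ω, g x y = g y x

/-- The regular part is determined by `Ω` on `closure Ω × Ω`. -/
theorem IsGreenRegularPart.unique {Ω : Set ℂ} (hΩ : IsOpen Ω) (hb : Bornology.IsBounded Ω)
    {g g' : ℂ → ℂ → ℝ} (hg : IsGreenRegularPart Ω g) (hg' : IsGreenRegularPart Ω g')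
    {x y : ℂ} (hx : x ∈ closure Ω) (hy : y ∈ Ω) : g x y = g' x y := by
  have key : ∀ h : ℂ → ℝ, HarmonicContOnCl h Ω → (∀ z ∈ frontier Ω, h z = 0) →
      ∀ z ∈ closure Ω, h z ≤ 0 := by
    intro h hh h0 z hz
    by_contra! hpos
    have hc : IsCompact (closure Ω) := hb.isCompact_closure
    obtain ⟨m, hm, hmax⟩ := hc.exists_isMaxOn ⟨z, hz⟩ hh.continuousOn
    have hmpos : 0 < h m := lt_of_lt_of_le hpos (hmax hz)
    -- among the maximum points, one with the largest real part
    have hA : IsCompact (closure Ω ∩ h ⁻¹' {h m}) :=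
      hc.of_isClosed_subset
        (hh.continuousOn.preimage_isClosed_of_isClosed isClosed_closure isClosed_singleton)
        Set.inter_subset_left
    obtain ⟨a, ⟨ha, ham⟩, hamax⟩ := hA.exists_isMaxOn ⟨m, hm, rfl⟩
      Complex.continuous_re.continuousOn
    have ham' : h a = h m := ham
    have haΩ : a ∈ Ω := by
      by_contra hna
      have : a ∈ frontier Ω := by
        rw [hΩ.frontier_eq]; exact ⟨ha, hna⟩
      have := h0 a this
      linarith
    obtain ⟨r, hr, hball⟩ := Metric.isOpen_iff.1 hΩ a haΩ
    obtain ⟨F, hF, hFe⟩ :=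
      HarmonicOnNhd.exists_analyticOnNhd_ball_re_eq (hh.harmonicOnNhd.mono hball)
    have hr2 : Metric.closedBall a (r / 2) ⊆ Metric.ball a r :=
      Metric.closedBall_subset_ball (by linarith)
    have hd : DiffContOnCl ℂ (fun w => Complex.exp (F w)) (Metric.ball a (r / 2)) := by
      apply DifferentiableOn.diffContOnCl
      intro w hw
      rw [closure_ball _ (by linarith)] at hw
      exact (hF w (hr2 hw)).differentiableAt.cexp.differentiableWithinAt
    have hre : ∀ w ∈ Metric.ball a r, (F w).re = h w := fun w hw => hFe hw
    have hmx : IsMaxOn (norm ∘ fun w => Complex.exp (F w)) (Metric.ball a (r / 2)) a := by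
      intro w hw
      have hw' := Metric.ball_subset_ball (by linarith : r / 2 ≤ r) hw
      simp only [Set.mem_ofPred_eq, Function.comp, Complex.norm_exp]
      rw [hre w hw', hre a (Metric.mem_ball_self hr), ham']
      exact Real.exp_le_exp.2 (hmax (subset_closure (hball hw')))
    have heq := Complex.norm_eqOn_closedBall_of_isMaxOn hd hmx
    have hp : a + (r / 2 : ℝ) ∈ Metric.closedBall a (r / 2) := by
      simp [abs_of_pos hr]
    have hp' := hr2 hp
    have h1 := heq hp
    simp only [Function.comp, Complex.norm_exp, Real.exp_eq_exp, Function.const] at h1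
    rw [hre _ hp', hre a (Metric.mem_ball_self hr), ham'] at h1
    have h2 := hamax (show a + (r / 2 : ℝ) ∈ closure Ω ∩ h ⁻¹' {h m} from
      ⟨subset_closure (hball hp'), h1⟩)
    simp at h2
    linarith
  have hd : ∀ g₁ g₂ : ℂ → ℂ → ℝ, IsGreenRegularPart Ω g₁ → IsGreenRegularPart Ω g₂ →
      g₁ x y ≤ g₂ x y := by
    intro g₁ g₂ h₁ h₂
    have := key (fun z => g₁ z y - g₂ z y)
      ⟨(h₁.harmonic y hy).harmonicOnNhd.sub (h₂.harmonic y hy).harmonicOnNhd,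
        (h₁.harmonic y hy).continuousOn.sub (h₂.harmonic y hy).continuousOn⟩
      (fun z hz => by simp [h₁.boundary y hy z hz, h₂.boundary y hy z hz]) x hx
    simpa using this
  exact le_antisymm (hd g g' hg hg') (hd g' g hg' hg)

open Classical in
/-- The Green's function `G_Ω(x, y) = (1 / 2π) log |x - y|⁻¹ + g_Ω(x, y)` of `Ω` with zero
Dirichlet boundary conditions, for `x, y ∈ Ω` distinct. A bounded open set with smooth boundary
has a regular part `g_Ω`, and the preceding lemma says that it is unique; only for sets without
one is the second branch used. -/
noncomputable def greenFunction (Ω : Set ℂ) (x y : ℂ) : ℝ :=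
  if h : ∃ g, IsGreenRegularPart Ω g then
    (2 * Real.pi)⁻¹ * Real.log ‖x - y‖⁻¹ + h.choose x y
  else 0

/-- `f ∈ C_c^∞(Ω)`, complex valued. -/
def IsTestFunction (Ω : Set ℂ) (f : ℂ → ℂ) : Prop :=
  ContDiff ℝ ∞ f ∧ HasCompactSupport f ∧ tsupport f ⊆ Ω

/-- The Boltzmann weight `exp (-∑_{k < l} α_k α_l G_Ω(x_k, x_l))` of `n` charges. -/
noncomputable def coulombWeight (Ω : Set ℂ) {n : ℕ} (α : Fin n → ℝ) (x : Fin n → ℂ) : ℝ :=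
  Real.exp (-∑ k, ∑ l ∈ Finset.Ioi k, α k * α l * greenFunction Ω (x k) (x l))

/-- The integrand of `coulombTwoPoint` as a function of the free points `y = (x_3, …, x_n)`, where
`n = m + 2`; the test functions are `f = (f_3, …, f_n)`. -/
noncomputable def coulombIntegrand (Ω : Set ℂ) {m : ℕ} (α : Fin (m + 2) → ℝ)
    (f : Fin m → ℂ → ℂ) (x₁ x₂ : ℂ) (y : Fin m → ℂ) : ℂ :=
  (∏ j, f j (y j)) * (coulombWeight Ω α (Fin.cons x₁ (Fin.cons x₂ y)) : ℂ)

/-- `H_n(x_1, x_2)` for `n = m + 2`: all points but the first two are integrated over `Ω`. -/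
noncomputable def coulombTwoPoint (Ω : Set ℂ) {m : ℕ} (α : Fin (m + 2) → ℝ)
    (f : Fin m → ℂ → ℂ) (x₁ x₂ : ℂ) : ℂ :=
  ∫ y in Set.univ.pi (fun _ : Fin m => Ω), coulombIntegrand Ω α f x₁ x₂ y

/-! Put `β = ‖α‖² / (4π)`, so that `β < 1`, and let `D_k` be the distance from `x_k` to its nearest
neighbour.

The pointwise estimate is Onsager's. Smear each charge into a smooth radial density on a disc of
radius `r_k`, the discs being disjoint and contained in `Ω`. By the mean value property the
interactions between different charges do not change, while the total Dirichlet energy is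
nonnegative. Hence minus the interaction energy is at most the sum of the self-energies, which grow
like `log (1 / r_k)`. Taking `r_k = min (D_k / 3) δ` and `s = n ^ (-1/2)`, the typical spacing of
`n` points, bounds the Boltzmann weight by `C ^ n * s ^ (-β n) * ∏ max(1, s / D_k) ^ β`. The power
`s ^ (-β n) = n ^ (‖α‖² n / 8π)` is the growth in the claim. This is
`exists_coulombWeight_le_prod_max`.

It remains to integrate the product over all points but two, with a bound `C ^ n * (1 + |x₁ - x₂| ^
(-2β))`; this is `lmarginal_prod_max_le`. Only points with `D_k ≤ s` matter, and there are `2 ^ n`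
sets of such points. From such a set remove a point with largest nearest neighbour distance, or a
mutual nearest pair, without altering the distances of the others (`exists_removable`). A pair
carries `(s / d) ^ (2β)`, which is locally integrable in the plane because `β < 1`. If the largest
distance is cut off at `t` and the bound is allowed to grow like `exp (n (t / s) ^ (2 - 2β))`,
integrating one relative coordinate gains a constant times `s² / n = n ^ (-2)`, which pays for the
at most `n²` choices of pair. Removals involving the two fixed points gain less, but there are fewer
of them; they produce the singular factor. The resulting induction is `nnBound_pow`. -/

/-! ### Nearest neighbour distances and the removal of extremal points. -/

section NearestNeighbour

variable {ι : Type*} [DecidableEq ι]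

/-- The distance from `x i` to the other points of the configuration `x` with index in `A`. -/
noncomputable def nnDist (A : Finset ι) (x : ι → ℂ) (i : ι) : ℝ≥0∞ :=
  ⨅ j ∈ A.erase i, edist (x i) (x j)

/-- The product over `A` of the weights `(s / D) ^ β`, where `D` is the distance to the nearest
neighbour in `A`, on the set where all these distances are at most `t`. -/
noncomputable def nnWeight (s : ℝ≥0∞) (β : ℝ) (A : Finset ι) (t : ℝ≥0∞) (x : ι → ℂ) : ℝ≥0∞ :=
  ∏ i ∈ A, if nnDist A x i ≤ t then (s / nnDist A x i) ^ β else 0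

lemma nnDist_le {A : Finset ι} {x : ι → ℂ} {i j : ι} (hj : j ∈ A) (hij : j ≠ i) :
    nnDist A x i ≤ edist (x i) (x j) :=
  iInf₂_le (f := fun j (_ : j ∈ A.erase i) => edist (x i) (x j)) j (Finset.mem_erase.2 ⟨hij, hj⟩)

lemma nnDist_anti {A A' : Finset ι} (h : A' ⊆ A) (x : ι → ℂ) (i : ι) :
    nnDist A x i ≤ nnDist A' x i :=
  biInf_mono fun _ hj => Finset.erase_subset_erase _ h hj

lemma exists_nnDist_eq {A : Finset ι} {x : ι → ℂ} {i : ι} (h : nnDist A x i ≠ ⊤) :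
    ∃ j ∈ A, j ≠ i ∧ nnDist A x i = edist (x i) (x j) := by
  have hne : (A.erase i).Nonempty := by
    by_contra hne
    rw [Finset.not_nonempty_iff_eq_empty] at hne
    exact h (by simp [nnDist, hne])
  obtain ⟨j, hj, hmin⟩ := Finset.exists_min_image (A.erase i) (fun j => edist (x i) (x j)) hne
  refine ⟨j, Finset.mem_of_mem_erase hj, Finset.ne_of_mem_erase hj, le_antisymm ?_ ?_⟩
  · exact nnDist_le (Finset.mem_of_mem_erase hj) (Finset.ne_of_mem_erase hj)
  · exact le_iInf₂ hmin

lemma nnDist_eq_of_subset {A A' : Finset ι} {x : ι → ℂ} {i j : ι} (h : A' ⊆ A) (hj : j ∈ A')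
    (hij : j ≠ i) (hD : nnDist A x i = edist (x i) (x j)) : nnDist A' x i = nnDist A x i :=
  le_antisymm (hD ▸ nnDist_le hj hij) (nnDist_anti h x i)

lemma nnWeight_eq_of_le {s : ℝ≥0∞} {β : ℝ} {A : Finset ι} {t : ℝ≥0∞} {x : ι → ℂ}
    (h : ∀ i ∈ A, nnDist A x i ≤ t) :
    nnWeight s β A t x = ∏ i ∈ A, (s / nnDist A x i) ^ β :=
  Finset.prod_congr rfl fun i hi => if_pos (h i hi)

/-- Among the points whose nearest neighbour is farthest away, there is either one whose removal
does not change the nearest neighbour distances of the other points, or a pair of mutual nearest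
neighbours with this property. -/
lemma exists_removable {A : Finset ι} (hA : A.Nonempty) {x : ι → ℂ}
    (h : ∀ i ∈ A, nnDist A x i ≠ ⊤) :
    (∃ i ∈ A, (∀ k ∈ A, nnDist A x k ≤ nnDist A x i) ∧
      ∀ k ∈ A.erase i, nnDist (A.erase i) x k = nnDist A x k) ∨
    ∃ i ∈ A, ∃ j ∈ A.erase i, (∀ k ∈ A, nnDist A x k ≤ edist (x i) (x j)) ∧
      nnDist A x i = edist (x i) (x j) ∧ nnDist A x j = edist (x i) (x j) ∧
      ∀ k ∈ (A.erase i).erase j, nnDist ((A.erase i).erase j) x k = nnDist A x k := by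
  classical
  obtain ⟨i₀, hi₀, hmax⟩ := Finset.exists_max_image A (nnDist A x) hA
  set m := nnDist A x i₀ with hm
  by_cases hc : ∃ i ∈ A, nnDist A x i = m ∧
      ∀ k ∈ A.erase i, nnDist (A.erase i) x k = nnDist A x k
  · obtain ⟨i, hi, him, hk⟩ := hc
    exact Or.inl ⟨i, hi, fun k hk => him ▸ hmax k hk, hk⟩
  right
  push Not at hc
  -- When every removal of a point of `T` disturbs another point, each `i` in `T` is the unique
  -- nearest neighbour of some `κ i`, again in `T`. Uniqueness makes `κ` injective, hence a
  -- permutation of the finite set `T`.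
  set T := A.filter fun i => nnDist A x i = m with hT
  have key : ∀ i : T, ∃ k : T, (k : ι) ≠ i ∧ edist (x k) (x i) = m ∧
      ∀ j ∈ A, j ≠ k → j ≠ i → m < edist (x k) (x j) := by
    rintro ⟨i, hi⟩
    obtain ⟨hiA, him⟩ := Finset.mem_filter.1 hi
    obtain ⟨k, hk, hne⟩ := hc i hiA him
    have hkA := Finset.mem_of_mem_erase hk
    have hki := Finset.ne_of_mem_erase hk
    have hlt : nnDist A x k < nnDist (A.erase i) x k :=
      lt_of_le_of_ne (nnDist_anti (Finset.erase_subset _ _) x k) hne.symm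
    obtain ⟨j, hj, hjk, hD⟩ := exists_nnDist_eq (h k hkA)
    have hji : j = i := by
      by_contra hji
      exact hne (nnDist_eq_of_subset (Finset.erase_subset _ _)
        (Finset.mem_erase.2 ⟨hji, hj⟩) hjk hD)
    subst hji
    have hkm : nnDist A x k = m := by
      refine le_antisymm (hmax k hkA) ?_
      rw [← him, hD, edist_comm]
      exact nnDist_le hkA hki
    refine ⟨⟨k, Finset.mem_filter.2 ⟨hkA, hkm⟩⟩, hki, hD ▸ hkm, fun l hl hlk hlj => ?_⟩
    refine hkm.symm.trans_lt ?_
    exact hlt.trans_le (nnDist_le (Finset.mem_erase.2 ⟨hlj, hl⟩) hlk)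
  choose κ hκne hκm hκ using key
  have hinj : Function.Injective κ := by
    intro i i' hii
    by_contra hne
    have h1 := hκ i i' (Finset.mem_filter.1 i'.2).1
      (fun h => hκne i' (by rw [← hii]; exact h.symm)) (fun h => hne (Subtype.ext h.symm))
    rw [hii, hκm i'] at h1
    exact lt_irrefl _ h1
  have hsurj := Finite.surjective_of_injective hinj
  -- Choose `j₁` with `κ j₁ = i₀`. All points except `j₁` are farther than `m` from `i₀`, but `κ i₀`
  -- is at distance `m`, so `κ i₀ = j₁` and the pair is mutual. Any third point is farther than `m`
  -- from both, so neither is its nearest neighbour.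
  let i₁ : T := ⟨i₀, Finset.mem_filter.2 ⟨hi₀, rfl⟩⟩
  obtain ⟨j₁, hj₁⟩ := hsurj i₁
  have hback : κ i₁ = j₁ := by
    by_contra hne
    have h1 := hκ j₁ (κ i₁) (Finset.mem_filter.1 (κ i₁).2).1
      (by rw [hj₁]; exact hκne i₁) (fun h => hne (Subtype.ext h))
    rw [hj₁, edist_comm, hκm i₁] at h1
    exact lt_irrefl _ h1
  have hjA := (Finset.mem_filter.1 j₁.2).1
  have hjm := (Finset.mem_filter.1 j₁.2).2
  have hne : (j₁ : ι) ≠ i₀ := by have := hκne i₁; rwa [hback] at this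
  have hd : edist (x i₀) (x j₁) = m := by have := hκm j₁; rwa [hj₁] at this
  refine ⟨i₀, hi₀, j₁, Finset.mem_erase.2 ⟨hne, hjA⟩, fun k hk => hd ▸ hmax k hk,
    hd.symm ▸ rfl, hd.symm ▸ hjm, fun k hk => ?_⟩
  obtain ⟨hkj, hk⟩ := Finset.mem_erase.1 hk
  obtain ⟨hki, hkA⟩ := Finset.mem_erase.1 hk
  obtain ⟨l, hl, hlk, hD⟩ := exists_nnDist_eq (h k hkA)
  have hli : l ≠ i₀ := by
    rintro rfl
    have h1 := hκ j₁ k hkA (by rw [hj₁]; exact hki) hkj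
    rw [hj₁, edist_comm, ← hD] at h1
    exact absurd (hmax k hkA) (not_le.2 h1)
  have hlj : l ≠ j₁ := by
    rintro rfl
    have h1 := hκ i₁ k hkA (by rw [hback]; exact hkj) hki
    rw [hback, edist_comm, ← hD] at h1
    exact absurd (hmax k hkA) (not_le.2 h1)
  exact nnDist_eq_of_subset ((Finset.erase_subset _ _).trans (Finset.erase_subset _ _))
    (Finset.mem_erase.2 ⟨hlj, Finset.mem_erase.2 ⟨hli, hl⟩⟩) hlk hD

/-- Removing a point, or a pair of mutual nearest neighbours, whose nearest neighbour distance is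
largest. -/
lemma nnWeight_le_sum (s : ℝ≥0∞) (β : ℝ) {A : Finset ι} (hA : A.Nonempty) {t : ℝ≥0∞}
    (ht : t ≠ ⊤) (x : ι → ℂ) :
    nnWeight s β A t x ≤ ∑ i ∈ A, ∑ j ∈ A.erase i,
      ((if edist (x i) (x j) ≤ t then (s / edist (x i) (x j)) ^ β *
          nnWeight s β (A.erase i) (edist (x i) (x j)) x else 0) +
        if edist (x i) (x j) ≤ t then (s / edist (x i) (x j)) ^ β * (s / edist (x i) (x j)) ^ β *
          nnWeight s β ((A.erase i).erase j) (edist (x i) (x j)) x else 0) := by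
  by_cases h0 : ∀ i ∈ A, nnDist A x i ≤ t
  swap
  · push Not at h0
    obtain ⟨i, hi, hlt⟩ := h0
    have : nnWeight s β A t x = 0 := Finset.prod_eq_zero hi (if_neg (not_le.2 hlt))
    rw [this]; exact zero_le
  rw [nnWeight_eq_of_le h0]
  -- A point without neighbours has `nnDist` equal to `⊤`; the finite cutoff excludes this, so
  -- nearest neighbours exist.
  have htop : ∀ i ∈ A, nnDist A x i ≠ ⊤ := fun i hi => ne_top_of_le_ne_top ht (h0 i hi)
  have hsum : ∀ i ∈ A, ∀ j ∈ A.erase i, ∀ G : ι → ι → ℝ≥0∞,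
      G i j ≤ ∑ i ∈ A, ∑ j ∈ A.erase i, G i j := fun i hi j hj G =>
    (Finset.single_le_sum (f := fun j => G i j) (fun _ _ => zero_le) hj).trans
      (Finset.single_le_sum (f := fun i => ∑ j ∈ A.erase i, G i j) (fun _ _ => zero_le) hi)
  -- The extremal distance becomes the cutoff for the remaining points, whose own distances survive
  -- the removal.
  rcases exists_removable hA htop with ⟨i, hi, hmax, hk⟩ | ⟨i, hi, j, hj, hmax, hDi, hDj, hk⟩
  · obtain ⟨j, hj, hji, hD⟩ := exists_nnDist_eq (htop i hi)
    refine le_trans ?_ (hsum i hi j (Finset.mem_erase.2 ⟨hji, hj⟩) _)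
    refine le_trans (le_of_eq ?_) le_self_add
    rw [if_pos (hD ▸ h0 i hi), ← Finset.mul_prod_erase A _ hi, hD, nnWeight_eq_of_le]
    · congr 1
      exact Finset.prod_congr rfl fun k hk' => by rw [hk k hk']
    · intro k hk'
      rw [hk k hk', ← hD]
      exact hmax k (Finset.mem_of_mem_erase hk')
  · refine le_trans ?_ (hsum i hi j hj _)
    refine le_trans (le_of_eq ?_) le_add_self
    rw [if_pos (hDi ▸ h0 i hi), ← Finset.mul_prod_erase A _ hi, ← Finset.mul_prod_erase _ _ hj,
      hDi, hDj, nnWeight_eq_of_le, mul_assoc]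
    · congr 2
      exact Finset.prod_congr rfl fun k hk' => by rw [hk k hk']
    · intro k hk'
      rw [hk k hk']
      exact hmax k (Finset.mem_of_mem_erase (Finset.mem_of_mem_erase hk'))

/-- The points whose nearest neighbour is at distance at most `s` carry the whole weight. -/
lemma prod_max_le_sum_nnWeight [Fintype ι] {s : ℝ≥0∞} {β : ℝ} (hs0 : s ≠ 0) (hs : s ≠ ⊤)
    (hβ : 0 ≤ β) (x : ι → ℂ) :
    ∏ i, (max 1 (s / nnDist Finset.univ x i)) ^ β ≤
      ∑ A : Finset ι, nnWeight s β A s x := by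
  classical
  set A := Finset.univ.filter fun i => nnDist Finset.univ x i ≤ s with hA
  refine le_trans ?_ (Finset.single_le_sum (f := fun A => nnWeight s β A s x)
    (fun _ _ => zero_le) (Finset.mem_univ A))
  -- A nearest neighbour within distance `s` itself has a neighbour within distance `s`, so it
  -- belongs to `A`.
  have hD : ∀ i ∈ A, nnDist A x i = nnDist Finset.univ x i := by
    intro i hi
    have his := (Finset.mem_filter.1 hi).2
    obtain ⟨j, -, hji, hD⟩ := exists_nnDist_eq (ne_top_of_le_ne_top hs his)
    refine nnDist_eq_of_subset (Finset.subset_univ _) (Finset.mem_filter.2 ⟨Finset.mem_univ _, ?_⟩)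
      hji hD
    refine le_trans ?_ (hD ▸ his)
    rw [edist_comm]
    exact nnDist_le (Finset.mem_univ _) hji.symm
  rw [nnWeight_eq_of_le fun i hi => (hD i hi).trans_le (Finset.mem_filter.1 hi).2,
    ← Finset.prod_subset (Finset.subset_univ A)]
  · refine Finset.prod_le_prod' fun i hi => ?_
    rw [hD i hi]
    refine ENNReal.rpow_le_rpow (max_le ?_ le_rfl) hβ
    have his := (Finset.mem_filter.1 hi).2
    by_cases h0 : nnDist Finset.univ x i = 0
    · simp [h0, ENNReal.div_zero hs0]
    · rw [ENNReal.le_div_iff_mul_le (Or.inl h0) (Or.inl (ne_top_of_le_ne_top hs his)), one_mul]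
      exact his
  · intro i _ hi
    have : s < nnDist Finset.univ x i := by simpa [hA] using hi
    rw [max_eq_left, ENNReal.one_rpow]
    exact ENNReal.div_le_of_le_mul (by rw [one_mul]; exact this.le)

end NearestNeighbour

/-! ### Radial singular integrals in the plane. -/

section PlanarIntegrals

open Set

lemma lintegral_comp_norm_complex {g : ℝ → ℝ≥0∞} (hg : Measurable g) :
    ∫⁻ z : ℂ, g ‖z‖ = ENNReal.ofReal (2 * Real.pi) * ∫⁻ r in Ioi (0 : ℝ), ENNReal.ofReal r * g r := by
  rw [← Complex.lintegral_comp_polarCoord_symm, polarCoord_target]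
  have h1 : ∀ p ∈ Ioi (0 : ℝ) ×ˢ Ioo (-Real.pi) Real.pi,
      ENNReal.ofReal p.1 • g ‖Complex.polarCoord.symm p‖ = ENNReal.ofReal p.1 * g p.1 := by
    intro p hp
    rw [Complex.norm_polarCoord_symm, abs_of_pos hp.1, smul_eq_mul]
  rw [setLIntegral_congr_fun (measurableSet_Ioi.prod measurableSet_Ioo) h1,
    Measure.volume_eq_prod, setLIntegral_prod _ (by fun_prop)]
  simp only [lintegral_const, Measure.restrict_apply MeasurableSet.univ, univ_inter,
    Real.volume_Ioo]
  rw [lintegral_mul_const _ (by fun_prop), mul_comm]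
  congr 2
  ring

/-- The weight which makes the recursion for the nearest neighbour integrals close. -/
noncomputable def radialGrowth (lam s β : ℝ) (t : ℝ≥0∞) : ℝ≥0∞ :=
  ENNReal.ofReal (Real.exp (lam * (t.toReal / s) ^ (2 - 2 * β)))

@[fun_prop]
lemma measurable_radialGrowth (lam s β : ℝ) : Measurable (radialGrowth lam s β) := by
  unfold radialGrowth
  fun_prop

lemma one_le_radialGrowth {lam s : ℝ} (hlam : 0 ≤ lam) (hs : 0 ≤ s) (β : ℝ) (t : ℝ≥0∞) :
    1 ≤ radialGrowth lam s β t := by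
  rw [radialGrowth, ← ENNReal.ofReal_one]
  apply ENNReal.ofReal_le_ofReal
  apply Real.one_le_exp
  positivity

lemma radialGrowth_mono {lam s β : ℝ} (hlam : 0 ≤ lam) (hs : 0 ≤ s) (hβ : β ≤ 1) {t t' : ℝ≥0∞}
    (h : t ≤ t') (ht' : t' ≠ ⊤) : radialGrowth lam s β t ≤ radialGrowth lam s β t' := by
  apply ENNReal.ofReal_le_ofReal
  apply Real.exp_le_exp.2
  have := ENNReal.toReal_mono ht' h
  gcongr
  linarith

lemma radialGrowth_self {lam s : ℝ} (hs : 0 < s) (β : ℝ) :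
    radialGrowth lam s β (ENNReal.ofReal s) = ENNReal.ofReal (Real.exp lam) := by
  rw [radialGrowth, ENNReal.toReal_ofReal hs.le, div_self hs.ne', Real.one_rpow, mul_one]

/-- In polar coordinates the integrand `r (s / r) ^ (2β) E(r)` with `E(r) = exp (lam (r / s) ^ (2 -
2β))` is exactly `s² / ((2 - 2β) lam)` times `E'(r)`. Integration therefore reproduces the growth
weight and gains a factor `1 / lam`. -/
lemma lintegral_sq_mul_radialGrowth_le {lam s β : ℝ} (hlam : 0 < lam) (hs : 0 < s)
    (hβ1 : β < 1) {t : ℝ≥0∞} (ht : t ≠ ⊤) :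
    ∫⁻ u : ℂ, (if ‖u‖ₑ ≤ t then (ENNReal.ofReal s / ‖u‖ₑ) ^ β * (ENNReal.ofReal s / ‖u‖ₑ) ^ β *
      radialGrowth lam s β ‖u‖ₑ else 0) ≤
      ENNReal.ofReal (Real.pi * s ^ 2 / ((1 - β) * lam)) * radialGrowth lam s β t := by
  set τ := t.toReal with hτ
  have hτ0 : 0 ≤ τ := ENNReal.toReal_nonneg
  have htτ : t = ENNReal.ofReal τ := (ENNReal.ofReal_toReal ht).symm
  set γ := 2 - 2 * β with hγ
  have hγ0 : 0 < γ := by linarith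
  set E : ℝ → ℝ := fun r => Real.exp (lam * (r / s) ^ γ) with hE
  set E' : ℝ → ℝ := fun r => E r * (lam * (1 / s * γ * (r / s) ^ (γ - 1))) with hE'
  have hderiv : ∀ r ∈ Ioo 0 τ, HasDerivAt E (E' r) r := by
    intro r hr
    have h1 : HasDerivAt (fun r : ℝ => r / s) (1 / s) r := (hasDerivAt_id r).div_const s
    have h2 := h1.rpow_const (p := γ) (Or.inl (div_pos hr.1 hs).ne')
    exact (h2.const_mul lam).exp
  have hcont : ContinuousOn E (Icc 0 τ) := by
    apply Continuous.continuousOn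
    have : Continuous fun r : ℝ => (r / s) ^ γ :=
      (continuous_id.div_const s).rpow_const fun _ => Or.inr hγ0.le
    fun_prop
  have hpos : ∀ r ∈ Ioi (0 : ℝ), 0 ≤ E' r := by
    intro r hr
    have := mem_Ioi.1 hr
    have := (Real.exp_pos (lam * (r / s) ^ γ)).le
    simp only [hE', hE]
    positivity
  have hint := intervalIntegral.integrableOn_deriv_of_nonneg hcont hderiv fun r hr => hpos r hr.1
  have hFTC : ∫ r in (0 : ℝ)..τ, E' r = E τ - E 0 :=
    intervalIntegral.integral_eq_sub_of_hasDerivAt_of_le hτ0 hcont hderiv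
      ((intervalIntegrable_iff_integrableOn_Ioc_of_le hτ0).2 hint)
  set g : ℝ → ℝ≥0∞ := fun r => if r ≤ τ then
    (ENNReal.ofReal s / ENNReal.ofReal r) ^ β * (ENNReal.ofReal s / ENNReal.ofReal r) ^ β *
      ENNReal.ofReal (E r) else 0 with hg
  have hEm : Measurable E := by simp only [hE]; fun_prop
  have hgm : Measurable g := by
    apply Measurable.ite measurableSet_Iic _ measurable_const
    fun_prop
  have e1 : ∀ u : ℂ, (if ‖u‖ₑ ≤ t then (ENNReal.ofReal s / ‖u‖ₑ) ^ β *
      (ENNReal.ofReal s / ‖u‖ₑ) ^ β * radialGrowth lam s β ‖u‖ₑ else 0) = g ‖u‖ := by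
    intro u
    simp only [hg, htτ, ← ofReal_norm, radialGrowth, ENNReal.toReal_ofReal (norm_nonneg u),
      ENNReal.ofReal_le_ofReal_iff hτ0, hE, hγ]
  simp_rw [e1]
  rw [lintegral_comp_norm_complex hgm]
  set c := s ^ 2 / (γ * lam) with hc
  have hc0 : 0 ≤ c := by positivity
  have e2 : ∀ r ∈ Ioi (0 : ℝ), ENNReal.ofReal r * g r =
      (Ioc 0 τ).indicator (fun r => ENNReal.ofReal c * ENNReal.ofReal (E' r)) r := by
    intro r hr
    have hr0 : 0 < r := hr
    by_cases hrτ : r ≤ τ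
    · rw [indicator_of_mem (mem_Ioc.2 ⟨hr0, hrτ⟩)]
      simp only [hg, if_pos hrτ]
      rw [← ENNReal.ofReal_div_of_pos hr0, ENNReal.ofReal_rpow_of_pos (div_pos hs hr0),
        ← ENNReal.ofReal_mul (by positivity), ← ENNReal.ofReal_mul (by positivity),
        ← ENNReal.ofReal_mul hr0.le, ← ENNReal.ofReal_mul hc0]
      congr 1
      have : (s / r) ^ β * (s / r) ^ β = (r / s) ^ (γ - 1) * (s / r) := by
        rw [← inv_div r s, Real.inv_rpow (by positivity), ← Real.rpow_neg (by positivity),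
          ← Real.rpow_add (by positivity), ← Real.rpow_neg_one, ← Real.rpow_add (by positivity)]
        congr 1
        simp only [hγ]; ring
      rw [this]
      simp only [hE', hc]
      field_simp
    · rw [indicator_of_notMem (fun h => hrτ h.2)]
      simp [hg, hrτ]
  rw [setLIntegral_congr_fun measurableSet_Ioi e2, lintegral_indicator measurableSet_Ioc,
    Measure.restrict_restrict measurableSet_Ioc,
    inter_eq_left.2 (Ioc_subset_Ioi_self : Ioc 0 τ ⊆ Ioi 0),
    lintegral_const_mul _ (by simp only [hE']; fun_prop), ← ofReal_integral_eq_lintegral_ofReal hint,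
    ← intervalIntegral.integral_of_le hτ0, hFTC, radialGrowth,
    ← ENNReal.ofReal_mul hc0, ← ENNReal.ofReal_mul (by positivity),
    ← ENNReal.ofReal_mul (by have := sub_pos.2 hβ1; positivity)]
  · apply ENNReal.ofReal_le_ofReal
    have h1 : (1 - β) * lam ≠ 0 := (mul_pos (sub_pos.2 hβ1) hlam).ne'
    have h2 : 2 * Real.pi * c = Real.pi * s ^ 2 / ((1 - β) * lam) := by
      simp only [hc, hγ]
      rw [show (2 - 2 * β) * lam = 2 * ((1 - β) * lam) by ring]
      field_simp
    rw [← mul_assoc, h2]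
    have := (Real.exp_pos (lam * (0 / s) ^ γ)).le
    have h3 : 0 ≤ Real.pi * s ^ 2 / ((1 - β) * lam) := by
      have := sub_pos.2 hβ1
      positivity
    exact mul_le_mul_of_nonneg_left (by simp only [hE]; linarith) h3
  · filter_upwards [ae_restrict_mem measurableSet_Ioc] with r hr using hpos r hr.1

/-- The previous estimate with `lam = 1` and `t = s`, where the growth weight is `e`. -/
lemma lintegral_sq_le {s β : ℝ} (hs : 0 < s) (hβ1 : β < 1) :
    ∫⁻ u : ℂ, (if ‖u‖ₑ ≤ ENNReal.ofReal s then
      (ENNReal.ofReal s / ‖u‖ₑ) ^ β * (ENNReal.ofReal s / ‖u‖ₑ) ^ β else 0) ≤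
      ENNReal.ofReal (Real.pi * Real.exp 1 / (1 - β) * s ^ 2) := by
  have h1 := lintegral_sq_mul_radialGrowth_le one_pos hs hβ1
    (ENNReal.ofReal_ne_top (r := s))
  rw [radialGrowth_self hs, ← ENNReal.ofReal_mul (by have := sub_pos.2 hβ1; positivity)] at h1
  refine (lintegral_mono fun u => ?_).trans (h1.trans (le_of_eq ?_))
  · split_ifs
    · exact le_mul_of_one_le_right' (one_le_radialGrowth zero_le_one hs.le β _)
    · exact le_rfl
  · congr 1
    ring

lemma ENNReal.div_le_one_of_le {a b : ℝ≥0∞} (h : a ≤ b) : a / b ≤ 1 :=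
  ENNReal.div_le_of_le_mul (by rwa [one_mul])

/-- Within distance `s` of `q` this is the centred integral; elsewhere the integrand is at most `1`
on the disc around `p`. -/
lemma lintegral_sq_translate_le {s β : ℝ} (hs : 0 < s) (hβ : 0 ≤ β) (hβ1 : β < 1) (p q : ℂ) :
    ∫⁻ y : ℂ, (if edist p y ≤ ENNReal.ofReal s then
      (ENNReal.ofReal s / edist y q) ^ β * (ENNReal.ofReal s / edist y q) ^ β else 0) ≤
      ENNReal.ofReal ((Real.pi * Real.exp 1 / (1 - β) + Real.pi) * s ^ 2) := by
  have h0 : 0 ≤ Real.pi * Real.exp 1 / (1 - β) := by have := sub_pos.2 hβ1; positivity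
  calc _ ≤ ∫⁻ y : ℂ, ((if ‖y - q‖ₑ ≤ ENNReal.ofReal s then
      (ENNReal.ofReal s / ‖y - q‖ₑ) ^ β * (ENNReal.ofReal s / ‖y - q‖ₑ) ^ β else 0) +
        (Metric.closedBall p s).indicator 1 y) := by
        refine lintegral_mono fun y => ?_
        rw [← edist_eq_enorm_sub]
        by_cases hp : edist p y ≤ ENNReal.ofReal s
        · rw [if_pos hp]
          by_cases hq : edist y q ≤ ENNReal.ofReal s
          · rw [if_pos hq]; exact le_self_add
          · have hmem : y ∈ Metric.closedBall p s := by
              rw [Metric.mem_closedBall, dist_comm]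
              rwa [edist_dist, ENNReal.ofReal_le_ofReal_iff hs.le] at hp
            have h1 : (ENNReal.ofReal s / edist y q) ^ β ≤ 1 :=
              ENNReal.rpow_le_one (ENNReal.div_le_one_of_le (not_le.1 hq).le) hβ
            rw [if_neg hq, zero_add, Set.indicator_of_mem hmem]
            exact mul_le_one' h1 h1
        · rw [if_neg hp]; exact zero_le
    _ = (∫⁻ y : ℂ, (if ‖y - q‖ₑ ≤ ENNReal.ofReal s then
      (ENNReal.ofReal s / ‖y - q‖ₑ) ^ β * (ENNReal.ofReal s / ‖y - q‖ₑ) ^ β else 0)) +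
        volume (Metric.closedBall p s) := by
        rw [lintegral_add_right _ (measurable_one.indicator Metric.isClosed_closedBall.measurableSet),
          lintegral_indicator_one Metric.isClosed_closedBall.measurableSet]
    _ ≤ _ := by
        rw [lintegral_sub_right_eq_self (fun u : ℂ => if ‖u‖ₑ ≤ ENNReal.ofReal s then
          (ENNReal.ofReal s / ‖u‖ₑ) ^ β * (ENNReal.ofReal s / ‖u‖ₑ) ^ β else 0) q,
          add_mul, ENNReal.ofReal_add (by positivity) (by positivity)]
        refine add_le_add (lintegral_sq_le hs hβ1) (le_of_eq ?_)
        rw [Complex.volume_closedBall, ENNReal.ofReal_mul Real.pi_pos.le, mul_comm,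
          ENNReal.ofReal_pow hs.le]
        congr 1
        rw [← NNReal.coe_real_pi, ENNReal.ofReal_coe_nnreal]

/-- The singular factor at a pair of fixed points at distance `d`. -/
noncomputable def pairFactor (β : ℝ) (d : ℝ≥0∞) : ℝ≥0∞ := 1 + (1 / d) ^ β * (1 / d) ^ β

@[fun_prop]
lemma measurable_pairFactor (β : ℝ) : Measurable (pairFactor β) := by
  unfold pairFactor
  fun_prop

lemma one_le_pairFactor (β : ℝ) (d : ℝ≥0∞) : 1 ≤ pairFactor β d := le_self_add

lemma pairFactor_one (β : ℝ) : pairFactor β 1 = 2 := by simp [pairFactor, one_add_one_eq_two]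

lemma div_rpow_le_of_le_two_mul {β : ℝ} (hβ : 0 ≤ β) {s a d : ℝ≥0∞} (h : d ≤ 2 * a) :
    (s / a) ^ β ≤ 2 ^ β * (1 / d) ^ β * s ^ β := by
  rw [← ENNReal.mul_rpow_of_nonneg _ _ hβ, ← ENNReal.mul_rpow_of_nonneg _ _ hβ]
  apply ENNReal.rpow_le_rpow _ hβ
  have h2 : d / 2 ≤ a := ENNReal.div_le_of_le_mul (by rwa [mul_comm])
  calc s / a ≤ s / (d / 2) := ENNReal.div_le_div_left h2 _
    _ = 2 * (1 / d) * s := by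
      rw [div_eq_mul_inv, ENNReal.inv_div (Or.inl ENNReal.ofNat_ne_top) (Or.inl two_ne_zero)]
      rw [one_div, div_eq_mul_inv, mul_comm]

/-- One of `|p - y|`, `|y - q|` is at least `|p - q| / 2`, so one singularity can be exchanged for a
power of `|p - q|`, at the cost `2 ^ (2β) ≤ 4`; the other one has exponent `2β < 2` and is
integrable. The cutoff gives `(s / |p - y|) ^ β ≥ 1`, so this factor may be squared beforehand. -/
lemma lintegral_mul_pairFactor_le {s β : ℝ} (hs : 0 < s) (hβ : 0 ≤ β) (hβ1 : β < 1) (p q : ℂ) :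
    ∫⁻ y : ℂ, (if edist p y ≤ ENNReal.ofReal s then
      (ENNReal.ofReal s / edist p y) ^ β * pairFactor β (edist y q) else 0) ≤
      ENNReal.ofReal (8 * (Real.pi * Real.exp 1 / (1 - β) + Real.pi) * s ^ 2) *
        pairFactor β (edist p q) := by
  set S := ENNReal.ofReal s with hS
  set w : ℂ → ℂ → ℝ≥0∞ := fun z y => (S / edist y z) ^ β * (S / edist y z) ^ β with hw
  have hwm : ∀ z, Measurable (w z) := fun z => by simp only [hw]; fun_prop
  set I : ℂ → ℝ≥0∞ := fun z => ∫⁻ y : ℂ, (if edist p y ≤ S then w z y else 0) with hI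
  have hball : MeasurableSet {y | edist p y ≤ S} := measurableSet_le (by fun_prop) (by fun_prop)
  set Q := (1 / edist p q) ^ β * (1 / edist p q) ^ β with hQ
  calc _ ≤ ∫⁻ y : ℂ, ((if edist p y ≤ S then w p y else 0) +
        4 * Q * ((if edist p y ≤ S then w p y else 0) + if edist p y ≤ S then w q y else 0)) := by
        refine lintegral_mono fun y => ?_
        by_cases hp : edist p y ≤ S
        swap
        · simp [hp]
        simp only [if_pos hp]
        have h1 : 1 ≤ (S / edist p y) ^ β := by
          calc (1 : ℝ≥0∞) = 1 ^ β := (ENNReal.one_rpow β).symm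
            _ ≤ _ := by
              refine ENNReal.rpow_le_rpow ?_ hβ
              rwa [ENNReal.le_div_iff_mul_le (Or.inr (ENNReal.ofReal_pos.2 hs).ne')
                (Or.inr ENNReal.ofReal_ne_top), one_mul]
        rw [pairFactor, mul_add, mul_one]
        have hcomm : edist p y = edist y p := edist_comm _ _
        have hfirst : (S / edist p y) ^ β ≤ w p y := by
          rw [hcomm] at h1
          rw [hcomm]
          exact le_mul_of_one_le_right' h1
        refine add_le_add hfirst ?_
        have hpow : (2 : ℝ≥0∞) ^ β * 2 ^ β ≤ 4 := by
          have : (2 : ℝ≥0∞) ^ β ≤ 2 := by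
            calc (2 : ℝ≥0∞) ^ β ≤ 2 ^ (1 : ℝ) :=
                  ENNReal.rpow_le_rpow_of_exponent_le (by norm_num) hβ1.le
              _ = 2 := ENNReal.rpow_one _
          calc (2 : ℝ≥0∞) ^ β * 2 ^ β ≤ 2 * 2 := mul_le_mul' this this
            _ = 4 := by norm_num
        have htri : edist p q ≤ 2 * edist p y ∨ edist p q ≤ 2 * edist y q := by
          have := edist_triangle p y q
          rcases le_total (edist p y) (edist y q) with h | h
          · right
            rw [two_mul]
            exact this.trans (add_le_add_left h _)
          · left
            rw [two_mul]
            exact this.trans (add_le_add_right h _)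
        have hone : ∀ a : ℝ≥0∞, (1 / a) ^ β * S ^ β = (S / a) ^ β := fun a => by
          rw [← ENNReal.mul_rpow_of_nonneg _ _ hβ, one_div, mul_comm, div_eq_mul_inv]
        rcases htri with h | h
        · have h2 := div_rpow_le_of_le_two_mul hβ (s := S) h
          calc (S / edist p y) ^ β * ((1 / edist y q) ^ β * (1 / edist y q) ^ β)
              ≤ ((S / edist p y) ^ β * (S / edist p y) ^ β) *
                ((1 / edist y q) ^ β * (1 / edist y q) ^ β) :=
                mul_le_mul_left (le_mul_of_one_le_right' h1) _
            _ ≤ ((2 ^ β * (1 / edist p q) ^ β * S ^ β) * (2 ^ β * (1 / edist p q) ^ β * S ^ β)) *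
                ((1 / edist y q) ^ β * (1 / edist y q) ^ β) := by gcongr
            _ = (2 ^ β * 2 ^ β) * Q * (((1 / edist y q) ^ β * S ^ β) *
                ((1 / edist y q) ^ β * S ^ β)) := by ring
            _ ≤ 4 * Q * (w p y + w q y) := by
              rw [hone]
              exact mul_le_mul' (mul_le_mul_left hpow _) le_add_self
        · have h2 := div_rpow_le_of_le_two_mul hβ (s := 1) h
          rw [ENNReal.one_rpow, mul_one] at h2
          calc (S / edist p y) ^ β * ((1 / edist y q) ^ β * (1 / edist y q) ^ β)
              ≤ w p y * ((2 ^ β * (1 / edist p q) ^ β) * (2 ^ β * (1 / edist p q) ^ β)) := by gcongr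
            _ = (2 ^ β * 2 ^ β) * Q * w p y := by ring
            _ ≤ 4 * Q * (w p y + w q y) := mul_le_mul' (mul_le_mul_left hpow _) le_self_add
    _ = I p + 4 * Q * (I p + I q) := by
        have hm : ∀ z, Measurable fun y => if edist p y ≤ S then w z y else 0 :=
          fun z => (hwm z).ite hball measurable_const
        rw [lintegral_add_left (hm p)]
        congr 1
        exact (lintegral_const_mul _ ((hm p).add (hm q))).trans
          (congrArg _ (lintegral_add_left (hm p) _))
    _ ≤ _ := by
        set J := ENNReal.ofReal ((Real.pi * Real.exp 1 / (1 - β) + Real.pi) * s ^ 2) with hJ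
        have h8 : ENNReal.ofReal (8 * (Real.pi * Real.exp 1 / (1 - β) + Real.pi) * s ^ 2) =
            8 * J := by
          rw [mul_assoc, ENNReal.ofReal_mul (by norm_num), ENNReal.ofReal_ofNat]
        have hp : I p ≤ J := lintegral_sq_translate_le hs hβ hβ1 p p
        have hq : I q ≤ J := lintegral_sq_translate_le hs hβ hβ1 p q
        calc I p + 4 * Q * (I p + I q) ≤ J + 4 * Q * (J + J) := by gcongr
          _ = J + 8 * J * Q := by ring
          _ ≤ 8 * J + 8 * J * Q := by
            gcongr
            exact le_mul_of_one_le_left' (by norm_num)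
          _ = _ := by rw [h8, pairFactor]; ring

end PlanarIntegrals

/-! ### Integrating out some of the points of a configuration. -/

section Marginals

lemma measurable_edist_apply {ι : Type*} (i j : ι) :
    Measurable fun x : ι → ℂ => edist (x i) (x j) :=
  (measurable_pi_apply i).edist (measurable_pi_apply j)

lemma measurable_kernel_mul {ι : Type*} {κ : ℝ≥0∞ → ℝ≥0∞} (hκ : Measurable κ)
    {H : ℝ≥0∞ → (ι → ℂ) → ℝ≥0∞}
    (hH : Measurable fun z : ℝ≥0∞ × (ι → ℂ) => H z.1 z.2) (i j : ι) :
    Measurable fun x : ι → ℂ => κ (edist (x i) (x j)) * H (edist (x i) (x j)) x :=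
  (hκ.comp (measurable_edist_apply i j)).mul
    (hH.comp ((measurable_edist_apply i j).prodMk measurable_id))

variable {ι : Type*} [DecidableEq ι] {ν : Measure ℂ}

lemma measurable_nnDist (A : Finset ι) (i : ι) :
    Measurable fun x : ι → ℂ => nnDist A x i :=
  Measurable.biInf (ι := ι) (A.erase i : Set ι) (Finset.countable_toSet _) fun j _ =>
    (measurable_pi_apply i).edist (measurable_pi_apply j)

lemma measurable_nnWeight (s : ℝ≥0∞) (β : ℝ) (A : Finset ι) :
    Measurable fun z : ℝ≥0∞ × (ι → ℂ) => nnWeight s β A z.1 z.2 := by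
  refine Finset.measurable_prod _ fun i _ => ?_
  have h : Measurable fun z : ℝ≥0∞ × (ι → ℂ) => nnDist A z.2 i :=
    (measurable_nnDist A i).comp measurable_snd
  exact Measurable.ite (measurableSet_le h measurable_fst) ((measurable_const.div h).pow_const β)
    measurable_const

lemma measurable_nnWeight_right (s : ℝ≥0∞) (β : ℝ) (A : Finset ι) (t : ℝ≥0∞) :
    Measurable fun x : ι → ℂ => nnWeight s β A t x := by
  refine Finset.measurable_prod _ fun i _ => ?_
  have h := measurable_nnDist A i
  exact Measurable.ite (measurableSet_le h measurable_const)
    ((measurable_const.div h).pow_const β) measurable_const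

lemma nnWeight_congr {s : ℝ≥0∞} {β : ℝ} {A : Finset ι} {t : ℝ≥0∞} {x y : ι → ℂ}
    (h : ∀ i ∈ A, x i = y i) : nnWeight s β A t x = nnWeight s β A t y := by
  have hD : ∀ i ∈ A, nnDist A x i = nnDist A y i := fun i hi =>
    biInf_congr fun j hj => by rw [h i hi, h j (Finset.mem_of_mem_erase hj)]
  exact Finset.prod_congr rfl fun i hi => by rw [hD i hi]

lemma lmarginal_eq_of_indep [IsFiniteMeasure ν] (s : Finset ι) {f : (ι → ℂ) → ℝ≥0∞}
    (hf : ∀ x y, (∀ i ∉ s, x i = y i) → f x = f y) (x : ι → ℂ) :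
    lmarginal (fun _ => ν) s f x = ν Set.univ ^ s.card * f x := by
  have : ∀ y : (i : s) → ℂ, f (Function.updateFinset x s y) = f x := fun y =>
    hf _ _ fun i hi => by simp [Function.updateFinset, hi]
  simp [lmarginal, this, lintegral_const, Measure.pi_univ, mul_comm]

lemma lmarginal_le_of_indep [IsFiniteMeasure ν] {s s' : Finset ι} (hs : s' ⊆ s)
    {f : (ι → ℂ) → ℝ≥0∞} (hfm : Measurable f)
    (hf : ∀ x y, (∀ i ∉ s \ s', x i = y i) → f x = f y) (x : ι → ℂ) :
    lmarginal (fun _ => ν) s f x =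
      ν Set.univ ^ (s \ s').card * lmarginal (fun _ => ν) s' f x := by
  have h : lmarginal (fun _ => ν) (s \ s') f = fun x => ν Set.univ ^ (s \ s').card * f x :=
    funext fun x => lmarginal_eq_of_indep _ hf x
  have hsu : s = s' ∪ (s \ s') := (Finset.union_sdiff_of_subset hs).symm
  conv_lhs => rw [hsu, lmarginal_union _ f hfm Finset.disjoint_sdiff, h]
  exact lintegral_const_mul _ (hfm.comp measurable_updateFinset)

lemma lmarginal_kernel_mul {s : Finset ι} {p q : ι} (hp : p ∉ s) (hq : q ∉ s)
    (κ : ℝ≥0∞ → ℝ≥0∞) {H : ℝ≥0∞ → (ι → ℂ) → ℝ≥0∞} (hH : ∀ a, Measurable (H a)) (x : ι → ℂ) :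
    lmarginal (fun _ => ν) s (fun x => κ (edist (x p) (x q)) * H (edist (x p) (x q)) x) x =
      κ (edist (x p) (x q)) * lmarginal (fun _ => ν) s (H (edist (x p) (x q))) x := by
  have h : ∀ l ∉ s, ∀ z, Function.updateFinset x s z l = x l := fun l hl z => by
    simp [Function.updateFinset, hl]
  simp only [lmarginal, h p hp, h q hq]
  exact lintegral_const_mul _ ((hH _).comp measurable_updateFinset)

lemma lmarginal_finset_sum {s : Finset ι} {κ : Type*} (T : Finset κ)
    {f : κ → (ι → ℂ) → ℝ≥0∞} (hf : ∀ k ∈ T, Measurable (f k)) (x : ι → ℂ) :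
    lmarginal (fun _ => ν) s (fun x => ∑ k ∈ T, f k x) x =
      ∑ k ∈ T, lmarginal (fun _ => ν) s (f k) x :=
  lintegral_finsetSum _ fun k hk => (hf k hk).comp measurable_updateFinset

lemma lmarginal_add {s : Finset ι} {f g : (ι → ℂ) → ℝ≥0∞} (hf : Measurable f) (x : ι → ℂ) :
    lmarginal (fun _ => ν) s (fun x => f x + g x) x =
      lmarginal (fun _ => ν) s f x + lmarginal (fun _ => ν) s g x :=
  lintegral_add_left (hf.comp measurable_updateFinset) _

/-- Lets a fixed point that the integrand no longer sees be moved to a convenient place. -/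
lemma lmarginal_update_of_indep {s : Finset ι} {f : (ι → ℂ) → ℝ≥0∞} {p : ι}
    (hf : ∀ x y, (∀ i ≠ p, x i = y i) → f x = f y) (x : ι → ℂ) (z : ℂ) :
    lmarginal (fun _ => ν) s f (Function.update x p z) = lmarginal (fun _ => ν) s f x := by
  refine lintegral_congr fun y => hf _ _ fun i hi => ?_
  by_cases his : i ∈ s <;> simp [Function.updateFinset, his, hi]

/-- Integrating out `x i` in the coordinate `x i - x j`. -/
lemma lmarginal_shift_le [IsFiniteMeasure ν] (hν : ν ≤ volume) {s : Finset ι} {i j : ι}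
    (hi : i ∈ s) (hij : j ≠ i) {κ : ℝ≥0∞ → ℝ≥0∞} (hκ : Measurable κ)
    {H : ℝ≥0∞ → (ι → ℂ) → ℝ≥0∞} (hH : Measurable fun z : ℝ≥0∞ × (ι → ℂ) => H z.1 z.2)
    (hHi : ∀ a x y, (∀ l ≠ i, x l = y l) → H a x = H a y) (x : ι → ℂ) :
    lmarginal (fun _ => ν) s (fun x => κ (edist (x i) (x j)) * H (edist (x i) (x j)) x) x ≤
      ∫⁻ u : ℂ, κ ‖u‖ₑ * lmarginal (fun _ => ν) (s.erase i) (H ‖u‖ₑ) x := by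
  have hm := measurable_kernel_mul hκ hH i j
  rw [lmarginal_erase' _ hm hi]
  calc _ ≤ lmarginal (fun _ => ν) (s.erase i) (fun x => ∫⁻ u : ℂ, κ ‖u‖ₑ * H ‖u‖ₑ x) x := by
        refine lmarginal_mono (fun x => ?_) x
        calc _ ≤ ∫⁻ y : ℂ, κ ‖y - x j‖ₑ * H ‖y - x j‖ₑ x := by
              -- Enlarging `ν` to Lebesgue measure makes translation by `x j` available.
              refine (lintegral_mono' hν le_rfl).trans (le_of_eq ?_)
              refine lintegral_congr fun y => ?_
              rw [Function.update_self, Function.update_of_ne hij, edist_eq_enorm_sub]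
              congr 1
              exact hHi _ _ _ fun l hl => Function.update_of_ne hl _ _
          _ = _ := lintegral_sub_right_eq_self (fun u : ℂ => κ ‖u‖ₑ * H ‖u‖ₑ x) (x j)
    _ = _ := by
        simp only [lmarginal]
        rw [lintegral_lintegral_swap]
        · refine lintegral_congr fun u => ?_
          exact lintegral_const_mul _
            (hH.comp (measurable_const.prodMk measurable_updateFinset))
        · refine Measurable.aemeasurable ?_
          have h1 : Measurable fun z : ((i : { x // x ∈ s.erase i }) → ℂ) × ℂ => ‖z.2‖ₑ := by
            fun_prop
          exact (hκ.comp h1).mul (hH.comp (h1.prodMk (measurable_updateFinset.comp measurable_fst)))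

end Marginals

/-! ### The three kinds of removal step. -/

section Recursion

variable {ι : Type*} [DecidableEq ι] {ν : Measure ℂ}

/-- The bound propagated by the recursion: integration over all variables but those with index
`p`, `q`. -/
def NNBound (ν : Measure ℂ) (s β lam : ℝ) (b : ℝ≥0∞) (A : Finset ι) : Prop :=
  ∀ p q : ι, p ≠ q → ∀ t ≤ ENNReal.ofReal s, ∀ x : ι → ℂ,
    lmarginal (fun _ => ν) (A \ {p, q}) (nnWeight (ENNReal.ofReal s) β A t) x ≤
      b * radialGrowth lam s β t * pairFactor β (edist (x p) (x q))

/-- `κ` cut off at distance `t`. -/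
noncomputable def cutKernel (κ : ℝ≥0∞ → ℝ≥0∞) (t a : ℝ≥0∞) : ℝ≥0∞ := if a ≤ t then κ a else 0

lemma measurable_cutKernel {κ : ℝ≥0∞ → ℝ≥0∞} (hκ : Measurable κ) (t : ℝ≥0∞) :
    Measurable (cutKernel κ t) :=
  hκ.ite measurableSet_Iic measurable_const

/-- The removed point `i` is integrated. The remaining weight does not see `x i`, so with `u = x i -
x j` the inductive bound applies at cutoff `|u|`, and the `u`-integral gains `s² / lam`. When `j` is
removed as well and is not fixed, its integral is idle; at most one variable is idle, whence the
factor `1 + ν univ`. -/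
lemma lmarginal_cutKernel_free_le [IsFiniteMeasure ν] (hν : ν ≤ volume) {s β lam : ℝ} (hs : 0 < s)
    (hβ1 : β < 1) (hlam : 0 < lam) {b : ℝ≥0∞} {A A' : Finset ι} {p q i j : ι}
    (hpq : p ≠ q) (hi : i ∈ A \ {p, q}) (hij : j ≠ i) (hA' : A' ⊆ A.erase i)
    (hcard : (((A \ {p, q}).erase i) \ (A' \ {p, q})).card ≤ 1)
    (hdisj : Disjoint (((A \ {p, q}).erase i) \ (A' \ {p, q})) A')
    (ih : NNBound ν s β lam b A') {κ : ℝ≥0∞ → ℝ≥0∞} (hκ : Measurable κ)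
    (hκle : ∀ a ≤ ENNReal.ofReal s,
      κ a ≤ (ENNReal.ofReal s / a) ^ β * (ENNReal.ofReal s / a) ^ β)
    {t : ℝ≥0∞} (ht : t ≤ ENNReal.ofReal s) (x : ι → ℂ) :
    lmarginal (fun _ => ν) (A \ {p, q}) (fun x => cutKernel κ t (edist (x i) (x j)) *
        nnWeight (ENNReal.ofReal s) β A' (edist (x i) (x j)) x) x ≤
      ENNReal.ofReal (Real.pi * s ^ 2 / ((1 - β) * lam)) * (1 + ν Set.univ) *
        (b * radialGrowth lam s β t * pairFactor β (edist (x p) (x q))) := by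
  set S := ENNReal.ofReal s with hS
  set P := pairFactor β (edist (x p) (x q)) with hP
  have hnn := measurable_nnWeight S β A'
  refine (lmarginal_shift_le hν hi hij (measurable_cutKernel hκ t) hnn
    (fun a x y h => nnWeight_congr fun l hl => h l (Finset.ne_of_mem_erase (hA' hl))) x).trans ?_
  have hstep : ∀ u : ℂ, cutKernel κ t ‖u‖ₑ *
      lmarginal (fun _ => ν) ((A \ {p, q}).erase i) (nnWeight S β A' ‖u‖ₑ) x ≤
      (if ‖u‖ₑ ≤ t then (S / ‖u‖ₑ) ^ β * (S / ‖u‖ₑ) ^ β * radialGrowth lam s β ‖u‖ₑ else 0) *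
        ((1 + ν Set.univ) * (b * P)) := by
    intro u
    by_cases hu : ‖u‖ₑ ≤ t
    swap
    · simp [cutKernel, hu]
    rw [cutKernel, if_pos hu, if_pos hu]
    have hsub : A' \ {p, q} ⊆ (A \ {p, q}).erase i := by
      intro l hl
      have h1 := Finset.mem_sdiff.1 hl
      have h2 := Finset.mem_erase.1 (hA' h1.1)
      exact Finset.mem_erase.2 ⟨h2.1, Finset.mem_sdiff.2 ⟨h2.2, h1.2⟩⟩
    have hV : ν Set.univ ^ (((A \ {p, q}).erase i) \ (A' \ {p, q})).card ≤ 1 + ν Set.univ := by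
      rcases Nat.le_one_iff_eq_zero_or_eq_one.1 hcard with h | h <;> rw [h] <;> simp
    have hind := lmarginal_le_of_indep (ν := ν) hsub
      (measurable_nnWeight_right S β A' ‖u‖ₑ) (fun x y h => nnWeight_congr fun l hl =>
        h l (Finset.disjoint_right.1 hdisj hl)) x
    rw [hind]
    calc _ ≤ ((S / ‖u‖ₑ) ^ β * (S / ‖u‖ₑ) ^ β) * ((1 + ν Set.univ) *
          (b * radialGrowth lam s β ‖u‖ₑ * P)) :=
          mul_le_mul' (hκle _ (hu.trans ht)) (mul_le_mul' hV (ih p q hpq _ (hu.trans ht) x))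
      _ = _ := by ring
  refine (lintegral_mono hstep).trans ?_
  have hm : Measurable fun u : ℂ => if ‖u‖ₑ ≤ t then
      (S / ‖u‖ₑ) ^ β * (S / ‖u‖ₑ) ^ β * radialGrowth lam s β ‖u‖ₑ else 0 := by
    refine Measurable.ite (measurableSet_le (by fun_prop) (by fun_prop)) ?_ measurable_const
    fun_prop
  rw [lintegral_mul_const _ hm]
  refine (mul_le_mul_left (lintegral_sq_mul_radialGrowth_le hlam hs hβ1
    (ne_top_of_le_ne_top ENNReal.ofReal_ne_top ht)) _).trans (le_of_eq ?_)
  ring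

/-- The removed point `p` is fixed and its neighbour `j` is integrated last. With `x j = y` held,
the inductive bound is used for the pair `(j, q)` instead of `(p, q)`, which is why `NNBound` ranges
over all pairs. The `y`-integral then turns the singularity at `(y, x q)` into one at `(x p, x q)`
and gains only `s²`. -/
lemma lmarginal_cutKernel_fixed_le [IsFiniteMeasure ν] (hν : ν ≤ volume) {s β lam : ℝ}
    (hs : 0 < s) (hβ : 0 ≤ β) (hβ1 : β < 1) (hlam : 0 < lam) {b : ℝ≥0∞} {A : Finset ι} {p q j : ι}
    (hj : j ∈ A \ {p, q})
    (ih : NNBound ν s β lam b (A.erase p))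
    {t : ℝ≥0∞} (ht : t ≤ ENNReal.ofReal s) (x : ι → ℂ) :
    lmarginal (fun _ => ν) (A \ {p, q}) (fun x =>
        cutKernel (fun a => (ENNReal.ofReal s / a) ^ β) t (edist (x p) (x j)) *
        nnWeight (ENNReal.ofReal s) β (A.erase p) (edist (x p) (x j)) x) x ≤
      ENNReal.ofReal (8 * (Real.pi * Real.exp 1 / (1 - β) + Real.pi) * s ^ 2) *
        (b * radialGrowth lam s β t * pairFactor β (edist (x p) (x q))) := by
  set S := ENNReal.ofReal s with hS
  set κ : ℝ≥0∞ → ℝ≥0∞ := fun a => (S / a) ^ β with hκ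
  have hκm : Measurable κ := by simp only [hκ]; fun_prop
  have hnn := measurable_nnWeight S β (A.erase p)
  obtain ⟨hjA, hjpq⟩ := Finset.mem_sdiff.1 hj
  have hjp : j ≠ p := fun h => hjpq (by simp [h])
  have hjq : j ≠ q := fun h => hjpq (by simp [h])
  have hset : (A \ {p, q}).erase j = (A.erase p) \ {j, q} := by
    ext l
    simp only [Finset.mem_erase, Finset.mem_sdiff, Finset.mem_insert, Finset.mem_singleton]
    tauto
  rw [lmarginal_erase _ (measurable_kernel_mul (measurable_cutKernel hκm t) hnn p j) hj]
  have hstep : ∀ y : ℂ, lmarginal (fun _ => ν) ((A \ {p, q}).erase j) (fun x =>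
        cutKernel κ t (edist (x p) (x j)) * nnWeight S β (A.erase p) (edist (x p) (x j)) x)
        (Function.update x j y) ≤
      (if edist (x p) y ≤ S then (S / edist (x p) y) ^ β * pairFactor β (edist y (x q)) else 0) *
        (b * radialGrowth lam s β t) := by
    intro y
    set x' := Function.update x j y with hx'
    have hxp : x' p = x p := Function.update_of_ne hjp.symm _ _
    have hxq : x' q = x q := Function.update_of_ne hjq.symm _ _
    have hxj : x' j = y := Function.update_self _ _ _
    have heq := lmarginal_kernel_mul (ν := ν) (s := (A \ {p, q}).erase j) (p := p) (q := j)
      (by simp) (by simp) (cutKernel κ t) (measurable_nnWeight_right S β (A.erase p)) x'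
    rw [hxp, hxj] at heq
    rw [heq]
    by_cases hy : edist (x p) y ≤ t
    swap
    · simp [cutKernel, hy]
    rw [cutKernel, if_pos hy, if_pos (hy.trans ht), hset]
    have h1 := ih j q hjq _ (hy.trans ht) x'
    rw [hxj, hxq] at h1
    have h2 := radialGrowth_mono hlam.le hs.le hβ1.le hy
      (ne_top_of_le_ne_top ENNReal.ofReal_ne_top ht)
    calc _ ≤ κ (edist (x p) y) * (b * radialGrowth lam s β t * pairFactor β (edist y (x q))) := by
          gcongr
          exact h1.trans (by gcongr)
      _ = _ := by simp only [hκ]; ring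
  refine (lintegral_mono hstep).trans ((lintegral_mono' hν le_rfl).trans ?_)
  have hm : Measurable fun y : ℂ => if edist (x p) y ≤ S then
      (S / edist (x p) y) ^ β * pairFactor β (edist y (x q)) else 0 := by
    refine Measurable.ite (measurableSet_le (by fun_prop) (by fun_prop)) ?_ measurable_const
    fun_prop
  rw [lintegral_mul_const _ hm]
  refine (mul_le_mul_left (lintegral_mul_pairFactor_le hs hβ hβ1 (x p) (x q)) _).trans
    (le_of_eq ?_)
  ring

/-- Nothing is integrated here: the kernel itself supplies the singular factor. To avoid a second
one from the inductive bound, `x p`, which the remaining weight does not see, is moved to distance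
`1` from `x q`, where `pairFactor` equals `2`. -/
lemma lmarginal_cutKernel_pair_le {s β lam : ℝ} (hs : 0 < s)
    (hβ1 : β < 1) (hlam : 0 < lam) {b : ℝ≥0∞} {A A' : Finset ι} {p q : ι}
    (hpq : p ≠ q) (hA' : A' \ {p, q} = A \ {p, q}) (hp : p ∉ A')
    (ih : NNBound ν s β lam b A') {κ : ℝ≥0∞ → ℝ≥0∞} (hκ : ∀ a, κ a ≤ pairFactor β a)
    {t : ℝ≥0∞} (ht : t ≤ ENNReal.ofReal s) (x : ι → ℂ) :
    lmarginal (fun _ => ν) (A \ {p, q}) (fun x => cutKernel κ t (edist (x p) (x q)) *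
        nnWeight (ENNReal.ofReal s) β A' (edist (x p) (x q)) x) x ≤
      2 * (b * radialGrowth lam s β t * pairFactor β (edist (x p) (x q))) := by
  set S := ENNReal.ofReal s with hS
  have heq := lmarginal_kernel_mul (ν := ν) (s := A \ {p, q}) (p := p) (q := q)
    (by simp) (by simp) (cutKernel κ t) (measurable_nnWeight_right S β A') x
  rw [heq]
  by_cases hd : edist (x p) (x q) ≤ t
  swap
  · simp [cutKernel, hd]
  rw [cutKernel, if_pos hd]
  have hind := lmarginal_update_of_indep (ν := ν) (s := A \ {p, q})
    (f := nnWeight S β A' (edist (x p) (x q))) (p := p)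
    (fun x y h => nnWeight_congr fun l hl => h l fun hlp => hp (hlp ▸ hl)) x (x q + 1)
  rw [← hind, ← hA']
  have h1 := ih p q hpq _ (hd.trans ht) (Function.update x p (x q + 1))
  rw [Function.update_self, Function.update_of_ne hpq.symm, edist_eq_enorm_sub (x q + 1),
    add_sub_cancel_left, enorm_one, pairFactor_one] at h1
  have h2 := radialGrowth_mono hlam.le hs.le hβ1.le hd
      (ne_top_of_le_ne_top ENNReal.ofReal_ne_top ht)
  calc _ ≤ pairFactor β (edist (x p) (x q)) * (b * radialGrowth lam s β t * 2) :=
        mul_le_mul' (hκ _) (h1.trans (by gcongr))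
    _ = _ := by ring

end Recursion

/-! ### The recursion over subsets and the integrated bound. -/

section RecursionBound

variable {ι : Type*} [DecidableEq ι] {ν : Measure ℂ}

/-- The constant of `nnBound_pow`. -/
noncomputable def recursionConst (β : ℝ) (V : ℝ≥0∞) : ℝ≥0∞ :=
  2 * (ENNReal.ofReal (Real.pi / (1 - β)) * (1 + V)) +
    2 * ENNReal.ofReal (8 * (Real.pi * Real.exp 1 / (1 - β) + Real.pi)) + 16

lemma recursionConst_ne_top (β : ℝ) {V : ℝ≥0∞} (hV : V ≠ ⊤) : recursionConst β V ≠ ⊤ := by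
  unfold recursionConst
  finiteness

lemma one_le_recursionConst (β : ℝ) (V : ℝ≥0∞) : 1 ≤ recursionConst β V :=
  le_add_left (by norm_num)

lemma NNBound.mono {s β lam : ℝ} {b b' : ℝ≥0∞} {A : Finset ι} (h : NNBound ν s β lam b A)
    (hb : b ≤ b') : NNBound ν s β lam b' A := fun p q hpq t ht x =>
  (h p q hpq t ht x).trans (by gcongr)

lemma div_rpow_le_pairFactor {s β : ℝ} (hs1 : s ≤ 1) (hβ : 0 ≤ β) (a : ℝ≥0∞) :
    (ENNReal.ofReal s / a) ^ β ≤ pairFactor β a := by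
  have h1 : (ENNReal.ofReal s / a) ^ β ≤ (1 / a) ^ β := by
    gcongr
    exact ENNReal.ofReal_le_one.2 hs1
  refine h1.trans ?_
  rcases le_total ((1 / a) ^ β) 1 with h | h
  · exact h.trans (one_le_pairFactor β a)
  · exact (le_mul_of_one_le_right' h).trans le_add_self

lemma div_rpow_sq_le_pairFactor {s β : ℝ} (hs1 : s ≤ 1) (hβ : 0 ≤ β) (a : ℝ≥0∞) :
    (ENNReal.ofReal s / a) ^ β * (ENNReal.ofReal s / a) ^ β ≤ pairFactor β a := by
  have h1 : (ENNReal.ofReal s / a) ^ β ≤ (1 / a) ^ β := by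
    gcongr
    exact ENNReal.ofReal_le_one.2 hs1
  exact (mul_le_mul' h1 h1).trans le_add_self

lemma le_div_rpow_of_le {s β : ℝ} (hs : 0 < s) (hβ : 0 ≤ β) {a : ℝ≥0∞}
    (ha : a ≤ ENNReal.ofReal s) :
    (ENNReal.ofReal s / a) ^ β ≤ (ENNReal.ofReal s / a) ^ β * (ENNReal.ofReal s / a) ^ β := by
  refine le_mul_of_one_le_right' ?_
  calc (1 : ℝ≥0∞) = 1 ^ β := (ENNReal.one_rpow β).symm
    _ ≤ _ := by
      refine ENNReal.rpow_le_rpow ?_ hβ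
      rwa [ENNReal.le_div_iff_mul_le (Or.inr (ENNReal.ofReal_pos.2 hs).ne')
        (Or.inr ENNReal.ofReal_ne_top), one_mul]

lemma sum_indicator_pair_le (A : Finset ι) (p q : ι) :
    ∑ i ∈ A, (if i ∈ ({p, q} : Finset ι) then (1 : ℝ≥0∞) else 0) ≤ 2 := by
  rw [Finset.sum_ite_mem, Finset.sum_const, nsmul_eq_mul, mul_one]
  have : (A ∩ {p, q}).card ≤ 2 :=
    (Finset.card_le_card Finset.inter_subset_right).trans Finset.card_le_two
  exact_mod_cast this

/-- Combines the three removal steps according to which of `i`, `j` are fixed. The indicators record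
the rare cases, so that each cost can later be weighed against the number of pairs incurring it. -/
lemma lmarginal_pair_term_le [IsFiniteMeasure ν] (hν : ν ≤ volume) {s β lam : ℝ} (hs : 0 < s)
    (hs1 : s ≤ 1) (hβ : 0 ≤ β) (hβ1 : β < 1) (hlam : 0 < lam) {b : ℝ≥0∞} {A : Finset ι}
    (ih : ∀ A' ⊂ A, NNBound ν s β lam b A') {p q i j : ι} (hpq : p ≠ q) (hi : i ∈ A)
    (hj : j ∈ A.erase i) {t : ℝ≥0∞} (ht : t ≤ ENNReal.ofReal s) (x : ι → ℂ) :
    lmarginal (fun _ => ν) (A \ {p, q}) (fun x =>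
        cutKernel (fun a => (ENNReal.ofReal s / a) ^ β) t (edist (x i) (x j)) *
        nnWeight (ENNReal.ofReal s) β (A.erase i) (edist (x i) (x j)) x) x +
      lmarginal (fun _ => ν) (A \ {p, q}) (fun x =>
        cutKernel (fun a => (ENNReal.ofReal s / a) ^ β * (ENNReal.ofReal s / a) ^ β) t
          (edist (x i) (x j)) *
        nnWeight (ENNReal.ofReal s) β ((A.erase i).erase j) (edist (x i) (x j)) x) x ≤
      (2 * (ENNReal.ofReal (Real.pi * s ^ 2 / ((1 - β) * lam)) * (1 + ν Set.univ)) +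
        (if i ∈ ({p, q} : Finset ι) then 1 else 0) *
          ENNReal.ofReal (8 * (Real.pi * Real.exp 1 / (1 - β) + Real.pi) * s ^ 2) +
        (if i ∈ ({p, q} : Finset ι) then 1 else 0) *
          (if j ∈ ({p, q} : Finset ι) then 1 else 0) * 4) *
        (b * radialGrowth lam s β t * pairFactor β (edist (x p) (x q))) := by
  set S := ENNReal.ofReal s with hS
  set Y := b * radialGrowth lam s β t * pairFactor β (edist (x p) (x q)) with hY
  set D := ENNReal.ofReal (Real.pi * s ^ 2 / ((1 - β) * lam)) * (1 + ν Set.univ) with hD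
  set D' := ENNReal.ofReal (8 * (Real.pi * Real.exp 1 / (1 - β) + Real.pi) * s ^ 2) with hD'
  obtain ⟨hji, hjA⟩ := Finset.mem_erase.1 hj
  have hm1 : Measurable fun a : ℝ≥0∞ => (S / a) ^ β := by fun_prop
  have hm2 : Measurable fun a : ℝ≥0∞ => (S / a) ^ β * (S / a) ^ β := by fun_prop
  have ih1 := ih _ (Finset.erase_ssubset hi)
  have ih2 := ih ((A.erase i).erase j)
    ((Finset.erase_subset _ _).trans_ssubset (Finset.erase_ssubset hi))
  have hsecond : ∀ i j, i ∈ A → j ∈ A → j ≠ i → NNBound ν s β lam b ((A.erase i).erase j) →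
      i ∉ ({p, q} : Finset ι) → lmarginal (fun _ => ν) (A \ {p, q}) (fun x =>
        cutKernel (fun a => (S / a) ^ β * (S / a) ^ β) t (edist (x i) (x j)) *
        nnWeight S β ((A.erase i).erase j) (edist (x i) (x j)) x) x ≤ D * Y := by
    intro i j hi hj hji ih2 hifree
    refine lmarginal_cutKernel_free_le hν hs hβ1 hlam hpq (Finset.mem_sdiff.2 ⟨hi, hifree⟩) hji
      (Finset.erase_subset _ _) ?_ ?_ ih2 hm2 (fun a _ => le_rfl) ht x
    · refine (Finset.card_le_card (t := {j}) ?_).trans (by simp)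
      intro l hl
      simp only [Finset.mem_erase, Finset.mem_sdiff, Finset.mem_singleton] at hl ⊢
      tauto
    · rw [Finset.disjoint_left]
      intro l hl
      simp only [Finset.mem_erase, Finset.mem_sdiff] at hl ⊢
      tauto
  by_cases hifree : i ∈ ({p, q} : Finset ι)
  swap
  · have h1 : lmarginal (fun _ => ν) (A \ {p, q}) (fun x =>
        cutKernel (fun a => (S / a) ^ β) t (edist (x i) (x j)) *
        nnWeight S β (A.erase i) (edist (x i) (x j)) x) x ≤ D * Y := by
      refine lmarginal_cutKernel_free_le hν hs hβ1 hlam hpq (Finset.mem_sdiff.2 ⟨hi, hifree⟩) hji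
        subset_rfl ?_ ?_ ih1 hm1 (fun a ha => le_div_rpow_of_le hs hβ ha) ht x
      · refine (Finset.card_le_card (t := ∅) ?_).trans (by simp)
        intro l hl
        simp only [Finset.mem_erase, Finset.mem_sdiff] at hl ⊢
        tauto
      · rw [Finset.disjoint_left]
        intro l hl
        simp only [Finset.mem_erase, Finset.mem_sdiff] at hl ⊢
        tauto
    refine (add_le_add h1 (hsecond i j hi hjA hji ih2 hifree)).trans (le_of_eq ?_)
    simp only [if_neg hifree]
    ring
  simp only [if_pos hifree, one_mul]
  by_cases hjfree : j ∈ ({p, q} : Finset ι)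
  · simp only [if_pos hjfree, one_mul]
    have hset1 : A.erase i \ {p, q} = A \ {p, q} := by
      ext l
      simp only [Finset.mem_erase, Finset.mem_sdiff] at hifree ⊢
      constructor
      · tauto
      · exact fun h => ⟨⟨fun hl => h.2 (hl ▸ hifree), h.1⟩, h.2⟩
    have hset2 : (A.erase i).erase j \ {p, q} = A \ {p, q} := by
      rw [← hset1]
      ext l
      simp only [Finset.mem_erase, Finset.mem_sdiff] at hjfree ⊢
      constructor
      · tauto
      · exact fun h => ⟨⟨fun hl => h.2 (hl ▸ hjfree), h.1⟩, h.2⟩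
    have key : ∀ A' : Finset ι, A' \ {p, q} = A \ {p, q} → i ∉ A' → NNBound ν s β lam b A' →
        ∀ κ : ℝ≥0∞ → ℝ≥0∞, (∀ a, κ a ≤ pairFactor β a) →
        lmarginal (fun _ => ν) (A \ {p, q}) (fun x => cutKernel κ t (edist (x i) (x j)) *
          nnWeight S β A' (edist (x i) (x j)) x) x ≤ 2 * Y := by
      intro A' hA' hiA' ihA' κ hκ
      simp only [Finset.mem_insert, Finset.mem_singleton] at hifree hjfree
      rcases hifree with rfl | rfl
      · obtain rfl : j = q := hjfree.resolve_left hji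
        exact lmarginal_cutKernel_pair_le hs hβ1 hlam hpq hA' hiA' ihA' hκ ht x
      · obtain rfl : j = p := hjfree.resolve_right hji
        rw [hY, edist_comm (x j)]
        rw [Finset.pair_comm j i] at hA' ⊢
        exact lmarginal_cutKernel_pair_le hs hβ1 hlam hpq.symm hA' hiA' ihA' hκ ht x
    refine (add_le_add (key _ hset1 (by simp) ih1 _ (div_rpow_le_pairFactor hs1 hβ))
      (key _ hset2 (by simp) ih2 _ (div_rpow_sq_le_pairFactor hs1 hβ))).trans ?_
    rw [← add_mul]
    refine mul_le_mul_left (le_trans ?_ le_add_self) _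
    norm_num
  · simp only [if_neg hjfree]
    have h1 : lmarginal (fun _ => ν) (A \ {p, q}) (fun x =>
        cutKernel (fun a => (S / a) ^ β) t (edist (x i) (x j)) *
        nnWeight S β (A.erase i) (edist (x i) (x j)) x) x ≤ D' * Y := by
      have hj' : j ∈ A \ {p, q} := Finset.mem_sdiff.2 ⟨hjA, hjfree⟩
      simp only [Finset.mem_insert, Finset.mem_singleton] at hifree
      rcases hifree with rfl | rfl
      · exact lmarginal_cutKernel_fixed_le hν hs hβ hβ1 hlam hj' ih1 ht x
      · rw [hY, edist_comm (x p)]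
        rw [Finset.pair_comm p i] at hj' ⊢
        exact lmarginal_cutKernel_fixed_le hν hs hβ hβ1 hlam hj' ih1 ht x
    have h2 : lmarginal (fun _ => ν) (A \ {p, q}) (fun x =>
        cutKernel (fun a => (S / a) ^ β * (S / a) ^ β) t (edist (x i) (x j)) *
        nnWeight S β ((A.erase i).erase j) (edist (x i) (x j)) x) x ≤ D * Y := by
      -- The mutual pair term is symmetric, so the integrated point `j` may play the role of `i`.
      have := hsecond j i hjA hi hji.symm (by rwa [Finset.erase_right_comm]) hjfree
      simpa only [edist_comm (_ : ℂ), Finset.erase_right_comm (a := j)] using this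
    refine (add_le_add h1 h2).trans ?_
    rw [← add_mul]
    refine mul_le_mul_left ?_ _
    rw [zero_mul, add_zero, add_comm]
    refine add_le_add_left ?_ _
    exact le_mul_of_one_le_left' (by norm_num)

/-- Induction on `A`, with growth rate `lam = n` and `s² = 1 / n`. Each removal leaves a proper
subset, hence at least one factor of the constant to spend on the sum over all pairs `(i, j)`. -/
theorem nnBound_pow [IsFiniteMeasure ν] (hν : ν ≤ volume) {s β : ℝ} (hs : 0 < s) (hs1 : s ≤ 1)
    (hβ : 0 ≤ β) (hβ1 : β < 1) {n : ℕ} (hns : n * s ^ 2 = 1) (A : Finset ι) (hA : A.card ≤ n) :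
    NNBound ν s β n (recursionConst β (ν Set.univ) ^ A.card) A := by
  have hn : 0 < (n : ℝ) := by
    by_contra h
    have : (n : ℝ) = 0 := le_antisymm (not_lt.1 h) (Nat.cast_nonneg n)
    rw [this, zero_mul] at hns
    exact zero_ne_one hns
  set B := recursionConst β (ν Set.univ) with hB
  have hB1 : 1 ≤ B := one_le_recursionConst _ _
  induction A using Finset.strongInduction with
  | H A ih =>
  intro p q hpq t ht x
  rcases A.eq_empty_or_nonempty with rfl | hne
  · simp only [Finset.empty_sdiff, lmarginal_empty, nnWeight, Finset.prod_empty, Finset.card_empty,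
      pow_zero, one_mul]
    exact one_le_mul (one_le_radialGrowth hn.le hs.le β t) (one_le_pairFactor _ _)
  set S := ENNReal.ofReal s with hS
  have ih' : ∀ A' ⊂ A, NNBound ν s β n (B ^ (A.card - 1)) A' := fun A' hA' => by
    have hlt := Finset.card_lt_card hA'
    exact (ih A' hA' (hlt.le.trans hA)).mono (pow_le_pow_right₀ hB1 (by omega))
  set Y := B ^ (A.card - 1) * radialGrowth n s β t * pairFactor β (edist (x p) (x q)) with hY
  set κ₁ : ℝ≥0∞ → ℝ≥0∞ := fun a => (S / a) ^ β with hκ₁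
  set κ₂ : ℝ≥0∞ → ℝ≥0∞ := fun a => (S / a) ^ β * (S / a) ^ β with hκ₂
  have hm1 : Measurable κ₁ := by simp only [hκ₁]; fun_prop
  have hm2 : Measurable κ₂ := by simp only [hκ₂]; fun_prop
  set T₁ : ι → ι → (ι → ℂ) → ℝ≥0∞ := fun i j x => cutKernel κ₁ t (edist (x i) (x j)) *
    nnWeight S β (A.erase i) (edist (x i) (x j)) x with hT₁
  set T₂ : ι → ι → (ι → ℂ) → ℝ≥0∞ := fun i j x => cutKernel κ₂ t (edist (x i) (x j)) *
    nnWeight S β ((A.erase i).erase j) (edist (x i) (x j)) x with hT₂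
  have hT₁m : ∀ i j, Measurable (T₁ i j) := fun i j =>
    measurable_kernel_mul (measurable_cutKernel hm1 t) (measurable_nnWeight S β _) i j
  have hT₂m : ∀ i j, Measurable (T₂ i j) := fun i j =>
    measurable_kernel_mul (measurable_cutKernel hm2 t) (measurable_nnWeight S β _) i j
  have hpt : ∀ x, nnWeight S β A t x ≤ ∑ i ∈ A, ∑ j ∈ A.erase i, (T₁ i j x + T₂ i j x) := by
    intro x
    refine (nnWeight_le_sum S β hne (ne_top_of_le_ne_top ENNReal.ofReal_ne_top ht) x).trans
      (le_of_eq ?_)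
    simp only [hT₁, hT₂, cutKernel, ite_mul, zero_mul, hκ₁, hκ₂]
  set e : ι → ℝ≥0∞ := fun i => if i ∈ ({p, q} : Finset ι) then 1 else 0 with he
  set D := ENNReal.ofReal (Real.pi * s ^ 2 / ((1 - β) * n)) * (1 + ν Set.univ) with hD
  set D' := ENNReal.ofReal (8 * (Real.pi * Real.exp 1 / (1 - β) + Real.pi) * s ^ 2) with hD'
  have hesum : ∑ i ∈ A, e i ≤ 2 := sum_indicator_pair_le A p q
  have hcard : (A.card : ℝ≥0∞) ≤ n := by exact_mod_cast hA
  -- There are at most `n²` pairs in all, `2n` with `i` fixed and `4` with both fixed. Their costs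
  -- are of order `s² / n = 1 / n²`, `s² = 1 / n` and `1`, so each kind contributes a constant
  -- independent of `n`.
  have hsum : ∑ i ∈ A, ∑ j ∈ A, (2 * D + e i * D' + e i * e j * 4) ≤ B := by
    calc _ = A.card * (A.card * (2 * D)) + (∑ i ∈ A, e i) * (A.card * D') +
          (∑ i ∈ A, e i) * (∑ j ∈ A, e j) * 4 := by
          simp only [Finset.sum_add_distrib, Finset.sum_const, nsmul_eq_mul, ← Finset.sum_mul,
            ← Finset.mul_sum]
          ring
      _ ≤ n * (n * (2 * D)) + 2 * (n * D') + 2 * 2 * 4 := by gcongr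
      _ = B := by
          have h1 : (n : ℝ≥0∞) * n * ENNReal.ofReal (Real.pi * s ^ 2 / ((1 - β) * n)) =
              ENNReal.ofReal (Real.pi / (1 - β)) := by
            rw [← ENNReal.ofReal_natCast n, ← ENNReal.ofReal_mul (by positivity),
              ← ENNReal.ofReal_mul (by positivity)]
            congr 1
            have h1 : 1 - β ≠ 0 := (sub_pos.2 hβ1).ne'
            calc (n : ℝ) * n * (Real.pi * s ^ 2 / ((1 - β) * n)) =
                Real.pi * (n * s ^ 2) / (1 - β) := by field_simp
              _ = _ := by rw [hns, mul_one]
          have h2 : (n : ℝ≥0∞) * D' =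
              ENNReal.ofReal (8 * (Real.pi * Real.exp 1 / (1 - β) + Real.pi)) := by
            rw [← ENNReal.ofReal_natCast n, hD', ← ENNReal.ofReal_mul (by positivity)]
            congr 1
            rw [mul_left_comm, hns, mul_one]
          rw [h2, hB, recursionConst, ← h1, hD]
          norm_num
          ring
  calc lmarginal (fun _ => ν) (A \ {p, q}) (nnWeight S β A t) x
      ≤ lmarginal (fun _ => ν) (A \ {p, q})
          (fun x => ∑ i ∈ A, ∑ j ∈ A.erase i, (T₁ i j x + T₂ i j x)) x :=
        lmarginal_mono (fun x => hpt x) x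
    _ = ∑ i ∈ A, ∑ j ∈ A.erase i, (lmarginal (fun _ => ν) (A \ {p, q}) (T₁ i j) x +
          lmarginal (fun _ => ν) (A \ {p, q}) (T₂ i j) x) := by
        have hTm : ∀ i j, Measurable fun x => T₁ i j x + T₂ i j x := fun i j =>
          (hT₁m i j).add (hT₂m i j)
        rw [lmarginal_finset_sum A (fun i _ => Finset.measurable_fun_sum _ fun j _ => hTm i j)]
        refine Finset.sum_congr rfl fun i _ => ?_
        rw [lmarginal_finset_sum (A.erase i) (fun j _ => hTm i j)]
        exact Finset.sum_congr rfl fun j _ => lmarginal_add (hT₁m i j) x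
    _ ≤ ∑ i ∈ A, ∑ j ∈ A.erase i, (2 * D + e i * D' + e i * e j * 4) * Y :=
        Finset.sum_le_sum fun i hi => Finset.sum_le_sum fun j hj =>
          lmarginal_pair_term_le hν hs hs1 hβ hβ1 hn ih' hpq hi hj ht x
    _ ≤ ∑ i ∈ A, ∑ j ∈ A, (2 * D + e i * D' + e i * e j * 4) * Y :=
        Finset.sum_le_sum fun i hi => Finset.sum_le_sum_of_subset (Finset.erase_subset _ _)
    _ = (∑ i ∈ A, ∑ j ∈ A, (2 * D + e i * D' + e i * e j * 4)) * Y := by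
        simp only [Finset.sum_mul]
    _ ≤ B * Y := by gcongr
    _ = _ := by
        rw [hY, ← mul_assoc, ← mul_assoc, ← pow_succ', Nat.sub_add_cancel hne.card_pos]

/-- The integral of the nearest neighbour weights over all variables but two. -/
theorem lmarginal_prod_max_le [Fintype ι] [IsFiniteMeasure ν] (hν : ν ≤ volume) {s β : ℝ}
    (hs : 0 < s) (hs1 : s ≤ 1) (hβ : 0 ≤ β) (hβ1 : β < 1)
    (hns : (Fintype.card ι : ℝ) * s ^ 2 = 1) {p q : ι} (hpq : p ≠ q) (x : ι → ℂ) :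
    lmarginal (fun _ => ν) (Finset.univ \ {p, q}) (fun x =>
        ∏ i, (max 1 (ENNReal.ofReal s / nnDist Finset.univ x i)) ^ β) x ≤
      (2 * (1 + ν Set.univ) * recursionConst β (ν Set.univ) * ENNReal.ofReal (Real.exp 1)) ^
        Fintype.card ι * pairFactor β (edist (x p) (x q)) := by
  set S := ENNReal.ofReal s with hS
  set B := recursionConst β (ν Set.univ) with hB
  set N := Fintype.card ι with hN
  set P := pairFactor β (edist (x p) (x q)) with hP
  have hterm : ∀ A : Finset ι, lmarginal (fun _ => ν) (Finset.univ \ {p, q})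
      (nnWeight S β A S) x ≤ ((1 + ν Set.univ) * B * ENNReal.ofReal (Real.exp 1)) ^ N * P := by
    intro A
    have hsub : A \ {p, q} ⊆ Finset.univ \ {p, q} :=
      Finset.sdiff_subset_sdiff (Finset.subset_univ A) subset_rfl
    rw [lmarginal_le_of_indep hsub (measurable_nnWeight_right S β A S)
      (fun x y h => nnWeight_congr fun l hl => h l (by
        simp only [Finset.mem_sdiff, Finset.mem_univ, true_and, not_and, not_not]
        tauto)) x]
    have h1 := nnBound_pow hν hs hs1 hβ hβ1 hns A (Finset.card_le_univ A) p q hpq S le_rfl x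
    -- Points outside `A` are not seen by the weight and contribute only total mass.
    have h2 : ν Set.univ ^ ((Finset.univ \ {p, q}) \ (A \ {p, q})).card ≤
        (1 + ν Set.univ) ^ N :=
      (pow_le_pow_left₀ zero_le le_add_self _).trans
        (pow_le_pow_right₀ le_self_add (Finset.card_le_univ _))
    calc _ ≤ (1 + ν Set.univ) ^ N * (B ^ A.card * radialGrowth N s β S * P) := mul_le_mul' h2 h1
      _ ≤ (1 + ν Set.univ) ^ N * (B ^ N * ENNReal.ofReal (Real.exp 1) ^ N * P) := by
          have h3 : B ^ A.card ≤ B ^ N :=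
            pow_le_pow_right₀ (one_le_recursionConst _ _) (Finset.card_le_univ _)
          have h4 : radialGrowth N s β S = ENNReal.ofReal (Real.exp 1) ^ N := by
            rw [radialGrowth_self hs, ← ENNReal.ofReal_pow (Real.exp_pos 1).le, ← Real.exp_nat_mul,
              mul_one]
          rw [h4]
          gcongr
      _ = _ := by rw [mul_pow, mul_pow]; ring
  calc _ ≤ lmarginal (fun _ => ν) (Finset.univ \ {p, q})
        (fun x => ∑ A : Finset ι, nnWeight S β A S x) x :=
        lmarginal_mono (fun x => prod_max_le_sum_nnWeight (ENNReal.ofReal_pos.2 hs).ne'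
          ENNReal.ofReal_ne_top hβ x) x
    _ = ∑ A : Finset ι, lmarginal (fun _ => ν) (Finset.univ \ {p, q}) (nnWeight S β A S) x :=
        lmarginal_finset_sum _ (fun A _ => measurable_nnWeight_right S β A S) x
    _ ≤ ∑ A : Finset ι, ((1 + ν Set.univ) * B * ENNReal.ofReal (Real.exp 1)) ^ N * P :=
        Finset.sum_le_sum fun A _ => hterm A
    _ = _ := by
        -- The `2 ^ N` subsets account for the factor `2` in the base.
        rw [Finset.sum_const, Finset.card_univ, Fintype.card_finset, nsmul_eq_mul, ← hN]
        push_cast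
        rw [show 2 * (1 + ν Set.univ) * B * ENNReal.ofReal (Real.exp 1) =
          2 * ((1 + ν Set.univ) * B * ENNReal.ofReal (Real.exp 1)) by ring, mul_pow 2]
        ring

end RecursionBound

/-! ### Nonnegativity of the Dirichlet energy. -/

section Energy

/-- `φ(t) = t χ(t² / ε² - 1)` for a smooth step function `χ`. -/
noncomputable def softThreshold (ε t : ℝ) : ℝ := t * Real.smoothTransition (t ^ 2 / ε ^ 2 - 1)

lemma contDiff_softThreshold (ε : ℝ) : ContDiff ℝ ∞ (softThreshold ε) := by
  unfold softThreshold
  have h : ContDiff ℝ ∞ Real.smoothTransition := Real.smoothTransition.contDiff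
  exact contDiff_id.mul (h.comp (by fun_prop))

lemma softThreshold_eq_zero {ε t : ℝ} (hε : 0 < ε) (ht : |t| ≤ ε) : softThreshold ε t = 0 := by
  have : t ^ 2 / ε ^ 2 - 1 ≤ 0 := by
    rw [sub_nonpos, div_le_one (by positivity)]
    exact sq_le_sq' (abs_le.1 ht).1 (abs_le.1 ht).2
  rw [softThreshold, Real.smoothTransition.zero_of_nonpos this, mul_zero]

lemma abs_softThreshold_sub_le {ε : ℝ} (hε : 0 < ε) (t : ℝ) : |softThreshold ε t - t| ≤ 2 * ε := by
  rcases le_total (2 * ε) |t| with h | h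
  · have : 1 ≤ t ^ 2 / ε ^ 2 - 1 := by
      rw [le_sub_iff_add_le, le_div_iff₀ (by positivity), ← sq_abs t]
      nlinarith
    rw [softThreshold, Real.smoothTransition.one_of_one_le this]
    simp [hε.le]
  · refine le_trans ?_ h
    rw [softThreshold, show t * Real.smoothTransition (t ^ 2 / ε ^ 2 - 1) - t =
      t * (Real.smoothTransition (t ^ 2 / ε ^ 2 - 1) - 1) by ring, abs_mul]
    refine mul_le_of_le_one_right (abs_nonneg t) (abs_le.2 ⟨?_, ?_⟩)
    · linarith [Real.smoothTransition.nonneg (t ^ 2 / ε ^ 2 - 1)]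
    · linarith [Real.smoothTransition.le_one (t ^ 2 / ε ^ 2 - 1)]

lemma deriv_softThreshold_nonneg (ε t : ℝ) : 0 ≤ deriv (softThreshold ε) t := by
  have hST : ContDiff ℝ ∞ Real.smoothTransition := Real.smoothTransition.contDiff
  have h1 : HasDerivAt (fun t : ℝ => t ^ 2 / ε ^ 2 - 1) (2 * t / ε ^ 2) t := by
    simpa using ((hasDerivAt_pow 2 t).div_const (ε ^ 2)).sub_const 1
  have h2 := ((hST.differentiable (by simp)) (t ^ 2 / ε ^ 2 - 1)).hasDerivAt.comp t h1
  have h3 : HasDerivAt (softThreshold ε) _ t := (hasDerivAt_id t).mul h2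
  rw [h3.deriv]
  have h4 : 0 ≤ deriv Real.smoothTransition (t ^ 2 / ε ^ 2 - 1) :=
    Real.smoothTransition.monotone.deriv_nonneg
  have h5 := Real.smoothTransition.nonneg (t ^ 2 / ε ^ 2 - 1)
  have h6 : 0 ≤ t * (2 * t / ε ^ 2) := by
    rw [show t * (2 * t / ε ^ 2) = 2 * t ^ 2 / ε ^ 2 by ring]
    positivity
  simp only [id]
  nlinarith [mul_nonneg h4 h6]

lemma integral_fderiv_eq_zero_of_hasCompactSupport {f : ℂ → ℝ} (hf : ContDiff ℝ 1 f)
    (hs : HasCompactSupport f) (v : ℂ) : ∫ x, fderiv ℝ f x v = 0 := by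
  have h1 : Continuous fun x => fderiv ℝ f x v :=
    (hf.continuous_fderiv (by simp)).clm_apply continuous_const
  have h := integral_mul_fderiv_eq_neg_fderiv_mul_of_integrable (μ := volume) (𝕜 := ℝ)
    (f := fun _ : ℂ => (1 : ℝ)) (g := f) (v := v)
    (by simp)
    (by simpa using h1.integrable_of_hasCompactSupport (hs.fderiv_apply ℝ v))
    (by simpa using hf.continuous.integrable_of_hasCompactSupport hs)
    (fun x _ => differentiableAt_const _) (fun x _ => hf.differentiable (by simp) x)
  simpa using h

lemma laplacian_eq_fderiv_fderiv (u : ℂ → ℝ) (x : ℂ) :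
    Laplacian.laplacian u x = fderiv ℝ (fderiv ℝ u) x 1 1 +
      fderiv ℝ (fderiv ℝ u) x Complex.I Complex.I := by
  rw [laplacian_eq_iteratedFDeriv_complexPlane]
  simp [iteratedFDeriv_two_apply]

variable {Ω : Set ℂ}

/-- Testing `-Δu = μ` against `φ(u)` gives `∫ φ'(u) |∇u|² ≥ 0`. Since `φ` vanishes near `0` and `u`
vanishes on the boundary, `φ(u) ∇u` has compact support in `Ω`, so no boundary term arises and no
regularity of `∇u` up to the boundary is needed. -/
lemma integral_comp_mul_nonneg (hΩ : IsOpen Ω) (hb : Bornology.IsBounded Ω) {u μ : ℂ → ℝ}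
    {φ : ℝ → ℝ} {ε : ℝ}
    (hε : 0 < ε) (hφ : ContDiff ℝ ∞ φ) (hφ0 : ∀ t, |t| ≤ ε → φ t = 0) (hφ' : ∀ t, 0 ≤ deriv φ t)
    (hc : ContinuousOn u (closure Ω)) (h0 : ∀ x ∈ frontier Ω, u x = 0) (hu : ContDiffOn ℝ 2 u Ω)
    (hμ : ∀ x ∈ Ω, Laplacian.laplacian u x = -μ x)
    (hint : IntegrableOn (fun x => φ (u x) * μ x) Ω) :
    0 ≤ ∫ x in Ω, φ (u x) * μ x := by
  set K : Set ℂ := closure Ω ∩ u ⁻¹' {t | ε ≤ |t|} with hK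
  have hKc : IsCompact K :=
    hb.isCompact_closure.of_isClosed_subset
      (hc.preimage_isClosed_of_isClosed isClosed_closure
        (isClosed_le continuous_const continuous_abs)) Set.inter_subset_left
  have hKΩ : K ⊆ Ω := by
    rintro x ⟨hx, hxu⟩
    by_contra hn
    have hxu' : ε ≤ |u x| := hxu
    rw [h0 x (by rw [hΩ.frontier_eq]; exact ⟨hx, hn⟩), abs_zero] at hxu'
    exact absurd hxu' (not_le.2 hε)
  have hzero : ∀ x ∈ Ω, x ∉ K → φ (u x) = 0 := fun x hx hxK =>
    hφ0 _ (not_lt.1 fun h => hxK ⟨subset_closure hx, h.le⟩)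
  -- The component of `φ(u) ∇u` in direction `v`, extended by zero; its support lies in `K`.
  set G : ℂ → ℂ → ℝ := fun v => Ω.indicator fun x => φ (u x) * fderiv ℝ u x v with hG
  have hGoff : ∀ v, ∀ x ∉ K, G v x = 0 := by
    intro v x hx
    by_cases hxΩ : x ∈ Ω
    · simp [hG, Set.indicator_of_mem hxΩ, hzero x hxΩ hx]
    · exact Set.indicator_of_notMem hxΩ _
  have hev : ∀ v, ∀ x ∉ K, G v =ᶠ[nhds x] fun _ => 0 := fun v x hx =>
    Filter.eventually_of_mem (hKc.isClosed.isOpen_compl.mem_nhds hx) fun y hy => hGoff v y hy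
  have hev' : ∀ v, ∀ x ∈ Ω, G v =ᶠ[nhds x] fun x => φ (u x) * fderiv ℝ u x v := fun v x hx =>
    Filter.eventually_of_mem (hΩ.mem_nhds hx) fun y hy => Set.indicator_of_mem hy _
  have hu2 : ∀ x ∈ Ω, ContDiffAt ℝ 2 u x := fun x hx => hu.contDiffAt (hΩ.mem_nhds hx)
  have hu1 : ∀ x ∈ Ω, ContDiffAt ℝ 1 (fderiv ℝ u) x := fun x hx =>
    (hu2 x hx).fderiv_right (by norm_num)
  have hφ1 : ContDiff ℝ 1 φ := hφ.of_le (by simp)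
  have hGC : ∀ v, ContDiff ℝ 1 (G v) := by
    intro v
    rw [contDiff_iff_contDiffAt]
    intro x
    by_cases hx : x ∈ Ω
    · refine ContDiffAt.congr_of_eventuallyEq ?_ (hev' v x hx)
      exact (hφ1.contDiffAt.comp x ((hu2 x hx).of_le (by norm_num))).mul
        ((hu1 x hx).clm_apply contDiffAt_const)
    · exact contDiffAt_const.congr_of_eventuallyEq (hev v x fun h => hx (hKΩ h))
  have hGs : ∀ v, HasCompactSupport (G v) := fun v =>
    HasCompactSupport.intro hKc fun x hx => hGoff v x hx
  have hderiv : ∀ x ∈ Ω, ∀ v, fderiv ℝ (G v) x v =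
      deriv φ (u x) * fderiv ℝ u x v ^ 2 + φ (u x) * fderiv ℝ (fderiv ℝ u) x v v := by
    intro x hx v
    rw [(hev' v x hx).fderiv_eq]
    have h1 : HasFDerivAt u (fderiv ℝ u x) x :=
      ((hu2 x hx).differentiableAt (by norm_num)).hasFDerivAt
    have h2 : HasFDerivAt (fun x => φ (u x)) (deriv φ (u x) • fderiv ℝ u x) x :=
      ((hφ1.differentiable (by norm_num)) (u x)).hasDerivAt.comp_hasFDerivAt x h1
    have h3 : HasFDerivAt (fderiv ℝ u) (fderiv ℝ (fderiv ℝ u) x) x :=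
      ((hu1 x hx).differentiableAt (by norm_num)).hasFDerivAt
    have h4 : HasFDerivAt (fun x => fderiv ℝ u x v)
        ((ContinuousLinearMap.apply ℝ ℝ v).comp (fderiv ℝ (fderiv ℝ u) x)) x :=
      (ContinuousLinearMap.apply ℝ ℝ v).hasFDerivAt.comp x h3
    rw [(h2.fun_mul h4).fderiv]
    simp
    ring
  have hI : ∀ v, Integrable fun x => fderiv ℝ (G v) x v := fun v =>
    (((hGC v).continuous_fderiv (by simp)).clm_apply continuous_const).integrable_of_hasCompactSupport
      ((hGs v).fderiv_apply ℝ v)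
  have hsum : ∫ x in Ω, φ (u x) * μ x =
      ∫ x, (Ω.indicator (fun x => φ (u x) * μ x) x + fderiv ℝ (G 1) x 1 +
        fderiv ℝ (G Complex.I) x Complex.I) := by
    have hi := (integrable_indicator_iff hΩ.measurableSet).2 hint
    have hi1 : Integrable fun x => Ω.indicator (fun x => φ (u x) * μ x) x +
        fderiv ℝ (G 1) x 1 := hi.add (hI 1)
    rw [integral_add hi1 (hI _), integral_add hi (hI 1),
      integral_fderiv_eq_zero_of_hasCompactSupport (hGC 1) (hGs 1),
      integral_fderiv_eq_zero_of_hasCompactSupport (hGC _) (hGs _), add_zero, add_zero,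
      integral_indicator hΩ.measurableSet]
  rw [hsum]
  refine integral_nonneg fun x => ?_
  by_cases hx : x ∈ Ω
  · have hl := hμ x hx
    rw [laplacian_eq_fderiv_fderiv] at hl
    simp only [Pi.zero_apply, Set.indicator_of_mem hx, hderiv x hx]
    have h1 := mul_nonneg (hφ' (u x)) (sq_nonneg (fderiv ℝ u x 1))
    have h2 := mul_nonneg (hφ' (u x)) (sq_nonneg (fderiv ℝ u x Complex.I))
    have h3 : φ (u x) * μ x = -(φ (u x) * (fderiv ℝ (fderiv ℝ u) x 1 1 +
      fderiv ℝ (fderiv ℝ u) x Complex.I Complex.I)) := by rw [hl]; ring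
    rw [h3]
    linarith
  · have hxK : x ∉ K := fun h => hx (hKΩ h)
    simp [Set.indicator_of_notMem hx, (hev _ x hxK).fderiv_eq]

/-- The Dirichlet energy of the potential of a charge density is nonnegative. -/
theorem integral_mul_nonneg_of_laplacian (hΩ : IsOpen Ω) (hb : Bornology.IsBounded Ω)
    {u μ : ℂ → ℝ} (hc : ContinuousOn u (closure Ω)) (h0 : ∀ x ∈ frontier Ω, u x = 0)
    (hu : ContDiffOn ℝ 2 u Ω) (hμ : ∀ x ∈ Ω, Laplacian.laplacian u x = -μ x)
    (hμc : Continuous μ) : 0 ≤ ∫ x in Ω, u x * μ x := by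
  have hint : ∀ w : ℂ → ℝ, ContinuousOn w (closure Ω) → IntegrableOn w Ω := fun w hw =>
    (hw.integrableOn_compact hb.isCompact_closure).mono_set subset_closure
  have hi : IntegrableOn (fun x => u x * μ x) Ω := hint _ (hc.mul hμc.continuousOn)
  have hia := hint _ (hμc.abs.continuousOn)
  have hA : 0 ≤ ∫ x in Ω, |μ x| := integral_nonneg fun x => abs_nonneg _
  -- Replacing `u` by its soft threshold costs at most `2ε ∫ |μ|`, and `ε` is chosen to make this at
  -- most `δ`.
  refine le_of_forall_pos_le_add fun δ hδ => ?_
  set A := ∫ x in Ω, |μ x| with hAdef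
  set ε := δ / (2 * (A + 1)) with hε
  have hε0 : 0 < ε := by positivity
  have hφc := (contDiff_softThreshold ε).continuous
  have hiφ : IntegrableOn (fun x => softThreshold ε (u x) * μ x) Ω :=
    hint _ ((hφc.comp_continuousOn hc).mul hμc.continuousOn)
  have h1 := integral_comp_mul_nonneg hΩ hb hε0 (contDiff_softThreshold ε)
    (fun t ht => softThreshold_eq_zero hε0 ht) (deriv_softThreshold_nonneg ε) hc h0 hu hμ hiφ
  have h2 : ∫ x in Ω, softThreshold ε (u x) * μ x ≤ ∫ x in Ω, (u x * μ x + 2 * ε * |μ x|) := by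
    refine integral_mono hiφ (hi.add (hia.const_mul _)) fun x => ?_
    have h3 := abs_softThreshold_sub_le hε0 (u x)
    have h4 : (softThreshold ε (u x) - u x) * μ x ≤ 2 * ε * |μ x| :=
      (le_abs_self _).trans (by rw [abs_mul]; gcongr)
    simp only
    linarith
  rw [integral_add hi (hia.const_mul _), integral_const_mul] at h2
  have h5 : 2 * ε * A ≤ δ := by
    rw [hε]
    have : 2 * (δ / (2 * (A + 1))) * A = δ * (A / (A + 1)) := by field_simp
    rw [this]
    exact mul_le_of_le_one_right hδ.le ((div_le_one (by positivity)).2 (by linarith))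
  linarith

end Energy

/-! ### Smeared point charges. -/

section Smearing

open Set

/-- A smooth function of `q = |z|²` which equals `-log |z|` for `|z| ≥ 1`. -/
noncomputable def smearProfile (q : ℝ) : ℝ :=
  -(1 / 2) * (Real.smoothTransition (2 * q - 1) * Real.log q)

lemma smearProfile_of_one_le {q : ℝ} (hq : 1 ≤ q) : smearProfile q = -(1 / 2) * Real.log q := by
  rw [smearProfile, Real.smoothTransition.one_of_one_le (by linarith), one_mul]

lemma contDiff_smearProfile : ContDiff ℝ ∞ smearProfile := by
  rw [contDiff_iff_contDiffAt]
  intro q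
  rcases lt_or_ge q (1 / 2) with hq | hq
  · have : smearProfile =ᶠ[nhds q] fun _ => 0 := by
      filter_upwards [Iio_mem_nhds hq] with y hy
      rw [smearProfile, Real.smoothTransition.zero_of_nonpos (by linarith [mem_Iio.1 hy])]
      simp
    exact contDiffAt_const.congr_of_eventuallyEq this
  · have h : ContDiff ℝ ∞ Real.smoothTransition := Real.smoothTransition.contDiff
    have h1 : ContDiffAt ℝ ∞ (fun q : ℝ => Real.smoothTransition (2 * q - 1)) q :=
      (h.comp (by fun_prop : ContDiff ℝ ∞ fun q : ℝ => 2 * q - 1)).contDiffAt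
    exact contDiffAt_const.mul (h1.mul (Real.contDiffAt_log.2 (by linarith)))

lemma contDiff_deriv_smearProfile : ContDiff ℝ ∞ (deriv smearProfile) :=
  ((contDiff_infty_iff_deriv (f := smearProfile)).1 contDiff_smearProfile).2

lemma contDiff_deriv_deriv_smearProfile : ContDiff ℝ ∞ (deriv (deriv smearProfile)) :=
  ((contDiff_infty_iff_deriv (f := deriv smearProfile)).1 contDiff_deriv_smearProfile).2

lemma hasDerivAt_smearProfile (q : ℝ) : HasDerivAt smearProfile (deriv smearProfile q) q :=
  (contDiff_smearProfile.differentiable (by simp) q).hasDerivAt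

lemma hasDerivAt_deriv_smearProfile (q : ℝ) :
    HasDerivAt (deriv smearProfile) (deriv (deriv smearProfile) q) q :=
  (contDiff_deriv_smearProfile.differentiable (by simp) q).hasDerivAt

lemma deriv_smearProfile {q : ℝ} (hq : 1 < q) : deriv smearProfile q = -(1 / 2) * q⁻¹ := by
  have h : smearProfile =ᶠ[nhds q] fun q => -(1 / 2) * Real.log q := by
    filter_upwards [Ioi_mem_nhds hq] with y hy using smearProfile_of_one_le (mem_Ioi.1 hy).le
  rw [h.deriv_eq]
  exact ((Real.hasDerivAt_log (by linarith)).const_mul _).deriv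

/-- The charge density of the smeared potential, up to scaling, as a function of `q = |z|²`. -/
noncomputable def smearCharge (q : ℝ) : ℝ :=
  -(4 * (deriv smearProfile q + q * deriv (deriv smearProfile) q))

lemma continuous_smearCharge : Continuous smearCharge := by
  have h1 := contDiff_deriv_smearProfile.continuous
  have h2 := contDiff_deriv_deriv_smearProfile.continuous
  unfold smearCharge
  fun_prop

/-- For `q > 1` the profile is `-(1/2) log q`, the harmonic function `-log |z|`; the endpoint `q =
1` follows by continuity. -/
lemma smearCharge_eq_zero {q : ℝ} (hq : 1 ≤ q) : smearCharge q = 0 := by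
  have h : ∀ q ∈ Ioi (1 : ℝ), smearCharge q = 0 := by
    intro q hq
    have hq1 : 1 < q := hq
    have he : deriv smearProfile =ᶠ[nhds q] fun q => -(1 / 2) * q⁻¹ := by
      filter_upwards [Ioi_mem_nhds hq1] with y hy using deriv_smearProfile hy
    rw [smearCharge, deriv_smearProfile hq1, he.deriv_eq,
      ((hasDerivAt_inv (by linarith : q ≠ 0)).const_mul _).deriv]
    field_simp
    ring
  have hc : IsClosed {q | smearCharge q = 0} := isClosed_eq continuous_smearCharge continuous_const
  have := hc.closure_subset_iff.2 (fun q hq => h q hq : Ioi (1 : ℝ) ⊆ {q | smearCharge q = 0})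
  rw [closure_Ioi] at this
  exact this (mem_Ici.2 hq)

/-- The potential of a charge at `c` smeared out over the disc of radius `r`. -/
noncomputable def smearPotential (c : ℂ) (r : ℝ) (x : ℂ) : ℝ :=
  smearProfile (‖x - c‖ ^ 2 / r ^ 2) - Real.log r

/-- The density of a charge at `c` smeared out over the disc of radius `r`. -/
noncomputable def smearDensity (c : ℂ) (r : ℝ) (x : ℂ) : ℝ :=
  (r ^ 2)⁻¹ * smearCharge (‖x - c‖ ^ 2 / r ^ 2)

lemma contDiff_smearPotential (c : ℂ) (r : ℝ) : ContDiff ℝ ∞ (smearPotential c r) := by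
  have h : ContDiff ℝ ∞ fun x : ℂ => ‖x - c‖ ^ 2 / r ^ 2 :=
    ((contDiff_id.sub contDiff_const).norm_sq ℝ).div_const _
  exact (contDiff_smearProfile.comp h).sub contDiff_const

lemma continuous_smearDensity (c : ℂ) (r : ℝ) : Continuous (smearDensity c r) := by
  have := continuous_smearCharge
  unfold smearDensity
  fun_prop

lemma one_le_norm_sq_div {c : ℂ} {r : ℝ} (hr : 0 < r) {x : ℂ} (hx : r ≤ ‖x - c‖) :
    1 ≤ ‖x - c‖ ^ 2 / r ^ 2 := by
  rw [one_le_div (by positivity)]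
  gcongr

lemma smearPotential_eq {c : ℂ} {r : ℝ} (hr : 0 < r) {x : ℂ} (hx : r ≤ ‖x - c‖) :
    smearPotential c r x = Real.log ‖x - c‖⁻¹ := by
  have hx0 : 0 < ‖x - c‖ := hr.trans_le hx
  rw [smearPotential, smearProfile_of_one_le (one_le_norm_sq_div hr hx),
    Real.log_div (by positivity) (by positivity), Real.log_pow, Real.log_pow, Real.log_inv]
  push_cast
  ring

lemma smearDensity_eq_zero {c : ℂ} {r : ℝ} (hr : 0 < r) {x : ℂ} (hx : r ≤ ‖x - c‖) :
    smearDensity c r x = 0 := by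
  rw [smearDensity, smearCharge_eq_zero (one_le_norm_sq_div hr hx), mul_zero]

/-- For `q = k |x - c|²` the chain rule in the plane gives `Δ F(q) = 4k (F'(q) + q F''(q))`, which
is what `smearCharge` is modelled on. -/
lemma laplacian_smearPotential (c : ℂ) (r : ℝ) (x : ℂ) :
    Laplacian.laplacian (smearPotential c r) x = -smearDensity c r x := by
  set q : ℂ → ℝ := fun x => ‖x - c‖ ^ 2 / r ^ 2 with hq
  set k : ℝ := (r ^ 2)⁻¹ with hk
  have hqd : ∀ x, HasFDerivAt q ((2 * k) • innerSL ℝ (x - c)) x := by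
    intro x
    have h1 : HasFDerivAt (fun x => ‖x - c‖ ^ 2) (2 • (innerSL ℝ (x - c))) x := by
      exact (hasStrictFDerivAt_norm_sq (x - c)).hasFDerivAt.comp x
        ((hasFDerivAt_id x).sub_const c)
    have h2 := h1.const_mul k
    have h3 : (fun x => k * ‖x - c‖ ^ 2) = q := by
      funext x; simp only [hq, hk]; ring
    rw [h3] at h2
    refine h2.congr_fderiv ?_
    rw [← Nat.cast_smul_eq_nsmul ℝ, smul_smul, mul_comm]
    norm_num
  have hfd : ∀ x, fderiv ℝ (smearPotential c r) x =
      (deriv smearProfile (q x) * (2 * k)) • innerSL ℝ (x - c) := by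
    intro x
    have := ((hasDerivAt_smearProfile (q x)).comp_hasFDerivAt x (hqd x)).sub_const (Real.log r)
    rw [mul_smul]
    exact this.fderiv
  have hinner : ∀ v x : ℂ, HasFDerivAt (fun x : ℂ => innerSL ℝ (x - c) v) (innerSL ℝ v) x := by
    intro v x
    have h1 := (innerSL ℝ v).hasFDerivAt.comp x ((hasFDerivAt_id x).sub_const c)
    simp only [ContinuousLinearMap.comp_id] at h1
    refine h1.congr_of_eventuallyEq (Filter.Eventually.of_forall fun y => ?_)
    simp only [Function.comp, innerSL_apply_apply, id]
    exact real_inner_comm _ _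
  have hsecond : ∀ v, fderiv ℝ (fderiv ℝ (smearPotential c r)) x v v =
      (2 * k) ^ 2 * deriv (deriv smearProfile) (q x) * (inner ℝ (x - c) v) ^ 2 +
        2 * k * deriv smearProfile (q x) * inner ℝ v v := by
    intro v
    have hdiff : DifferentiableAt ℝ (fderiv ℝ (smearPotential c r)) x :=
      ((contDiff_infty.1 (contDiff_smearPotential c r) 2).fderiv_right (m := 1) (by norm_num)).differentiable (by simp) x
    have h1 : fderiv ℝ (fderiv ℝ (smearPotential c r)) x v v =
        fderiv ℝ (fun y => fderiv ℝ (smearPotential c r) y v) x v := by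
      rw [fderiv_clm_apply hdiff (differentiableAt_const v)]
      simp
    have h2 : (fun y => fderiv ℝ (smearPotential c r) y v) =
        fun y => deriv smearProfile (q y) * ((2 * k) * innerSL ℝ (y - c) v) := by
      funext y
      rw [hfd]
      simp
      ring
    have h3 := ((hasDerivAt_deriv_smearProfile (q x)).comp_hasFDerivAt x (hqd x)).fun_mul
      ((hinner v x).const_mul (2 * k))
    rw [h1, h2]
    refine (congrArg (fun L : ℂ →L[ℝ] ℝ => L v) h3.fderiv).trans ?_
    simp
    ring
  rw [laplacian_eq_fderiv_fderiv, hsecond, hsecond, smearDensity, smearCharge]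
  have hn : ‖x - c‖ ^ 2 = (x - c).re ^ 2 + (x - c).im ^ 2 := by
    rw [← Complex.normSq_eq_norm_sq, Complex.normSq_apply]; ring
  have hqx : q x = k * ((x - c).re ^ 2 + (x - c).im ^ 2) := by
    simp only [hq, hk, hn]; ring
  change _ = -(k * -(4 * (deriv smearProfile (q x) + q x * deriv (deriv smearProfile) (q x))))
  have i1 : inner ℝ (x - c) (1 : ℂ) = (x - c).re := by simp [Complex.inner]
  have i2 : inner ℝ (x - c) Complex.I = (x - c).im := by
    simp [Complex.inner]
    ring
  have i3 : inner ℝ (1 : ℂ) (1 : ℂ) = (1 : ℝ) := by simp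
  have i4 : inner ℝ Complex.I Complex.I = (1 : ℝ) := by simp
  rw [i1, i2, i3, i4]
  generalize deriv smearProfile (q x) = a at *
  generalize deriv (deriv smearProfile) (q x) = b at *
  rw [hqx]
  ring

lemma harmonicAt_smearPotential {c : ℂ} {r : ℝ} (hr : 0 < r) {x : ℂ} (hx : r < ‖x - c‖) :
    HarmonicAt (smearPotential c r) x := by
  refine ⟨(contDiff_infty.1 (contDiff_smearPotential c r) 2).contDiffAt, ?_⟩
  have hopen : IsOpen {x : ℂ | r < ‖x - c‖} := isOpen_lt continuous_const (by fun_prop)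
  filter_upwards [hopen.mem_nhds hx] with y hy
  have hy' : r < ‖y - c‖ := hy
  rw [laplacian_smearPotential, smearDensity_eq_zero hr hy'.le]
  simp

/-- The mean value property for radial averages. -/
lemma integral_mul_radial_eq {v : ℂ → ℝ} {c : ℂ} {r : ℝ}
    (hv : HarmonicOnNhd v (Metric.closedBall c r)) {ψ : ℝ → ℝ} (hψ : Continuous ψ)
    (hψ0 : ∀ τ, r ≤ τ → ψ τ = 0) :
    ∫ x, v x * ψ ‖x - c‖ = v c * (2 * Real.pi * ∫ τ in Ioi (0 : ℝ), τ * ψ τ) := by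
  have h1 : ∫ x, v x * ψ ‖x - c‖ = ∫ z, v (c + z) * ψ ‖z‖ := by
    rw [← integral_add_left_eq_self _ c]
    simp
  rw [h1, ← Complex.integral_comp_polarCoord_symm, polarCoord_target]
  set f : ℝ × ℝ → ℝ := fun p => p.1 * (v (circleMap c p.1 p.2) * ψ p.1) with hf
  have h2 : ∀ p ∈ Ioi (0 : ℝ) ×ˢ Ioo (-Real.pi) Real.pi,
      p.1 • (v (c + Complex.polarCoord.symm p) * ψ ‖Complex.polarCoord.symm p‖) = f p := by
    intro p hp
    rw [Complex.norm_polarCoord_symm, abs_of_pos hp.1, smul_eq_mul, Complex.polarCoord_symm_apply,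
      hf]
    simp only [circleMap, Complex.exp_mul_I, Complex.ofReal_cos, Complex.ofReal_sin]
  rw [setIntegral_congr_fun (measurableSet_Ioi.prod measurableSet_Ioo) h2]
  have hcont : ContinuousOn f (Icc 0 r ×ˢ Icc (-Real.pi) Real.pi) := by
    have hc1 : ContinuousOn (fun p : ℝ × ℝ => v (circleMap c p.1 p.2))
        (Icc 0 r ×ˢ Icc (-Real.pi) Real.pi) := by
      refine hv.continuousOn.comp (Continuous.continuousOn ?_) ?_
      · unfold circleMap
        fun_prop
      · intro p hp
        have hp1 := hp.1
        rw [Metric.mem_closedBall, dist_eq_norm]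
        simp only [circleMap, add_sub_cancel_left, norm_mul, Complex.norm_exp_ofReal_mul_I, mul_one,
          Complex.norm_real, Real.norm_eq_abs, abs_of_nonneg hp1.1]
        exact hp1.2
    have hc2 : Continuous fun p : ℝ × ℝ => ψ p.1 := hψ.comp continuous_fst
    exact continuous_fst.continuousOn.mul (hc1.mul hc2.continuousOn)
  have hint : IntegrableOn f (Ioi (0 : ℝ) ×ˢ Ioo (-Real.pi) Real.pi) := by
    have hcp := hcont.integrableOn_compact (isCompact_Icc.prod isCompact_Icc) (μ := volume)
    refine (hcp.mono_set (prod_mono Ioc_subset_Icc_self Ioo_subset_Icc_self :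
      Ioc 0 r ×ˢ Ioo (-Real.pi) Real.pi ⊆ _)).of_forall_sdiff_eq_zero
      (measurableSet_Ioi.prod measurableSet_Ioo) ?_
    rintro p ⟨hp, hp'⟩
    have : r ≤ p.1 := by
      by_contra hlt
      exact hp' ⟨⟨hp.1, (not_le.1 hlt).le⟩, hp.2⟩
    simp [hf, hψ0 _ this]
  rw [Measure.volume_eq_prod, setIntegral_prod _ hint]
  have hinner : ∀ τ ∈ Ioi (0 : ℝ), ∫ θ in Ioo (-Real.pi) Real.pi, f (τ, θ) =
      v c * (2 * Real.pi) * (τ * ψ τ) := by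
    intro τ hτ
    have hτ0 : 0 < τ := hτ
    rcases le_or_gt r τ with h | h
    · simp [hf, hψ0 _ h]
    have hm : HarmonicOnNhd v (Metric.closedBall c |τ|) :=
      hv.mono (Metric.closedBall_subset_closedBall (by rw [abs_of_pos hτ0]; exact h.le))
    have hav := hm.circleAverage_eq
    rw [Real.circleAverage_def] at hav
    have hper : Function.Periodic (fun θ => v (circleMap c τ θ)) (2 * Real.pi) := fun θ => by
      simp only [periodic_circleMap c τ θ]
    have h3 := hper.intervalIntegral_add_eq (-Real.pi) 0
    rw [show -Real.pi + 2 * Real.pi = Real.pi by ring, zero_add] at h3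
    have h4 : ∫ θ in Ioo (-Real.pi) Real.pi, v (circleMap c τ θ) = 2 * Real.pi * v c := by
      rw [← integral_Ioc_eq_integral_Ioo, ← intervalIntegral.integral_of_le
        (by linarith [Real.pi_pos]), h3, ← hav, smul_eq_mul]
      field_simp
    simp only [hf]
    rw [integral_const_mul, integral_mul_const, h4]
    ring
  rw [setIntegral_congr_fun measurableSet_Ioi hinner, integral_const_mul]
  ring

/-- The integrand is the derivative of `-2 q F'(q)` with `q = τ² / r²`, and `q F'(q) = -1/2` for `q
> 1`. The upper limit `2r` is safely past the support. -/
lemma integral_smearCharge {r : ℝ} (hr : 0 < r) :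
    ∫ τ in Ioi (0 : ℝ), τ * ((r ^ 2)⁻¹ * smearCharge (τ ^ 2 / r ^ 2)) = 1 := by
  set ψ : ℝ → ℝ := fun τ => τ * ((r ^ 2)⁻¹ * smearCharge (τ ^ 2 / r ^ 2)) with hψ
  set Φ : ℝ → ℝ := fun τ => -2 * (τ ^ 2 / r ^ 2 * deriv smearProfile (τ ^ 2 / r ^ 2)) with hΦ
  have hΦd : ∀ τ, HasDerivAt Φ (ψ τ) τ := by
    intro τ
    have h1 : HasDerivAt (fun τ : ℝ => τ ^ 2 / r ^ 2) (2 * τ / r ^ 2) τ := by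
      simpa using (hasDerivAt_pow 2 τ).div_const (r ^ 2)
    have h2 := (hasDerivAt_deriv_smearProfile (τ ^ 2 / r ^ 2)).comp τ h1
    have h3 := (h1.mul h2).const_mul (-2)
    refine h3.congr_deriv ?_
    simp only [hψ, smearCharge, Function.comp]
    field_simp
    ring
  have hψc : Continuous ψ := by
    have := continuous_smearCharge
    simp only [hψ]
    fun_prop
  have hsub : ∫ τ in Ioi (0 : ℝ), ψ τ = ∫ τ in Ioc (0 : ℝ) (2 * r), ψ τ := by
    refine (setIntegral_eq_of_subset_of_forall_sdiff_eq_zero measurableSet_Ioi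
      Ioc_subset_Ioi_self fun τ hτ => ?_)
    have h : 2 * r < τ := by
      by_contra hle
      exact hτ.2 ⟨hτ.1, not_lt.1 hle⟩
    have h1 : 1 ≤ τ ^ 2 / r ^ 2 := by
      rw [one_le_div (by positivity)]
      gcongr
      linarith
    simp [hψ, smearCharge_eq_zero h1]
  rw [hsub, ← intervalIntegral.integral_of_le (by positivity),
    intervalIntegral.integral_eq_sub_of_hasDerivAt (fun τ _ => hΦd τ)
      (hψc.intervalIntegrable _ _)]
  have h4 : (2 * r) ^ 2 / r ^ 2 = 4 := by field_simp; norm_num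
  simp only [hΦ, h4]
  rw [deriv_smearProfile (by norm_num)]
  norm_num

/-- Harmonic functions do not see the smearing. -/
theorem integral_mul_smearDensity {v : ℂ → ℝ} {c : ℂ} {r : ℝ} (hr : 0 < r)
    (hv : HarmonicOnNhd v (Metric.closedBall c r)) :
    ∫ x, v x * smearDensity c r x = 2 * Real.pi * v c := by
  have hψ : Continuous fun τ : ℝ => (r ^ 2)⁻¹ * smearCharge (τ ^ 2 / r ^ 2) := by
    have := continuous_smearCharge
    fun_prop
  have h := integral_mul_radial_eq hv hψ fun τ hτ => by
    have h1 : 1 ≤ τ ^ 2 / r ^ 2 := by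
      rw [one_le_div (by positivity)]
      gcongr
    simp [smearCharge_eq_zero h1]
  rw [integral_smearCharge hr] at h
  rw [mul_comm (2 * Real.pi), ← mul_one (2 * Real.pi)]
  exact h

/-- The self-energy of the charge smeared over the unit disc. -/
noncomputable def selfEnergy : ℝ := ∫ x : ℂ, smearProfile (‖x‖ ^ 2) * smearCharge (‖x‖ ^ 2)

/-- The density has total charge `2π`, so the shift `-log r` of the potential contributes `-2π log
r`; what remains is independent of `c` and `r` by translation and dilation. -/
theorem integral_smearPotential_mul_smearDensity (c : ℂ) {r : ℝ} (hr : 0 < r) :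
    ∫ x, smearPotential c r x * smearDensity c r x = selfEnergy - 2 * Real.pi * Real.log r := by
  have hdc := continuous_smearDensity c r
  have hcs : HasCompactSupport (smearDensity c r) :=
    HasCompactSupport.intro (isCompact_closedBall c r) fun x hx =>
      smearDensity_eq_zero hr (by
        rw [Metric.mem_closedBall, not_le, dist_eq_norm] at hx
        exact hx.le)
  have hF : Continuous fun x : ℂ => smearProfile (‖x - c‖ ^ 2 / r ^ 2) := by
    have := contDiff_smearProfile.continuous
    fun_prop
  have h1 : ∫ x, smearPotential c r x * smearDensity c r x =
      (∫ x, smearProfile (‖x - c‖ ^ 2 / r ^ 2) * smearDensity c r x) -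
        ∫ x, Real.log r * smearDensity c r x := by
    have i1 : Integrable fun x => smearProfile (‖x - c‖ ^ 2 / r ^ 2) * smearDensity c r x :=
      (hF.mul hdc).integrable_of_hasCompactSupport hcs.mul_left
    have i2 : Integrable fun x => Real.log r * smearDensity c r x :=
      (continuous_const.mul hdc).integrable_of_hasCompactSupport hcs.mul_left
    rw [← integral_sub i1 i2]
    refine integral_congr_ae (Filter.Eventually.of_forall fun x => ?_)
    simp only [smearPotential]
    ring
  have h2 : ∫ x, Real.log r * smearDensity c r x = 2 * Real.pi * Real.log r :=
    integral_mul_smearDensity hr (harmonicOnNhd_const _)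
  have h3 : ∫ x, smearProfile (‖x - c‖ ^ 2 / r ^ 2) * smearDensity c r x = selfEnergy := by
    have h4 := integral_sub_right_eq_self (μ := volume) (fun x : ℂ =>
      smearProfile (‖x‖ ^ 2 / r ^ 2) * ((r ^ 2)⁻¹ * smearCharge (‖x‖ ^ 2 / r ^ 2))) c
    simp only [smearDensity]
    rw [h4]
    have h5 := Measure.integral_comp_inv_smul (volume : Measure ℂ)
      (fun x : ℂ => smearProfile (‖x‖ ^ 2) * smearCharge (‖x‖ ^ 2)) r
    have h6 : ∀ x : ℂ, ‖r⁻¹ • x‖ ^ 2 = ‖x‖ ^ 2 / r ^ 2 := fun x => by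
      rw [norm_smul, Real.norm_eq_abs, abs_of_pos (inv_pos.2 hr)]
      field_simp
    simp only [h6, Complex.finrank_real_complex, abs_of_pos (pow_pos hr 2), smul_eq_mul] at h5
    have h7 : selfEnergy = (r ^ 2)⁻¹ * ∫ x : ℂ,
        smearProfile (‖x‖ ^ 2 / r ^ 2) * smearCharge (‖x‖ ^ 2 / r ^ 2) := by
      rw [h5, selfEnergy]
      field_simp
    rw [h7, ← integral_const_mul]
    refine integral_congr_ae (Filter.Eventually.of_forall fun x => ?_)
    simp only
    ring
  rw [h1, h2, h3]

end Smearing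

/-! ### Onsager's inequality for the Green's function. -/

section Onsager

variable {Ω : Set ℂ}

/-- The maximum principle for harmonic functions on a bounded open set. -/
lemma harmonicContOnCl_le_of_frontier_le (hΩ : IsOpen Ω) (hb : Bornology.IsBounded Ω) {h : ℂ → ℝ}
    (hh : HarmonicContOnCl h Ω) {B : ℝ} (h0 : ∀ z ∈ frontier Ω, h z ≤ B) {z : ℂ}
    (hz : z ∈ closure Ω) : h z ≤ B := by
  by_contra! hpos
  have hc : IsCompact (closure Ω) := hb.isCompact_closure
  obtain ⟨m, hm, hmax⟩ := hc.exists_isMaxOn ⟨z, hz⟩ hh.continuousOn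
  have hmpos : B < h m := lt_of_lt_of_le hpos (hmax hz)
  -- Take the maximum point `a` with largest real part. Near `a`, `h` is the real part of an
  -- analytic `F`, and `|exp F|` has a local maximum at `a`, so `h` is constant nearby. The point `a
  -- + r / 2` then contradicts the choice of `a`.
  have hA : IsCompact (closure Ω ∩ h ⁻¹' {h m}) :=
    hc.of_isClosed_subset
      (hh.continuousOn.preimage_isClosed_of_isClosed isClosed_closure isClosed_singleton)
      Set.inter_subset_left
  obtain ⟨a, ⟨ha, ham⟩, hamax⟩ := hA.exists_isMaxOn ⟨m, hm, rfl⟩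
    Complex.continuous_re.continuousOn
  have ham' : h a = h m := ham
  have haΩ : a ∈ Ω := by
    by_contra hna
    have : a ∈ frontier Ω := by
      rw [hΩ.frontier_eq]; exact ⟨ha, hna⟩
    have := h0 a this
    linarith
  obtain ⟨r, hr, hball⟩ := Metric.isOpen_iff.1 hΩ a haΩ
  obtain ⟨F, hF, hFe⟩ :=
    HarmonicOnNhd.exists_analyticOnNhd_ball_re_eq (hh.harmonicOnNhd.mono hball)
  have hr2 : Metric.closedBall a (r / 2) ⊆ Metric.ball a r :=
    Metric.closedBall_subset_ball (by linarith)
  have hd : DiffContOnCl ℂ (fun w => Complex.exp (F w)) (Metric.ball a (r / 2)) := by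
    apply DifferentiableOn.diffContOnCl
    intro w hw
    rw [closure_ball _ (by linarith)] at hw
    exact (hF w (hr2 hw)).differentiableAt.cexp.differentiableWithinAt
  have hre : ∀ w ∈ Metric.ball a r, (F w).re = h w := fun w hw => hFe hw
  have hmx : IsMaxOn (norm ∘ fun w => Complex.exp (F w)) (Metric.ball a (r / 2)) a := by
    intro w hw
    have hw' := Metric.ball_subset_ball (by linarith : r / 2 ≤ r) hw
    simp only [Set.mem_ofPred_eq, Function.comp, Complex.norm_exp]
    rw [hre w hw', hre a (Metric.mem_ball_self hr), ham']
    exact Real.exp_le_exp.2 (hmax (subset_closure (hball hw')))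
  have heq := Complex.norm_eqOn_closedBall_of_isMaxOn hd hmx
  have hp : a + (r / 2 : ℝ) ∈ Metric.closedBall a (r / 2) := by
    simp [abs_of_pos hr]
  have hp' := hr2 hp
  have h1 := heq hp
  simp only [Function.comp, Complex.norm_exp, Real.exp_eq_exp, Function.const] at h1
  rw [hre _ hp', hre a (Metric.mem_ball_self hr), ham'] at h1
  have h2 := hamax (show a + (r / 2 : ℝ) ∈ closure Ω ∩ h ⁻¹' {h m} from
    ⟨subset_closure (hball hp'), h1⟩)
  simp at h2
  linarith

/-- The boundary values are `(2π)⁻¹ log |z - y|`, controlled by the diameter; the maximum principle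
carries the bound inside. In particular it holds on the diagonal, where it bounds the
self-interaction. -/
lemma IsGreenRegularPart.le_log (hΩ : IsOpen Ω) (hb : Bornology.IsBounded Ω) {g : ℂ → ℂ → ℝ}
    (hg : IsGreenRegularPart Ω g) {R : ℝ} (hR : ∀ x ∈ closure Ω, ∀ y ∈ closure Ω, ‖x - y‖ ≤ R)
    {x y : ℂ} (hx : x ∈ Ω) (hy : y ∈ Ω) : g x y ≤ (2 * Real.pi)⁻¹ * Real.log R := by
  refine harmonicContOnCl_le_of_frontier_le hΩ hb (hg.harmonic y hy) (fun z hz => ?_) (subset_closure hx)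
  rw [hg.boundary y hy z hz, Real.log_inv, mul_neg, neg_neg]
  have hne : 0 < ‖z - y‖ := by
    rw [norm_pos_iff, sub_ne_zero]
    rintro rfl
    rw [hΩ.frontier_eq] at hz
    exact hz.2 hy
  have := Real.log_le_log hne (hR z (frontier_subset_closure hz) y (subset_closure hy))
  have hpi := Real.pi_pos
  gcongr

/-- Positivity of the electrostatic energy of finitely many charges, smeared out over disjoint discs
in `Ω`. -/
theorem IsGreenRegularPart.energy_nonneg (hΩ : IsOpen Ω) (hb : Bornology.IsBounded Ω)
    {g : ℂ → ℂ → ℝ} (hg : IsGreenRegularPart Ω g) {ι : Type*} [Fintype ι] [DecidableEq ι]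
    (α : ι → ℝ) (c : ι → ℂ) (r : ι → ℝ) (hr : ∀ k, 0 < r k)
    (hball : ∀ k, Metric.closedBall (c k) (r k) ⊆ Ω)
    (hdisj : ∀ k l, k ≠ l → r k + r l < ‖c k - c l‖) :
    0 ≤ ∑ k, ∑ l, α k * α l * (if k = l then
      selfEnergy - 2 * Real.pi * Real.log (r k) + 4 * Real.pi ^ 2 * g (c k) (c k)
      else 4 * Real.pi ^ 2 * ((2 * Real.pi)⁻¹ * Real.log ‖c l - c k‖⁻¹ + g (c l) (c k))) := by
  have hcΩ : ∀ k, c k ∈ Ω := fun k => hball k (Metric.mem_closedBall_self (hr k).le)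
  -- Outside its disc `V k` equals `2π` times the Green's function, so it vanishes on the boundary
  -- of `Ω`.
  set V : ι → ℂ → ℝ := fun k x => smearPotential (c k) (r k) x + 2 * Real.pi * g x (c k) with hV
  set σ : ι → ℂ → ℝ := fun l => smearDensity (c l) (r l) with hσ
  have hgh : ∀ k, HarmonicContOnCl (fun x => g x (c k)) Ω := fun k => hg.harmonic _ (hcΩ k)
  have hgh2 : ∀ k, HarmonicOnNhd (fun x => 2 * Real.pi * g x (c k)) Ω := fun k x hx =>
    ((hgh k).harmonicOnNhd x hx).const_smul (c := 2 * Real.pi)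
  have hVc : ∀ k, ContinuousOn (V k) (closure Ω) := fun k =>
    (contDiff_smearPotential _ _).continuous.continuousOn.add
      (continuousOn_const.mul (hgh k).continuousOn)
  have hV0 : ∀ k, ∀ x ∈ frontier Ω, V k x = 0 := by
    intro k x hx
    have hxr : r k ≤ ‖x - c k‖ := by
      by_contra hlt
      rw [hΩ.frontier_eq] at hx
      exact hx.2 (hball k (by rw [Metric.mem_closedBall, dist_eq_norm]; exact (not_le.1 hlt).le))
    simp only [hV]
    rw [smearPotential_eq (hr k) hxr, hg.boundary _ (hcΩ k) x hx]
    have := Real.pi_pos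
    field_simp
    ring
  have hV2 : ∀ k, ∀ x ∈ Ω, ContDiffAt ℝ 2 (V k) x := fun k x hx =>
    (contDiff_infty.1 (contDiff_smearPotential _ _) 2).contDiffAt.add (hgh2 k x hx).1
  have hVl : ∀ k, ∀ x ∈ Ω, Laplacian.laplacian (V k) x = -σ k x := by
    intro k x hx
    have h1 := ContDiffAt.laplacian_add
      (contDiff_infty.1 (contDiff_smearPotential (c k) (r k)) 2).contDiffAt (hgh2 k x hx).1
    have h2 : Laplacian.laplacian (fun x => 2 * Real.pi * g x (c k)) x = 0 := (hgh2 k x hx).2.self_of_nhds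
    rw [h2, add_zero, laplacian_smearPotential] at h1
    exact h1
  have hσc : ∀ l, Continuous (σ l) := fun l => continuous_smearDensity _ _
  have hσ0 : ∀ l, ∀ x ∉ Ω, σ l x = 0 := fun l x hx => smearDensity_eq_zero (hr l) (by
    by_contra hlt
    exact hx (hball l (by rw [Metric.mem_closedBall, dist_eq_norm]; exact (not_le.1 hlt).le)))
  have hint : ∀ w : ℂ → ℝ, ContinuousOn w (closure Ω) → ∀ l, IntegrableOn (fun x => w x * σ l x) Ω :=
    fun w hw l => ((hw.mul (hσc l).continuousOn).integrableOn_compact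
      hb.isCompact_closure).mono_set subset_closure
  have hfull : ∀ w : ℂ → ℝ, ∀ l, ∫ x in Ω, w x * σ l x = ∫ x, w x * σ l x := fun w l =>
    setIntegral_eq_integral_of_forall_compl_eq_zero fun x hx => by rw [hσ0 l x hx, mul_zero]
  -- For `k ≠ l` the potential `V k` is harmonic on the disc of `l`, so smearing the charge at `l`
  -- returns `2π V k (c l)`. Only the diagonal terms feel the radii.
  have hpair : ∀ k l, ∫ x in Ω, V k x * σ l x = if k = l then
      selfEnergy - 2 * Real.pi * Real.log (r k) + 4 * Real.pi ^ 2 * g (c k) (c k)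
      else 4 * Real.pi ^ 2 * ((2 * Real.pi)⁻¹ * Real.log ‖c l - c k‖⁻¹ + g (c l) (c k)) := by
    intro k l
    split_ifs with hkl
    · subst hkl
      have h1 : ∫ x in Ω, V k x * σ k x =
          (∫ x in Ω, smearPotential (c k) (r k) x * σ k x) +
            ∫ x in Ω, (2 * Real.pi * g x (c k)) * σ k x := by
        have i2 : IntegrableOn (fun x => (2 * Real.pi * g x (c k)) * σ k x) Ω :=
          hint _ (continuousOn_const.mul (hgh k).continuousOn) k
        rw [← integral_add (hint _ (contDiff_smearPotential _ _).continuous.continuousOn k) i2]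
        refine integral_congr_ae (Filter.Eventually.of_forall fun x => ?_)
        simp only [hV]
        ring
      rw [h1, hfull, hfull, hσ]
      simp only
      rw [integral_smearPotential_mul_smearDensity _ (hr k),
        integral_mul_smearDensity (hr k) ((hgh2 k).mono (hball k))]
      ring
    · have hfar : ∀ x ∈ Metric.closedBall (c l) (r l), r k < ‖x - c k‖ := by
        intro x hx
        rw [Metric.mem_closedBall, dist_eq_norm] at hx
        have h1 := hdisj k l hkl
        have h2 : ‖c k - c l‖ ≤ ‖x - c k‖ + ‖x - c l‖ := by
          rw [norm_sub_rev x (c k)]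
          exact norm_sub_le_norm_sub_add_norm_sub _ _ _
        linarith
      have hharm : HarmonicOnNhd (V k) (Metric.closedBall (c l) (r l)) := fun x hx =>
        (harmonicAt_smearPotential (hr k) (hfar x hx)).add (hgh2 k x (hball l hx))
      rw [hfull, hσ]
      simp only
      rw [integral_mul_smearDensity (hr l) hharm]
      simp only [hV]
      rw [smearPotential_eq (hr k) (hfar _ (Metric.mem_closedBall_self (hr l).le)).le]
      have := Real.pi_pos
      field_simp
      ring
  set u : ℂ → ℝ := fun x => ∑ k, α k * V k x with hu
  set μ : ℂ → ℝ := fun x => ∑ l, α l * σ l x with hμ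
  have hpos := integral_mul_nonneg_of_laplacian hΩ hb (u := u) (μ := μ)
    (continuousOn_finsetSum _ fun k _ => continuousOn_const.mul (hVc k))
    (fun x hx => by simp [hu, hV0 _ x hx])
    (fun x hx => (ContDiffAt.sum fun k _ => contDiffAt_const.mul (hV2 k x hx)).contDiffWithinAt)
    (fun x hx => by
      have hS : ∀ T : Finset ι, ContDiffAt ℝ 2 (fun x => ∑ k ∈ T, α k * V k x) x ∧
          Laplacian.laplacian (fun x => ∑ k ∈ T, α k * V k x) x = -∑ k ∈ T, α k * σ k x := by
        intro T
        induction T using Finset.induction_on with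
        | empty => exact ⟨by simpa using contDiffAt_const, by simp⟩
        | insert i T hi ih =>
          have h1 : ContDiffAt ℝ 2 (α i • V i) x := contDiffAt_const.smul (hV2 i x hx)
          have h2 : (fun x => ∑ k ∈ insert i T, α k * V k x) =
              α i • V i + fun x => ∑ k ∈ T, α k * V k x := by
            funext y
            simp [Finset.sum_insert hi]
          rw [h2, Finset.sum_insert hi, h1.laplacian_add ih.1, ih.2,
            laplacian_smul _ (hV2 i x hx), hVl i x hx]
          exact ⟨h1.add ih.1, by simp; ring⟩
      exact (hS Finset.univ).2)
    (continuous_finsetSum _ fun l _ => continuous_const.mul (hσc l))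
  refine hpos.trans (le_of_eq ?_)
  have hexp : ∀ x, u x * μ x = ∑ k, ∑ l, α k * α l * (V k x * σ l x) := by
    intro x
    simp only [hu, hμ, Finset.sum_mul_sum]
    exact Finset.sum_congr rfl fun k _ => Finset.sum_congr rfl fun l _ => by ring
  simp only [hexp]
  rw [integral_finsetSum _ fun k _ => integrable_finsetSum _ fun l _ =>
    (hint _ (hVc k) l).const_mul _]
  refine Finset.sum_congr rfl fun k _ => ?_
  rw [integral_finsetSum _ fun l _ => (hint _ (hVc k) l).const_mul _]
  refine Finset.sum_congr rfl fun l _ => ?_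
  rw [integral_const_mul, hpair]

lemma sum_offDiag_eq_two_mul {n : ℕ} (f : Fin n → Fin n → ℝ) (hf : ∀ k l, f k l = f l k) :
    ∑ k, ∑ l, f k l = ∑ k, f k k + 2 * ∑ k, ∑ l ∈ Finset.Ioi k, f k l := by
  have h1 : ∀ k, ∑ l, f k l = f k k + (∑ l ∈ Finset.Ioi k, f k l + ∑ l ∈ Finset.Iio k, f k l) := by
    intro k
    have hu : (Finset.univ : Finset (Fin n)) =
        insert k (Finset.Ioi k ∪ Finset.Iio k) := by
      ext l
      simp only [Finset.mem_univ, Finset.mem_insert, Finset.mem_union, Finset.mem_Ioi,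
        Finset.mem_Iio, true_iff]
      rcases lt_trichotomy l k with h | h | h <;> simp [h]
    rw [hu, Finset.sum_insert (by simp), Finset.sum_union]
    rw [Finset.disjoint_left]
    intro l hl hl'
    exact absurd (Finset.mem_Ioi.1 hl) (not_lt.2 (Finset.mem_Iio.1 hl').le)
  have h2 : ∑ k, ∑ l ∈ Finset.Iio k, f k l = ∑ k, ∑ l ∈ Finset.Ioi k, f k l := by
    rw [Finset.sum_comm' (t' := Finset.univ) (s' := fun l => Finset.Ioi l) (by simp)]
    exact Finset.sum_congr rfl fun k _ => Finset.sum_congr rfl fun l _ => hf _ _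
  simp only [h1, Finset.sum_add_distrib, h2]
  ring

/-- Onsager's inequality for the Green's function with a regular part. -/
lemma IsGreenRegularPart.neg_sum_le (hΩ : IsOpen Ω) (hb : Bornology.IsBounded Ω)
    {g : ℂ → ℂ → ℝ} (hg : IsGreenRegularPart Ω g) {n : ℕ}
    (α : Fin n → ℝ) (c : Fin n → ℂ) (r : Fin n → ℝ) (hr : ∀ k, 0 < r k)
    (hball : ∀ k, Metric.closedBall (c k) (r k) ⊆ Ω)
    (hdisj : ∀ k l, k ≠ l → r k + r l < ‖c k - c l‖) :
    -∑ k, ∑ l ∈ Finset.Ioi k, α k * α l *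
        ((2 * Real.pi)⁻¹ * Real.log ‖c k - c l‖⁻¹ + g (c k) (c l)) ≤
      ∑ k, α k ^ 2 / 2 * (selfEnergy / (4 * Real.pi ^ 2) + g (c k) (c k) -
        (2 * Real.pi)⁻¹ * Real.log (r k)) := by
  have hcΩ : ∀ k, c k ∈ Ω := fun k => hball k (Metric.mem_closedBall_self (hr k).le)
  have hpi := Real.pi_pos
  have h := hg.energy_nonneg hΩ hb α c r hr hball hdisj
  rw [sum_offDiag_eq_two_mul] at h
  · simp only [if_true] at h
    have h1 : ∑ k, ∑ l ∈ Finset.Ioi k, α k * α l * (if k = l then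
        selfEnergy - 2 * Real.pi * Real.log (r k) + 4 * Real.pi ^ 2 * g (c k) (c k)
        else 4 * Real.pi ^ 2 * ((2 * Real.pi)⁻¹ * Real.log ‖c l - c k‖⁻¹ + g (c l) (c k))) =
        4 * Real.pi ^ 2 * ∑ k, ∑ l ∈ Finset.Ioi k, α k * α l *
        ((2 * Real.pi)⁻¹ * Real.log ‖c k - c l‖⁻¹ + g (c k) (c l)) := by
      simp only [Finset.mul_sum]
      refine Finset.sum_congr rfl fun k _ => Finset.sum_congr rfl fun l hl => ?_
      rw [if_neg (Finset.mem_Ioi.1 hl).ne, norm_sub_rev (c l), hg.symm _ (hcΩ l) _ (hcΩ k)]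
      ring
    have h2 : ∑ k, α k * α k *
        (selfEnergy - 2 * Real.pi * Real.log (r k) + 4 * Real.pi ^ 2 * g (c k) (c k)) =
        8 * Real.pi ^ 2 * ∑ k, α k ^ 2 / 2 * (selfEnergy / (4 * Real.pi ^ 2) + g (c k) (c k) -
        (2 * Real.pi)⁻¹ * Real.log (r k)) := by
      rw [Finset.mul_sum]
      refine Finset.sum_congr rfl fun k _ => ?_
      field_simp
      ring
    rw [h1, h2] at h
    have h3 : 0 < 8 * Real.pi ^ 2 := by positivity
    nlinarith
  · intro k l
    by_cases hkl : k = l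
    · subst hkl; rfl
    · rw [if_neg hkl, if_neg (Ne.symm hkl), norm_sub_rev (c l), hg.symm _ (hcΩ l) _ (hcΩ k)]
      ring

/-- Onsager's inequality in the form of a product bound for the Boltzmann weight. -/
theorem exists_coulombWeight_le (hΩ : IsOpen Ω) (hb : Bornology.IsBounded Ω) {a : ℝ}
    (ha : a ^ 2 ≤ 4 * Real.pi) :
    ∃ C : ℝ, 1 ≤ C ∧ ∀ (n : ℕ) (α : Fin n → ℝ) (x : Fin n → ℂ) (r : Fin n → ℝ),
      (∀ k, |α k| ≤ a) → (∀ k, 0 < r k) → (∀ k, r k ≤ 1) →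
      (∀ k, Metric.closedBall (x k) (r k) ⊆ Ω) →
      (∀ k l, k ≠ l → r k + r l < ‖x k - x l‖) →
      coulombWeight Ω α x ≤ ∏ k, C * r k ^ (-(a ^ 2 / (4 * Real.pi))) := by
  have hpi := Real.pi_pos
  obtain ⟨R, hR⟩ := Metric.isBounded_iff.1 hb.closure
  set A := |selfEnergy| / (4 * Real.pi ^ 2) + (2 * Real.pi)⁻¹ * |Real.log R| with hA
  have hA0 : 0 ≤ A := by positivity
  refine ⟨Real.exp (2 * Real.pi * A), Real.one_le_exp (by positivity), ?_⟩
  intro n α x r hα hr hr1 hball hdisj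
  have hxΩ : ∀ k, x k ∈ Ω := fun k => hball k (Metric.mem_closedBall_self (hr k).le)
  by_cases hg : ∃ g, IsGreenRegularPart Ω g
  · have hspec := hg.choose_spec
    set g := hg.choose with hgdef
    have hG : ∀ x y, greenFunction Ω x y =
        (2 * Real.pi)⁻¹ * Real.log ‖x - y‖⁻¹ + g x y := fun x y => by
      rw [greenFunction, dif_pos hg]
    have h1 := hspec.neg_sum_le hΩ hb α x r hr hball hdisj
    simp only [coulombWeight, hG]
    refine (Real.exp_le_exp.2 h1).trans ?_
    rw [Real.exp_sum]
    refine Finset.prod_le_prod (fun k _ => (Real.exp_pos _).le) fun k _ => ?_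
    rw [Real.rpow_def_of_pos (hr k), ← Real.exp_add]
    apply Real.exp_le_exp.2
    have hα2 : α k ^ 2 ≤ a ^ 2 := sq_le_sq.2 ((hα k).trans (le_abs_self a))
    have hlog : Real.log (r k) ≤ 0 := Real.log_nonpos (hr k).le (hr1 k)
    have hgk : g (x k) (x k) ≤ (2 * Real.pi)⁻¹ * |Real.log R| :=
      (hspec.le_log hΩ hb (fun x hx y hy => by rw [← dist_eq_norm]; exact hR hx hy)
        (hxΩ k) (hxΩ k)).trans (by gcongr; exact le_abs_self _)
    have hE : selfEnergy / (4 * Real.pi ^ 2) ≤ |selfEnergy| / (4 * Real.pi ^ 2) := by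
      gcongr
      exact le_abs_self _
    have h2 : α k ^ 2 / 2 * (selfEnergy / (4 * Real.pi ^ 2) + g (x k) (x k)) ≤
        2 * Real.pi * A :=
      calc _ ≤ α k ^ 2 / 2 * A := by
            apply mul_le_mul_of_nonneg_left _ (by positivity)
            rw [hA]; linarith
        _ ≤ 2 * Real.pi * A := by
            apply mul_le_mul_of_nonneg_right _ hA0
            linarith
    -- Since `r k ≤ 1`, the logarithm is nonpositive and `α k ^ 2` may be enlarged to `a ^ 2`.
    have h3 : α k ^ 2 / 2 * (-((2 * Real.pi)⁻¹ * Real.log (r k))) ≤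
        Real.log (r k) * -(a ^ 2 / (4 * Real.pi)) := by
      have : a ^ 2 / (4 * Real.pi) - α k ^ 2 / (4 * Real.pi) ≥ 0 := by
        rw [← sub_div]
        exact div_nonneg (by linarith) (by positivity)
      have h4 : α k ^ 2 / 2 * (-((2 * Real.pi)⁻¹ * Real.log (r k))) =
          -(α k ^ 2 / (4 * Real.pi)) * Real.log (r k) := by
        field_simp
        ring
      rw [h4]
      nlinarith
    linarith [h2, h3]
  · have h1 : coulombWeight Ω α x = 1 := by
      simp [coulombWeight, greenFunction, hg]
    rw [h1]
    calc (1 : ℝ) = ∏ _k : Fin n, (1 : ℝ) := by simp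
      _ ≤ _ := by
        refine Finset.prod_le_prod (fun _ _ => zero_le_one) fun k _ => ?_
        refine one_le_mul_of_one_le_of_one_le (Real.one_le_exp (by positivity)) ?_
        exact Real.one_le_rpow_of_pos_of_le_one_of_nonpos (hr k) (hr1 k)
          (neg_nonpos.2 (by positivity))

end Onsager

/-! ### Measurability, and the Boltzmann weight in terms of nearest neighbours. -/

section Assembly

variable {Ω : Set ℂ}

/-- Harmonicity gives continuity of the regular part in the first variable, and symmetry in the
second; separate continuity suffices for joint measurability. -/
lemma exists_measurable_eq_greenFunction (hΩ : IsOpen Ω) :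
    ∃ G : ℂ × ℂ → ℝ, Measurable G ∧ ∀ x ∈ Ω, ∀ y ∈ Ω, G (x, y) = greenFunction Ω x y := by
  by_cases hg : ∃ g, IsGreenRegularPart Ω g
  swap
  · exact ⟨fun _ => 0, measurable_const, fun x _ y _ => by simp [greenFunction, hg]⟩
  have hspec := hg.choose_spec
  set g := hg.choose with hgdef
  have hu : Measurable (Function.uncurry fun (x : Ω) (y : Ω) => g x y) := by
    apply measurable_uncurry_of_continuous_of_measurable
    · intro y
      exact ((hspec.harmonic y y.2).continuousOn.mono subset_closure).domRestrict
    · intro x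
      have h1 : Continuous fun y : Ω => g y x :=
        ((hspec.harmonic x x.2).continuousOn.mono subset_closure).domRestrict
      have h2 : (fun y : Ω => g x y) = fun y : Ω => g y x :=
        funext fun y => hspec.symm _ x.2 _ y.2
      rw [h2]
      exact h1.measurable
  have he : MeasurableEmbedding (Prod.map ((↑) : Ω → ℂ) ((↑) : Ω → ℂ)) :=
    (MeasurableEmbedding.subtype_coe hΩ.measurableSet).prodMap
      (MeasurableEmbedding.subtype_coe hΩ.measurableSet)
  refine ⟨fun p => (2 * Real.pi)⁻¹ * Real.log ‖p.1 - p.2‖⁻¹ +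
    Function.extend (Prod.map ((↑) : Ω → ℂ) ((↑) : Ω → ℂ))
      (Function.uncurry fun (x : Ω) (y : Ω) => g x y) 0 p, ?_, ?_⟩
  · have := he.measurable_extend hu (measurable_const (a := (0 : ℝ)))
    exact Measurable.add (by fun_prop) this
  · intro x hx y hy
    have h1 := he.injective.extend_apply (Function.uncurry fun (x : Ω) (y : Ω) => g x y) 0
      (⟨x, hx⟩, ⟨y, hy⟩)
    simp only [Prod.map_apply, Function.uncurry_apply_pair] at h1
    rw [greenFunction, dif_pos hg]
    exact congrArg _ h1

lemma aestronglyMeasurable_coulombIntegrand (hΩ : IsOpen Ω) {m : ℕ} (α : Fin (m + 2) → ℝ)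
    {f : Fin m → ℂ → ℂ} (hf : ∀ j, Continuous (f j)) {x₁ x₂ : ℂ} (h₁ : x₁ ∈ Ω) (h₂ : x₂ ∈ Ω) :
    AEStronglyMeasurable (coulombIntegrand Ω α f x₁ x₂)
      (volume.restrict (Set.univ.pi fun _ => Ω)) := by
  obtain ⟨G, hG, hGe⟩ := exists_measurable_eq_greenFunction hΩ
  set X : (Fin m → ℂ) → Fin (m + 2) → ℂ := fun y => Fin.cons x₁ (Fin.cons x₂ y) with hX
  have hXm : ∀ k, Measurable fun y => X y k := by
    intro k
    refine Fin.cases ?_ (fun k => Fin.cases ?_ (fun k => ?_) k) k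
    · exact measurable_const
    · exact measurable_const
    · exact measurable_pi_apply k
  have hm : Measurable fun y : Fin m → ℂ => (∏ j, f j (y j)) *
      (Real.exp (-∑ k, ∑ l ∈ Finset.Ioi k, α k * α l * G (X y k, X y l)) : ℂ) := by
    refine Measurable.mul ?_ ?_
    · exact Finset.measurable_fun_prod _ fun j _ => (hf j).measurable.comp (measurable_pi_apply j)
    · refine Complex.measurable_ofReal.comp (Real.measurable_exp.comp (Measurable.neg ?_))
      exact Finset.measurable_fun_sum _ fun k _ => Finset.measurable_fun_sum _ fun l _ =>
        (hG.comp ((hXm k).prodMk (hXm l))).const_mul _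
  refine hm.aestronglyMeasurable.congr ?_
  filter_upwards [ae_restrict_mem (MeasurableSet.univ_pi fun _ => hΩ.measurableSet)] with y hy
  have hXΩ : ∀ k, X y k ∈ Ω := by
    intro k
    refine Fin.cases ?_ (fun k => Fin.cases ?_ (fun k => ?_) k) k
    · exact h₁
    · exact h₂
    · exact hy k trivial
  have hsum : ∑ k, ∑ l ∈ Finset.Ioi k, α k * α l * G (X y k, X y l) =
      ∑ k, ∑ l ∈ Finset.Ioi k, α k * α l * greenFunction Ω (X y k) (X y l) :=
    Finset.sum_congr rfl fun k _ => Finset.sum_congr rfl fun l _ => by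
      rw [hGe _ (hXΩ k) _ (hXΩ l)]
  rw [hsum]
  rfl

lemma nnDist_ne_top {n : ℕ} (hn : 2 ≤ n) (x : Fin n → ℂ) (k : Fin n) :
    nnDist Finset.univ x k ≠ ⊤ := by
  have : Nontrivial (Fin n) := Fin.nontrivial_iff_two_le.2 hn
  obtain ⟨l, hl⟩ := exists_ne k
  exact ne_top_of_le_ne_top (edist_ne_top _ _) (nnDist_le (Finset.mem_univ l) hl)

lemma nnDist_ne_zero {n : ℕ} (hn : 2 ≤ n) {x : Fin n → ℂ} (hx : Function.Injective x) (k : Fin n) :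
    nnDist Finset.univ x k ≠ 0 := by
  obtain ⟨l, -, hlk, h⟩ := exists_nnDist_eq (nnDist_ne_top hn x k)
  rw [h, Ne, edist_eq_zero]
  exact fun h => hlk (hx h).symm

/-- The Boltzmann weight of charges in a fixed compact subset of `Ω`, in terms of the nearest
neighbour distances. -/
theorem exists_coulombWeight_le_prod_max (hΩ : IsOpen Ω) (hb : Bornology.IsBounded Ω) {a : ℝ}
    (ha : a ^ 2 ≤ 4 * Real.pi) {L : Set ℂ} (hL : IsCompact L) (hLΩ : L ⊆ Ω) :
    ∃ C : ℝ, 1 ≤ C ∧ ∀ (n : ℕ), 2 ≤ n → ∀ (α : Fin n → ℝ) (x : Fin n → ℂ), ‖α‖ = a →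
      (∀ k, x k ∈ L) → ENNReal.ofReal (coulombWeight Ω α x) ≤
        ENNReal.ofReal (C * (n : ℝ) ^ (a ^ 2 / (8 * Real.pi))) ^ n *
        ∏ k, (max 1 (ENNReal.ofReal ((n : ℝ) ^ (-(1 / 2) : ℝ)) / nnDist Finset.univ x k)) ^
          (a ^ 2 / (4 * Real.pi)) := by
  have hpi := Real.pi_pos
  obtain ⟨C₀, hC₀, hW⟩ := exists_coulombWeight_le hΩ hb ha
  obtain ⟨δ₀, hδ₀, hthick⟩ := hL.exists_cthickening_subset_open hΩ hLΩ
  set δ := min δ₀ 1 with hδ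
  have hδ0 : 0 < δ := lt_min hδ₀ one_pos
  have hδ1 : δ ≤ 1 := min_le_right _ _
  set β := a ^ 2 / (4 * Real.pi) with hβ
  have hβ0 : 0 ≤ β := by positivity
  have hβ1 : 1 ≤ (3 / δ) ^ β :=
    Real.one_le_rpow ((one_le_div hδ0).2 (by linarith)) hβ0
  refine ⟨C₀ * (3 / δ) ^ β, one_le_mul_of_one_le_of_one_le hC₀ hβ1, fun n hn α x hα hx => ?_⟩
  have hn0 : (0 : ℝ) < n := by exact_mod_cast (by omega : 0 < n)
  have hn1 : (1 : ℝ) ≤ n := by exact_mod_cast (by omega : 1 ≤ n)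
  set s := (n : ℝ) ^ (-(1 / 2) : ℝ) with hs
  have hs0 : 0 < s := by positivity
  have hs1 : s ≤ 1 := Real.rpow_le_one_of_one_le_of_nonpos hn1 (by norm_num)
  -- This is the source of the power of `n` in the final bound.
  have hsβ : s ^ (-β) = (n : ℝ) ^ (a ^ 2 / (8 * Real.pi)) := by
    rw [hs, ← Real.rpow_mul hn0.le]
    congr 1
    rw [hβ]
    field_simp
    ring
  have hconst : 1 ≤ C₀ * (3 / δ) ^ β * (n : ℝ) ^ (a ^ 2 / (8 * Real.pi)) :=
    one_le_mul_of_one_le_of_one_le (one_le_mul_of_one_le_of_one_le hC₀ hβ1)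
      (Real.one_le_rpow hn1 (by positivity))
  have hfac : ∀ k, 1 ≤ (max 1 (ENNReal.ofReal s / nnDist Finset.univ x k)) ^ β := fun k =>
    calc (1 : ℝ≥0∞) = 1 ^ β := (ENNReal.one_rpow β).symm
      _ ≤ _ := ENNReal.rpow_le_rpow (le_max_left _ _) hβ0
  have hone : 1 ≤ ENNReal.ofReal (C₀ * (3 / δ) ^ β * (n : ℝ) ^ (a ^ 2 / (8 * Real.pi))) ^ n :=
    one_le_pow₀ (ENNReal.one_le_ofReal.2 hconst)
  by_cases hinj : Function.Injective x
  swap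
  -- For coinciding points the right side is infinite if `β > 0`; if `β = 0`, all charges vanish and
  -- the weight is `1`.
  · rcases hβ0.eq_or_lt with h0 | hpos
    · have ha0 : a = 0 := by
        rw [hβ, eq_comm, div_eq_zero_iff] at h0
        rcases h0 with h | h
        · exact pow_eq_zero_iff (two_ne_zero) |>.1 h
        · exact absurd h (by positivity)
      have hα0 : α = 0 := norm_eq_zero.1 (hα.trans ha0)
      have : coulombWeight Ω α x = 1 := by simp [coulombWeight, hα0]
      rw [this, ENNReal.ofReal_one]
      exact one_le_mul hone (Finset.one_le_prod' fun k _ => hfac k)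
    · have htop : ∏ k, (max 1 (ENNReal.ofReal s / nnDist Finset.univ x k)) ^ β = ⊤ := by
        rw [Function.Injective] at hinj
        push Not at hinj
        obtain ⟨k, l, hkl, hne⟩ := hinj
        refine top_unique ?_
        refine le_trans (le_of_eq ?_) (Finset.single_le_prod' (f := fun k =>
          (max 1 (ENNReal.ofReal s / nnDist Finset.univ x k)) ^ β) (fun k _ => hfac k)
          (Finset.mem_univ k))
        have hD : nnDist Finset.univ x k = 0 := by
          refine le_antisymm ((nnDist_le (Finset.mem_univ l) (Ne.symm hne)).trans ?_) zero_le
          rw [hkl, edist_self]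
        rw [hD, ENNReal.div_zero (ENNReal.ofReal_pos.2 hs0).ne', max_eq_right le_top,
          ENNReal.top_rpow_of_pos hpos]
      rw [htop, ENNReal.mul_top (zero_lt_one.trans_le hone).ne']
      exact le_top
  set D : Fin n → ℝ := fun k => (nnDist Finset.univ x k).toReal with hD
  have hDpos : ∀ k, 0 < D k := fun k =>
    ENNReal.toReal_pos (nnDist_ne_zero hn hinj k) (nnDist_ne_top hn x k)
  have hDof : ∀ k, nnDist Finset.univ x k = ENNReal.ofReal (D k) := fun k =>
    (ENNReal.ofReal_toReal (nnDist_ne_top hn x k)).symm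
  have hDle : ∀ k l, k ≠ l → D k ≤ ‖x k - x l‖ := by
    intro k l hkl
    have := ENNReal.toReal_mono (edist_ne_top _ _)
      (nnDist_le (x := x) (Finset.mem_univ l) (Ne.symm hkl))
    rwa [← dist_edist, dist_eq_norm] at this
  -- A third of the nearest neighbour distance makes the discs strictly disjoint; `δ` keeps them
  -- inside `Ω`, uniformly over the compact set `L`.
  set r : Fin n → ℝ := fun k => min (D k / 3) δ with hr
  have hr0 : ∀ k, 0 < r k := fun k => lt_min (by have := hDpos k; positivity) hδ0
  have hαk : ∀ k, |α k| ≤ a := fun k => by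
    rw [← Real.norm_eq_abs, ← hα]; exact norm_le_pi_norm α k
  have hweight := hW n α x r hαk hr0 (fun k => (min_le_right _ _).trans hδ1)
    (fun k => by
      refine (Metric.closedBall_subset_closedBall
        ((min_le_right _ _).trans (min_le_left _ _))).trans
        ((Metric.closedBall_subset_cthickening (hx k) δ₀).trans hthick))
    (fun k l hkl => by
      have h1 : r k ≤ D k / 3 := min_le_left _ _
      have h2 : r l ≤ D l / 3 := min_le_left _ _
      have h3 := hDle k l hkl
      have h4 := hDle l k hkl.symm
      rw [norm_sub_rev] at h4
      have := hDpos k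
      linarith)
  have hrβ : ∀ k, r k ^ (-β) ≤ (3 / δ) ^ β * s ^ (-β) * (max 1 (s / D k)) ^ β := by
    intro k
    set w := max 1 (s / D k) with hw
    have hw1 : 1 ≤ w := le_max_left _ _
    have hw0 : 0 < w := one_pos.trans_le hw1
    -- Follows from `s ≤ w * D k` for the first entry of the minimum, and from `s ≤ 1 ≤ w` for the
    -- second.
    have hlow : δ * s / 3 / w ≤ r k := by
      refine le_min ?_ ?_
      · have h1 : s ≤ w * D k := by
          have := le_max_right 1 (s / D k)
          rwa [div_le_iff₀ (hDpos k)] at this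
        rw [div_le_iff₀ hw0]
        have := hDpos k
        nlinarith [mul_le_of_le_one_left hs0.le hδ1]
      · rw [div_le_iff₀ hw0]
        nlinarith [mul_le_of_le_one_right hδ0.le hs1, mul_le_mul_of_nonneg_left hw1 hδ0.le]
    have hlow0 : 0 < δ * s / 3 / w := by positivity
    calc r k ^ (-β) ≤ (δ * s / 3 / w) ^ (-β) :=
          Real.rpow_le_rpow_of_nonpos hlow0 hlow (by linarith)
      _ = (3 / δ) ^ β * s ^ (-β) * w ^ β := by
          have h1 : δ * s / 3 / w = (3 / δ)⁻¹ * s * w⁻¹ := by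
            field_simp
          rw [h1, Real.mul_rpow (by positivity) (by positivity),
            Real.mul_rpow (by positivity) (by positivity), Real.rpow_neg_eq_inv_rpow (3 / δ)⁻¹,
            inv_inv, Real.rpow_neg_eq_inv_rpow w⁻¹, inv_inv]
  have hfinal : coulombWeight Ω α x ≤ (C₀ * (3 / δ) ^ β * (n : ℝ) ^ (a ^ 2 / (8 * Real.pi))) ^ n *
      ∏ k, (max 1 (s / D k)) ^ β := by
    refine hweight.trans ?_
    calc ∏ k, C₀ * r k ^ (-β) ≤ ∏ k, (C₀ * (3 / δ) ^ β * (n : ℝ) ^ (a ^ 2 / (8 * Real.pi))) *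
          (max 1 (s / D k)) ^ β := by
          refine Finset.prod_le_prod (fun k _ => ?_) fun k _ => ?_
          · have := hr0 k
            positivity
          · have := mul_le_mul_of_nonneg_left (hrβ k) (by linarith : 0 ≤ C₀)
            rw [hsβ] at this
            linarith
      _ = _ := by simp [Finset.prod_mul_distrib]
  refine (ENNReal.ofReal_le_ofReal hfinal).trans (le_of_eq ?_)
  rw [ENNReal.ofReal_mul (by positivity), ENNReal.ofReal_pow (by positivity),
    ENNReal.ofReal_prod_of_nonneg fun k _ => by positivity]
  congr 1
  refine Finset.prod_congr rfl fun k _ => ?_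
  rw [← ENNReal.ofReal_rpow_of_pos (by positivity), hDof, ← ENNReal.ofReal_div_of_pos (hDpos k),
    ENNReal.ofReal_max, ENNReal.ofReal_one]

/-- By continuity, a violation at one point of the open set would persist on an open set of positive
measure. -/
lemma enorm_le_of_eLpNorm_top_le (hΩ : IsOpen Ω) {f : ℂ → ℂ} (hf : Continuous f) {M : ℝ≥0∞}
    (hM : eLpNorm f ∞ (volume.restrict Ω) ≤ M) {x : ℂ} (hx : x ∈ Ω) : ‖f x‖ₑ ≤ M := by
  by_contra hlt
  rw [not_le] at hlt
  set U := Ω ∩ {x | M < ‖f x‖ₑ} with hU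
  have hUo : IsOpen U := hΩ.inter (isOpen_lt continuous_const hf.enorm)
  have hpos : 0 < volume U := hUo.measure_pos volume ⟨x, hx, hlt⟩
  have hae : ∀ᵐ y ∂(volume.restrict Ω), ‖f y‖ₑ ≤ M := by
    rw [eLpNorm_exponent_top] at hM
    filter_upwards [enorm_ae_le_eLpNormEssSup f (volume.restrict Ω)] with y hy using hy.trans hM
  rw [ae_restrict_iff' hΩ.measurableSet, ae_iff] at hae
  refine hpos.ne' (measure_mono_null (fun y hy => ?_) hae)
  intro h
  exact absurd (h hy.1) (not_le.2 hy.2)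

lemma lintegral_cons_cons {ν : Measure ℂ} [IsFiniteMeasure ν] {m : ℕ}
    {Φ : (Fin (m + 2) → ℂ) → ℝ≥0∞} (hΦ : Measurable Φ) (x₁ x₂ : ℂ) :
    ∫⁻ y : Fin m → ℂ, Φ (Fin.cons x₁ (Fin.cons x₂ y)) ∂Measure.pi (fun _ => ν) =
      lmarginal (fun _ => ν) (Finset.univ \ {0, 1}) Φ (Fin.cons x₁ (Fin.cons x₂ 0)) := by
  set e : Fin m → Fin (m + 2) := fun j => j.succ.succ with he
  have hinj : Function.Injective e := fun i j h => Fin.succ_injective _ (Fin.succ_injective _ h)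
  set X : Fin (m + 2) → ℂ := Fin.cons x₁ (Fin.cons x₂ 0) with hX
  have himg : Finset.univ.image e = Finset.univ \ {0, 1} := by
    ext k
    simp only [Finset.mem_image, Finset.mem_univ, true_and, Finset.mem_sdiff, Finset.mem_insert,
      Finset.mem_singleton]
    refine Fin.cases ?_ (fun k => Fin.cases ?_ (fun k => ?_) k) k
    · simp [he]
    · simp [he, Fin.ext_iff]
    · simp [he, Fin.ext_iff]
  have hc : Measurable fun y : Fin m → ℂ => (Fin.cons x₁ (Fin.cons x₂ y) : Fin (m + 2) → ℂ) := by
    refine measurable_pi_iff.2 fun k => ?_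
    refine Fin.cases ?_ (fun k => Fin.cases ?_ (fun k => ?_) k) k
    · exact measurable_const
    · exact measurable_const
    · exact measurable_pi_apply k
  have h1 := lmarginal_image (μ := fun _ : Fin (m + 2) => ν) hinj Finset.univ (hΦ.comp hc) X
  rw [lmarginal_univ, himg] at h1
  refine Eq.trans ?_ (h1.symm.trans ?_)
  · rfl
  · refine lintegral_congr fun z => ?_
    simp only [Function.comp]
    congr 1
    funext k
    have h0 : ∀ k ∈ ({0, 1} : Finset (Fin (m + 2))),
        Function.updateFinset X (Finset.univ \ {0, 1}) z k = X k := by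
      intro k hk
      have : k ∉ Finset.univ \ {0, 1} := fun h => (Finset.mem_sdiff.1 h).2 hk
      simp only [Function.updateFinset, this, dite_false]
    refine Fin.cases ?_ (fun k => Fin.cases ?_ (fun k => ?_) k) k
    · rw [h0 0 (by simp)]
      rfl
    · have : (Fin.succ 0 : Fin (m + 2)) = 1 := rfl
      rw [this, h0 1 (by simp)]
      rfl
    · rfl

end Assembly

/-! ### The two-point function. -/

section TwoPoint

variable {Ω : Set ℂ}

lemma enorm_coulombIntegrand {m : ℕ} (α : Fin (m + 2) → ℝ) (f : Fin m → ℂ → ℂ) (x₁ x₂ : ℂ)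
    (y : Fin m → ℂ) : ‖coulombIntegrand Ω α f x₁ x₂ y‖ₑ =
      (∏ j, ‖f j (y j)‖ₑ) * ENNReal.ofReal (coulombWeight Ω α (Fin.cons x₁ (Fin.cons x₂ y))) := by
  have hw : 0 ≤ coulombWeight Ω α (Fin.cons x₁ (Fin.cons x₂ y)) := (Real.exp_pos _).le
  rw [coulombIntegrand, enorm_mul]
  congr 1
  · simp only [enorm_eq_nnnorm, nnnorm_prod, ENNReal.ofNNReal_finsetProd]
  · rw [← ofReal_norm, Complex.norm_real, Real.norm_of_nonneg hw]

/-- The absolute integral of `n` charges, two of which are fixed. -/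
theorem exists_lintegral_coulombIntegrand_le (hΩ : IsOpen Ω) (hb : Bornology.IsBounded Ω) {a : ℝ}
    (ha : a ^ 2 < 4 * Real.pi) {L : Set ℂ} (hL : IsCompact L) (hLΩ : L ⊆ Ω) {M : ℝ≥0∞}
    (hM : M ≠ ⊤) :
    ∃ B : ℝ≥0∞, B ≠ ⊤ ∧ ∀ (m : ℕ) (α : Fin (m + 2) → ℝ) (f : Fin m → ℂ → ℂ), ‖α‖ = a →
      (∀ j, tsupport (f j) ⊆ L) → (∀ j, ∀ x ∈ Ω, ‖f j x‖ₑ ≤ M) → ∀ x₁ ∈ L, ∀ x₂ ∈ L,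
      ∫⁻ y in Set.univ.pi fun _ => Ω, ‖coulombIntegrand Ω α f x₁ x₂ y‖ₑ ≤
        (B * ENNReal.ofReal (((m + 2 : ℕ) : ℝ) ^ (a ^ 2 / (8 * Real.pi)))) ^ (m + 2) *
          pairFactor (a ^ 2 / (4 * Real.pi)) (edist x₁ x₂) := by
  have hpi := Real.pi_pos
  obtain ⟨C, hC, hW⟩ := exists_coulombWeight_le_prod_max hΩ hb ha.le hL hLΩ
  set β := a ^ 2 / (4 * Real.pi) with hβ
  have hβ0 : 0 ≤ β := by positivity
  have hβ1 : β < 1 := (div_lt_one (by positivity)).2 ha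
  set ν : Measure ℂ := volume.restrict Ω with hν
  have hfin : IsFiniteMeasure ν := isFiniteMeasure_restrict.2 hb.measure_lt_top.ne
  set R : ℝ≥0∞ :=
    2 * (1 + ν Set.univ) * recursionConst β (ν Set.univ) * ENNReal.ofReal (Real.exp 1) with hR
  have hRtop : R ≠ ⊤ := by
    have := recursionConst_ne_top β (measure_ne_top ν Set.univ)
    finiteness
  refine ⟨max M 1 * ENNReal.ofReal C * R, by finiteness, fun m α f hα hfL hfM x₁ h₁ x₂ h₂ => ?_⟩
  have hn0 : (0 : ℝ) < (m + 2 : ℕ) := by positivity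
  have hn1 : (1 : ℝ) ≤ (m + 2 : ℕ) := by exact_mod_cast (by omega : 1 ≤ m + 2)
  set s := ((m + 2 : ℕ) : ℝ) ^ (-(1 / 2) : ℝ) with hs
  have hs0 : 0 < s := by positivity
  have hs1 : s ≤ 1 := Real.rpow_le_one_of_one_le_of_nonpos hn1 (by norm_num)
  have hns : (Fintype.card (Fin (m + 2)) : ℝ) * s ^ 2 = 1 := by
    rw [Fintype.card_fin, hs, ← Real.rpow_natCast, ← Real.rpow_mul hn0.le]
    norm_num
    rw [Real.rpow_neg_one]
    exact mul_inv_cancel₀ (by positivity)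
  set Φ : (Fin (m + 2) → ℂ) → ℝ≥0∞ := fun x =>
    ∏ k, (max 1 (ENNReal.ofReal s / nnDist Finset.univ x k)) ^ β with hΦ
  have hΦm : Measurable Φ := Finset.measurable_fun_prod _ fun k _ =>
    (measurable_const.max (measurable_const.div (measurable_nnDist _ k))).pow_const _
  set P := ENNReal.ofReal (C * ((m + 2 : ℕ) : ℝ) ^ (a ^ 2 / (8 * Real.pi))) ^ (m + 2) with hP
  have hpt : ∀ y ∈ Set.univ.pi fun _ : Fin m => Ω, ‖coulombIntegrand Ω α f x₁ x₂ y‖ₑ ≤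
      max M 1 ^ (m + 2) * P * Φ (Fin.cons x₁ (Fin.cons x₂ y)) := by
    intro y hy
    rw [enorm_coulombIntegrand]
    -- The test functions vanish off `L`, so the weight need only be bounded for configurations in a
    -- fixed compact set.
    by_cases hyL : ∀ j, y j ∈ L
    swap
    · push Not at hyL
      obtain ⟨j, hj⟩ := hyL
      have h0 : f j (y j) = 0 := image_eq_zero_of_notMem_tsupport fun h => hj (hfL j h)
      rw [Finset.prod_eq_zero (Finset.mem_univ j) (by rw [h0, enorm_zero]), zero_mul]
      exact zero_le
    · rw [mul_assoc]
      refine mul_le_mul' ?_ (hW (m + 2) (by omega) α _ hα fun k => ?_)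
      -- Using `max M 1` allows the `m` factors to be padded to a power `m + 2`.
      · calc ∏ j, ‖f j (y j)‖ₑ ≤ ∏ _j : Fin m, max M 1 :=
              Finset.prod_le_prod' fun j _ => (hfM j _ (hy j trivial)).trans (le_max_left _ _)
          _ = max M 1 ^ m := by simp
          _ ≤ _ := pow_le_pow_right₀ (le_max_right _ _) (by omega)
      · refine Fin.cases ?_ (fun k => Fin.cases ?_ (fun k => ?_) k) k
        · exact h₁
        · exact h₂
        · exact hyL k
  have hmeas : (volume.restrict (Set.univ.pi fun _ : Fin m => Ω)) = Measure.pi fun _ => ν := by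
    rw [volume_pi, Measure.restrict_pi_pi]
  calc ∫⁻ y in Set.univ.pi fun _ => Ω, ‖coulombIntegrand Ω α f x₁ x₂ y‖ₑ
      ≤ ∫⁻ y in Set.univ.pi fun _ => Ω,
          max M 1 ^ (m + 2) * P * Φ (Fin.cons x₁ (Fin.cons x₂ y)) :=
        setLIntegral_mono' (MeasurableSet.univ_pi fun _ => hΩ.measurableSet) hpt
    _ = max M 1 ^ (m + 2) * P * ∫⁻ y, Φ (Fin.cons x₁ (Fin.cons x₂ y)) ∂Measure.pi fun _ => ν := by
        rw [hmeas, lintegral_const_mul' _ _ (by rw [hP]; finiteness)]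
    _ ≤ max M 1 ^ (m + 2) * P * (R ^ (m + 2) * pairFactor β (edist x₁ x₂)) := by
        rw [lintegral_cons_cons hΦm]
        have := lmarginal_prod_max_le (ν := ν) Measure.restrict_le_self hs0 hs1 hβ0 hβ1 hns
          (p := 0) (q := 1) (by simp) (Fin.cons x₁ (Fin.cons x₂ 0))
        rw [Fintype.card_fin] at this
        exact mul_le_mul_right this _
    _ = _ := by
        rw [hP, ENNReal.ofReal_mul (by linarith)]
        simp only [mul_pow]
        ring

/-- At distances at most `r` the summand `1` of `pairFactor` is at most `(r / |x - y|) ^ (2β)` and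
is absorbed by the singular term. -/
lemma pairFactor_edist_le {β r : ℝ} (hβ : 0 ≤ β) {x y : ℂ} (hxy : x ≠ y) (hr : ‖x - y‖ ≤ r) :
    pairFactor β (edist x y) ≤ ENNReal.ofReal ((1 + r ^ (2 * β)) * ‖x - y‖ ^ (-(2 * β))) := by
  have hd : 0 < ‖x - y‖ := norm_pos_iff.2 (sub_ne_zero.2 hxy)
  have he : edist x y = ENNReal.ofReal ‖x - y‖ := by rw [edist_dist, dist_eq_norm]
  rw [pairFactor, he, one_div, ← ENNReal.ofReal_inv_of_pos hd,
    ENNReal.ofReal_rpow_of_pos (inv_pos.2 hd), ← ENNReal.ofReal_mul (by positivity),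
    ← ENNReal.ofReal_one, ← ENNReal.ofReal_add zero_le_one (by positivity)]
  refine ENNReal.ofReal_le_ofReal ?_
  have h1 : ‖x - y‖⁻¹ ^ β * ‖x - y‖⁻¹ ^ β = ‖x - y‖ ^ (-(2 * β)) := by
    rw [← Real.rpow_neg_eq_inv_rpow, ← Real.rpow_add hd]
    ring_nf
  have h2 : 1 ≤ r ^ (2 * β) * ‖x - y‖ ^ (-(2 * β)) :=
    calc 1 = ‖x - y‖ ^ (2 * β) * ‖x - y‖ ^ (-(2 * β)) := by
          rw [← Real.rpow_add hd, add_neg_cancel, Real.rpow_zero]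
      _ ≤ _ := by gcongr
  rw [h1]
  linarith

theorem exists_coulombTwoPoint_le (hΩ : IsOpen Ω) (hb : Bornology.IsBounded Ω) {a : ℝ}
    (ha : a ^ 2 < 4 * Real.pi) {L : Set ℂ} (hL : IsCompact L) (hLΩ : L ⊆ Ω) {M : ℝ≥0∞}
    (hM : M ≠ ⊤) :
    ∃ C : ℝ, 0 < C ∧ ∀ (m : ℕ) (α : Fin (m + 2) → ℝ) (f : Fin m → ℂ → ℂ), ‖α‖ = a →
      (∀ j, Continuous (f j)) → (∀ j, tsupport (f j) ⊆ L) → (∀ j, ∀ x ∈ Ω, ‖f j x‖ₑ ≤ M) →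
      ∀ x₁ ∈ L, ∀ x₂ ∈ L, x₁ ≠ x₂ →
        IntegrableOn (coulombIntegrand Ω α f x₁ x₂) (Set.univ.pi fun _ => Ω) ∧
        ‖coulombTwoPoint Ω α f x₁ x₂‖ ≤
          ‖x₁ - x₂‖ ^ (-(a ^ 2 / (2 * Real.pi))) * C ^ (m + 2) *
            ((m + 2 : ℕ) : ℝ) ^ (a ^ 2 / (8 * Real.pi) * ((m + 2 : ℕ) : ℝ)) := by
  have hpi := Real.pi_pos
  obtain ⟨B, hB, hint⟩ := exists_lintegral_coulombIntegrand_le hΩ hb ha hL hLΩ hM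
  set β := a ^ 2 / (4 * Real.pi) with hβ
  have hβ0 : 0 ≤ β := by positivity
  have h2β : 2 * β = a ^ 2 / (2 * Real.pi) := by
    rw [hβ]
    field_simp
    ring
  set r := Metric.diam Ω with hr
  have hr0 : 0 ≤ r := Metric.diam_nonneg
  set D := 1 + r ^ (2 * β) with hD
  have hD1 : 1 ≤ D := le_add_of_nonneg_right (by positivity)
  refine ⟨(B.toReal + 1) * D, by positivity, fun m α f hα hf hfL hfM x₁ h₁ x₂ h₂ hne => ?_⟩
  have hn0 : (0 : ℝ) < (m + 2 : ℕ) := by positivity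
  have hd : 0 < ‖x₁ - x₂‖ := norm_pos_iff.2 (sub_ne_zero.2 hne)
  have hdr : ‖x₁ - x₂‖ ≤ r := by
    rw [← dist_eq_norm]
    exact Metric.dist_le_diam_of_mem hb (hLΩ h₁) (hLΩ h₂)
  have hBle : B ≤ ENNReal.ofReal (B.toReal + 1) := by
    rw [← ENNReal.ofReal_toReal hB, ENNReal.toReal_ofReal ENNReal.toReal_nonneg]
    exact ENNReal.ofReal_le_ofReal (by linarith)
  have key : ∫⁻ y in Set.univ.pi fun _ => Ω, ‖coulombIntegrand Ω α f x₁ x₂ y‖ₑ ≤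
      ENNReal.ofReal (‖x₁ - x₂‖ ^ (-(a ^ 2 / (2 * Real.pi))) * ((B.toReal + 1) * D) ^ (m + 2) *
        ((m + 2 : ℕ) : ℝ) ^ (a ^ 2 / (8 * Real.pi) * ((m + 2 : ℕ) : ℝ))) := by
    refine (hint m α f hα hfL hfM x₁ h₁ x₂ h₂).trans ?_
    calc (B * ENNReal.ofReal (((m + 2 : ℕ) : ℝ) ^ (a ^ 2 / (8 * Real.pi)))) ^ (m + 2) *
          pairFactor β (edist x₁ x₂)
        ≤ (ENNReal.ofReal (B.toReal + 1) *
            ENNReal.ofReal (((m + 2 : ℕ) : ℝ) ^ (a ^ 2 / (8 * Real.pi)))) ^ (m + 2) *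
          ENNReal.ofReal (D * ‖x₁ - x₂‖ ^ (-(2 * β))) := by
          gcongr
          exact pairFactor_edist_le hβ0 hne hdr
      _ = ENNReal.ofReal (((B.toReal + 1) * ((m + 2 : ℕ) : ℝ) ^ (a ^ 2 / (8 * Real.pi))) ^ (m + 2) *
          (D * ‖x₁ - x₂‖ ^ (-(2 * β)))) := by
          rw [← ENNReal.ofReal_mul (by positivity), ← ENNReal.ofReal_pow (by positivity),
            ← ENNReal.ofReal_mul (by positivity)]
      _ ≤ _ := by
          refine ENNReal.ofReal_le_ofReal ?_
          rw [h2β, mul_pow, mul_pow, Real.rpow_mul hn0.le, Real.rpow_natCast]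
          -- The factor `D` occurs only once; as `D ≥ 1` it can be put into the base of the power.
          have hDp : D ≤ D ^ (m + 2) := le_self_pow₀ hD1 (by omega)
          calc _ = ‖x₁ - x₂‖ ^ (-(a ^ 2 / (2 * Real.pi))) * ((B.toReal + 1) ^ (m + 2) * D) *
                (((m + 2 : ℕ) : ℝ) ^ (a ^ 2 / (8 * Real.pi))) ^ (m + 2) := by ring
            _ ≤ _ := by gcongr
  refine ⟨⟨aestronglyMeasurable_coulombIntegrand hΩ α hf (hLΩ h₁) (hLΩ h₂),
    key.trans_lt ENNReal.ofReal_lt_top⟩, ?_⟩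
  have h3 := (enorm_integral_le_lintegral_enorm
    (μ := volume.restrict (Set.univ.pi fun _ : Fin m => Ω)) (coulombIntegrand Ω α f x₁ x₂)).trans key
  rw [← ofReal_norm] at h3
  exact (ENNReal.ofReal_le_ofReal_iff (by positivity)).1 h3

end TwoPoint

/-- The constant `C` depends only on `Ω`, `K`, `a = ‖α‖ = max_i |α_i|`, the union `S` of the
supports and the largest `L^∞` norm `M`; the number of points is `n = m + 2 ≥ 3`. -/
theorem proposition3p7 (Ω : Set ℂ) (hΩ : IsOpen Ω) (hΩb : Bornology.IsBounded Ω)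
    (hΩs : HasSmoothBoundary Ω) (K : Set ℂ) (hK : IsCompact K) (hKΩ : K ⊆ Ω)
    (a : ℝ) (S : Set ℂ) (M : ℝ≥0∞) :
    ∃ C : ℝ, 0 < C ∧ ∀ (m : ℕ), 1 ≤ m → ∀ (α : Fin (m + 2) → ℝ) (f : Fin m → ℂ → ℂ),
      (∀ i, α i ∈ Set.Ioo (-√(4 * Real.pi)) √(4 * Real.pi)) → ‖α‖ = a →
      (∀ j, IsTestFunction Ω (f j)) → (⋃ j, tsupport (f j)) = S →
      (⨆ j, eLpNorm (f j) ∞ (volume.restrict Ω)) = M →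
      ∀ x₁ ∈ K, ∀ x₂ ∈ K, x₁ ≠ x₂ →
        IntegrableOn (coulombIntegrand Ω α f x₁ x₂) (Set.univ.pi fun _ => Ω) ∧
        ‖coulombTwoPoint Ω α f x₁ x₂‖ ≤
          ‖x₁ - x₂‖ ^ (-(‖α‖ ^ 2 / (2 * Real.pi))) * C ^ (m + 2) *
            ((m + 2 : ℕ) : ℝ) ^ (‖α‖ ^ 2 / (8 * Real.pi) * ((m + 2 : ℕ) : ℝ)) := by
  -- Since `C` is chosen before the charges and test functions, the parameters `a`, `S`, `M` may be
  -- attained by none; if these conditions fail, no data attain them and any `C` will do.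
  by_cases h : a ^ 2 < 4 * Real.pi ∧ IsCompact S ∧ S ⊆ Ω ∧ M ≠ ⊤
  · obtain ⟨ha, hS, hSΩ, hM⟩ := h
    obtain ⟨C, hC, hmain⟩ :=
      exists_coulombTwoPoint_le hΩ hΩb ha (hS.union hK) (Set.union_subset hSΩ hKΩ) hM
    refine ⟨C, hC, fun m _ α f _ hαa hf hfS hfM x₁ h₁ x₂ h₂ hne => ?_⟩
    rw [hαa]
    refine hmain m α f hαa (fun j => (hf j).1.continuous) (fun j => ?_) (fun j x hx => ?_)
      x₁ (Or.inr h₁) x₂ (Or.inr h₂) hne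
    · rw [← hfS]
      exact (Set.subset_iUnion (fun j => tsupport (f j)) j).trans Set.subset_union_left
    · refine enorm_le_of_eLpNorm_top_le hΩ (hf j).1.continuous ?_ hx
      rw [← hfM]
      exact le_iSup (fun j => eLpNorm (f j) ∞ (volume.restrict Ω)) j
  · refine ⟨1, one_pos, fun m hm α f hα hαa hf hfS hfM => absurd ⟨?_, ?_, ?_, ?_⟩ h⟩
    · have hpos : 0 < √(4 * Real.pi) := Real.sqrt_pos.2 (by positivity)
      have h1 : a < √(4 * Real.pi) := by
        rw [← hαa, pi_norm_lt_iff hpos]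
        exact fun i => abs_lt.2 (hα i)
      rw [← Real.sq_sqrt (show 0 ≤ 4 * Real.pi by positivity)]
      exact pow_lt_pow_left₀ h1 (hαa ▸ norm_nonneg α) two_ne_zero
    · rw [← hfS]
      exact isCompact_iUnion fun j => (hf j).2.1
    · rw [← hfS]
      exact Set.iUnion_subset fun j => (hf j).2.2
    · have : Nonempty (Fin m) := ⟨⟨0, hm⟩⟩
      obtain ⟨j, hj⟩ := exists_eq_ciSup_of_finite
        (f := fun j => eLpNorm (f j) ∞ (volume.restrict Ω))
      rw [← hfM, ← hj]
      exact ((hf j).1.continuous.memLp_top_of_hasCompactSupport (hf j).2.1 _).2.ne
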